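/- **Setting.** Let $p,q,m,n,d\ge 0$ be integers, $\mathbf z=(z_1,\dots,z_{p+q+m+n})\in\mathbb C^{p+q+m+n}$ and $\mathbf w=(w_1,\dots,w_d)\in\mathbb C^d$. Let $\mathbf s=(s_1,\dots,s_{p+q+m+n})=(0^p,1^q,0^m,1^n)$ and $|i|=s_i\in\mathbb Z_2$. *Current superalgebras.* $\mathfrak{gl}_{p+q|m+n}$ (notation for the general linear Lie superalgebra on $\mathbb C^{p|q}\oplus\mathbb C^{m|n}$) has the basis $E^i_j$, $1\le i,j\le p+q+m+n$, of parity $|i|+|j|$, with $[E^i_j,E^k_l]=\delta_{jk}E^i_l-(-1)^{(|i|+|j|)(|k|+|l|)}\delta_{il}E^k_j$; $\mathfrak{gl}_d$ has the usual basis $e_{ab}$. For $\mathfrak g$ either of them, $\mathfrak g[t]=\mathfrak g\otimes\mathbb C[t]$, $A[k]=A\otimes t^k$, and $A(z)=\sum_{k\ge 0}A[k]z^{-k-1}$. *Pseudo-differential operators.* For an associative unital superalgebra $\mathcal A$, $\mathcal A(\!(z^{-1},\partial_z^{-1})\!)$ is the algebra of formal series $\sum_{i\le r,\,j\le s}a_{ij}z^i\partial_z^j$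 ($r,s\in\mathbb Z$, $a_{ij}\in\mathcal A$) in which $z,\partial_z$ commute with $\mathcal A$, $\partial_z\partial_z^{-1}=\partial_z^{-1}\partial_z=1$ and $\partial_z^iz^j=\sum_{k\ge0}\binom ik\binom jk k!\,z^{j-k}\partial_z^{i-k}$ for $i,j\in\mathbb Z$. Homomorphisms of coefficient algebras are extended coefficientwise, and rational functions of $z$ stand for their expansions at $\infty$. *Weyl superalgebra.* $\mathcal D$ is the Weyl superalgebra generated by variables $y^a_r$ ($1\le r\le p+q$, of parity $|r|$) and $x^a_i$ ($1\le i\le m+n$, of parity $|p+q+i|$), $1\le a\le d$, and their derivatives $\partial_{y^a_r},\partial_{x^a_i}$. Let $\omega:\mathcal D\to\mathcal D$ be the anti-involution ($\omega(fg)=\omega(g)\omega(f)$, without signs) with $x^a_i\leftrightarrow\partial_{x^a_i}$, $y^a_r\leftrightarrow\partial_{y^a_r}$, extended to $\mathcal D(\!(z^{-1},\partial_z^{-1})\!)$ by $\omega(f z^i\partial_z^j)=\omega(f)z^j\partial_z^i$. Let $\phi_{\mathbf z}:U(\mathfrak{gl}_d[t])\to\mathcal D$ and $\varphi_{\mathbf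 w}:U(\mathfrak{gl}_{p+q|m+n}[t])\to\mathcal D$ be the homomorphisms with $$\phi_{\mathbf z}(e_{ab}[k])=-\sum_{r=1}^{p+q}z_r^k\,y^b_r\partial_{y^a_r}+\sum_{i=1}^{m+n}z_{p+q+i}^k\,x^a_i\partial_{x^b_i},$$ $$\varphi_{\mathbf w}(E^r_s[k])=\sum_{a=1}^d(-1)^{|s|+1}w_a^k\,\partial_{y^a_r}y^a_s,\qquad \varphi_{\mathbf w}(E^r_{p+q+j}[k])=\sum_{a=1}^d w_a^k\,\partial_{y^a_r}\partial_{x^a_j},$$ $$\varphi_{\mathbf w}(E^{p+q+i}_s[k])=\sum_{a=1}^d(-1)^{|s|+1}w_a^k\,x^a_iy^a_s,\qquad \varphi_{\mathbf w}(E^{p+q+i}_{p+q+j}[k])=\sum_{a=1}^d w_a^k\,x^a_i\partial_{x^a_j},$$ for $1\le a,b\le d$, $1\le r,s\le p+q$, $1\le i,j\le m+n$, $k\ge0$. *Matrices and determinants.* Put $$\mathcal L_d^{\mathbf w}=\big[\delta_{ab}(\partial_z-w_a)-e_{ab}(z)\big]_{a,b=1}^d,\qquad \mathcal L_{p+q|m+n}^{\mathbf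 z}=\big[\delta_{ij}(\partial_z-z_i)-(-1)^{|i|}E^i_j(z)\big]_{i,j=1}^{p+q+m+n}.$$ For a $k\times k$ matrix $A$ over a ring, $\operatorname{cdet}(A)=\sum_{\sigma\in\mathfrak S_k}(-1)^{l(\sigma)}a_{\sigma(1),1}\cdots a_{\sigma(k),k}$. The principal quasiminor $d_i(A)$ is $\big((A_i^{-1})_{ii}\big)^{-1}$, where $A_i$ is the upper left $i\times i$ submatrix of $A$; it is defined if $A_i$ and $(A_i^{-1})_{ii}$ are invertible. $A$ is sufficiently invertible if all $d_i(A)$ are defined, and then $\operatorname{Ber}^{\mathbf s}(A)=d_1(A)^{(-1)^{s_1}}\cdots d_k(A)^{(-1)^{s_k}}$. Finally let $$R_{p|q}(z)=\frac{(z-z_1)\cdots(z-z_p)}{(z-z_{p+1})\cdots(z-z_{p+q})},\qquad R'_{m|n}(z)=\frac{(z-z_{p+q+1})\cdots(z-z_{p+q+m})}{(z-z_{p+q+m+1})\cdots(z-z_{p+q+m+n})}.$$ **Proposition.** The matrix $\mathcal L_{p+q|m+n}^{\mathbf z}$ over $U(\mathfrak{gl}_{p+q|m+n}[t])(\!(z^{-1},\partial_z^{-1})\!)$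 is sufficiently invertible, so that its Berezinian of type $\mathbf s$ is defined, and in $\mathcal D(\!(z^{-1},\partial_z^{-1})\!)$ $$(z-w_1)\cdots(z-w_d)\cdot\varphi_{\mathbf w}\operatorname{Ber}^{\mathbf s}\big(\mathcal L_{p+q|m+n}^{\mathbf z}\big)=\omega\Big(R'_{m|n}(z)\cdot\phi_{\mathbf z}\operatorname{cdet}\big(\mathcal L_d^{\mathbf w}\big)\cdot R_{p|q}(z)\Big).$$ -/

import Mathlib

noncomputable section

namespace BetheDuality

open scoped Nat

/-- Pseudo-differential operators `A((z⁻¹, ∂_z⁻¹))` over a ring `A`: the formal series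
`∑_{i ≤ r} ∑_{j ≤ s} a_{ij} z^i ∂_z^j` with integer exponents bounded above;
`coeff i j` is the coefficient `a_{ij} ∈ A` of `z^i ∂_z^j`. -/
@[ext]
structure PseudoDiff (A : Type*) [Ring A] where
  coeff : ℤ → ℤ → A
  bounded : ∃ r s : ℤ, ∀ i j : ℤ, (r < i ∨ s < j) → coeff i j = 0

namespace PseudoDiff

variable {A : Type*} [Ring A]

/-- The coefficient `binom(j,t) binom(k,t) t!` of `z^{k-t} ∂^{j-t}` in the expansion
`∂^j z^k = ∑_t binom(j,t) binom(k,t) t! z^{k-t} ∂^{j-t}`, for integers `j`, `k`. -/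
def contr (j k : ℤ) (t : ℕ) : ℤ := Ring.choose j t * Ring.choose k t * (t ! : ℤ)

/-- The coefficient of `z^M ∂^N` in the product of `f = ∑ f_{ij} z^i ∂^j` and `g = ∑ g_{kl} z^k ∂^l`,
where `∂^j z^k` is expanded as above: the terms are
`contr j k t • (f_{ij} g_{kl}) z^{i+k-t} ∂^{j+l-t}` with `k = M - i + t` and `l = N - j + t`.
Only finitely many of them are nonzero. -/
def mulCoeff (f g : ℤ → ℤ → A) (M N : ℤ) : A :=
  ∑ᶠ x : ℕ × ℤ × ℤ, contr x.2.2 (M - x.2.1 + x.1) x.1 •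
    (f x.2.1 x.2.2 * g (M - x.2.1 + x.1) (N - x.2.2 + x.1))

theorem contr_zero (j k : ℤ) : contr j k 0 = 1 := by simp [contr]

theorem contr_zero_left (k : ℤ) (t : ℕ) (ht : t ≠ 0) : contr 0 k t = 0 := by
  simp [contr, Ring.choose_zero_ite, ht]

theorem contr_zero_right (k : ℤ) (t : ℕ) (ht : t ≠ 0) : contr k 0 t = 0 := by
  simp [contr, Ring.choose_zero_ite, ht]

/-- The exponents of `f` are bounded above by `r` and `s`. -/
def Bdd (f : ℤ → ℤ → A) (r s : ℤ) : Prop := ∀ i j : ℤ, (r < i ∨ s < j) → f i j = 0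

theorem Bdd.le {f : ℤ → ℤ → A} {r s : ℤ} (h : Bdd f r s) {i j : ℤ} (hf : f i j ≠ 0) :
    i ≤ r ∧ j ≤ s := by
  constructor <;> by_contra! hc
  · exact hf (h i j (Or.inl hc))
  · exact hf (h i j (Or.inr hc))

theorem finite_mul_support {f g : ℤ → ℤ → A} {r s r' s' : ℤ} (hf : Bdd f r s) (hg : Bdd g r' s')
    (M N : ℤ) : (fun x : ℕ × ℤ × ℤ => contr x.2.2 (M - x.2.1 + x.1) x.1 •
    (f x.2.1 x.2.2 * g (M - x.2.1 + x.1) (N - x.2.2 + x.1))).support.Finite := by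
  refine ((Set.finite_Icc 0 (r + r' - M).toNat).prod ((Set.finite_Icc (M - r') r).prod
    (Set.finite_Icc (N - s') s))).subset ?_
  rintro ⟨t, i, j⟩ hx
  simp only [Function.mem_support] at hx
  have h0 := right_ne_zero_of_smul hx
  have h1 := hf.le (left_ne_zero_of_mul h0)
  have h2 := hg.le (right_ne_zero_of_mul h0)
  simp only [Set.mem_prod, Set.mem_Icc]
  omega

theorem bdd_mulCoeff {f g : ℤ → ℤ → A} {r s r' s' : ℤ} (hf : Bdd f r s) (hg : Bdd g r' s') :
    Bdd (mulCoeff f g) (r + r') (s + s') := by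
  intro M N h
  refine finsum_eq_zero_of_forall_eq_zero ?_
  rintro ⟨t, i, j⟩
  by_contra hx
  have h0 := right_ne_zero_of_smul hx
  have h1 := hf.le (left_ne_zero_of_mul h0)
  have h2 := hg.le (right_ne_zero_of_mul h0)
  simp only at h1 h2
  omega

theorem finsum_antidiag {P : Type*} (F : P × ℕ → A) (G : P × ℕ × ℕ → A)
    (hG : G.support.Finite)
    (h : ∀ p u, F (p, u) = ∑ bc ∈ Finset.HasAntidiagonal.antidiagonal u, G (p, bc)) :
    ∑ᶠ x, F x = ∑ᶠ y, G y := by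
  classical
  set S := hG.toFinset with hS
  set π : P × ℕ × ℕ → P × ℕ := fun y => (y.1, y.2.1 + y.2.2) with hπ
  have hF : ∀ x, F x = ∑ y ∈ S with π y = x, G y := by
    rintro ⟨p, u⟩
    rw [h p u]
    refine (Finset.sum_map (Finset.HasAntidiagonal.antidiagonal u)
      ⟨fun bc => (p, bc), fun _ _ h => (Prod.mk.inj h).2⟩ G).symm.trans ?_
    symm
    refine Finset.sum_subset ?_ ?_
    · rintro ⟨p', b, c⟩ hy
      simp only [Finset.mem_filter, hπ, Prod.mk.injEq] at hy
      obtain ⟨-, rfl, hu⟩ := hy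
      exact Finset.mem_map.2 ⟨(b, c), Finset.HasAntidiagonal.mem_antidiagonal.2 hu, rfl⟩
    · rintro ⟨p', b, c⟩ hy hn
      obtain ⟨⟨b', c'⟩, h1, h2⟩ := Finset.mem_map.1 hy
      rw [Finset.HasAntidiagonal.mem_antidiagonal] at h1
      obtain ⟨rfl, rfl, rfl⟩ : p = p' ∧ b' = b ∧ c' = c := by
        have h3 : (p, (b', c')) = (p', (b, c)) := h2
        simpa only [Prod.mk.injEq] using h3
      by_contra hne
      exact hn (by simp [hS, hπ, h1, hne])
  rw [finsum_eq_sum G hG, finsum_eq_sum_of_support_subset (s := S.image π) F,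
    ← Finset.sum_fiberwise_of_maps_to (s := S) (t := S.image π) (g := π)
      (fun y hy => Finset.mem_image_of_mem _ hy)]
  · exact Finset.sum_congr rfl fun x _ => hF x
  · intro x hx
    rw [Function.mem_support, hF x] at hx
    obtain ⟨y, hy, -⟩ := Finset.exists_ne_zero_of_sum_ne_zero hx
    rw [Finset.mem_filter] at hy
    exact Finset.mem_coe.2 (Finset.mem_image.2 ⟨y, hy.1, hy.2⟩)

theorem choose_fall (x : ℤ) (a c : ℕ) :
    Ring.choose x (a + c) * ((a + c)! : ℤ) =
      (Ring.choose x a * (a ! : ℤ)) * (Ring.choose (x - a) c * (c ! : ℤ)) := by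
  have h := Ring.choose_smul_choose x (Nat.le_add_right a c)
  have h2 : ((a + c).choose a * a ! * c ! : ℤ) = (a + c)! := by
    have := Nat.choose_mul_factorial_mul_factorial (Nat.le_add_right a c)
    rw [Nat.add_sub_cancel_left] at this
    exact_mod_cast this
  rw [Nat.add_sub_cancel_left, nsmul_eq_mul] at h
  rw [← h2]
  linear_combination (a ! * c ! : ℤ) * h

/-- Auxiliary weight in the proof of associativity. -/
def weight (j k l m : ℤ) (a b c : ℕ) : ℤ :=
  Ring.choose j a * Ring.choose (j - a) c * Ring.choose l b *
    (Ring.choose k a * (a ! : ℤ)) * (Ring.choose m (b + c) * ((b + c)! : ℤ))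

theorem contr_left (j k l m : ℤ) (t u : ℕ) :
    contr (j + l - t) m u * contr j k t =
      ∑ bc ∈ Finset.HasAntidiagonal.antidiagonal u, weight j k l m t bc.1 bc.2 := by
  have h : Ring.choose (j + l - t) u = ∑ bc ∈ Finset.HasAntidiagonal.antidiagonal u,
      Ring.choose l bc.1 * Ring.choose (j - t) bc.2 := by
    rw [← Ring.add_choose_eq u (Commute.all l (j - t))]
    congr 1; ring
  rw [contr, h, Finset.sum_mul, Finset.sum_mul, Finset.sum_mul]
  refine Finset.sum_congr rfl fun bc hbc => ?_
  rw [Finset.HasAntidiagonal.mem_antidiagonal] at hbc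
  rw [weight, contr, hbc]
  ring

theorem contr_right (j k l m : ℤ) (v w : ℕ) :
    contr j (k + m - v) w * contr l m v =
      ∑ ac ∈ Finset.HasAntidiagonal.antidiagonal w, weight j k l m ac.1 v ac.2 := by
  have h : Ring.choose (k + m - v) w = ∑ ac ∈ Finset.HasAntidiagonal.antidiagonal w,
      Ring.choose k ac.1 * Ring.choose (m - v) ac.2 := by
    rw [← Ring.add_choose_eq w (Commute.all k (m - v))]
    congr 1; ring
  rw [contr, h, Finset.mul_sum, Finset.sum_mul, Finset.sum_mul]
  refine Finset.sum_congr rfl fun ac hac => ?_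
  rw [Finset.HasAntidiagonal.mem_antidiagonal] at hac
  have h1 := choose_fall j ac.1 ac.2
  rw [hac] at h1
  rw [weight, contr, choose_fall m v ac.2]
  linear_combination (Ring.choose k ac.1 * Ring.choose (m - v) ac.2 *
    (Ring.choose l v * Ring.choose m v * (v ! : ℤ))) * h1

theorem finite_triple {Q : Type*} {f g h : ℤ → ℤ → A} {r s r' s' r'' s'' : ℤ} (hf : Bdd f r s)
    (hg : Bdd g r' s') (hh : Bdd h r'' s'') (M N : ℤ) (F : Q → A)
    (e : Q → (ℕ × ℤ × ℤ × ℤ × ℤ) × (ℕ × ℕ)) (he : Function.Injective e)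
    (hF : ∀ q, F q ≠ 0 → ∃ a i j k l b c, e q = ((a, i, j, k, l), (b, c)) ∧ f i j ≠ 0 ∧
      g k l ≠ 0 ∧ h (M - i - k + (a + b + c : ℕ)) (N - j - l + (a + b + c : ℕ)) ≠ 0) :
    F.support.Finite := by
  set K := (r + r' + r'' - M).toNat
  refine Set.Finite.subset (Set.Finite.preimage he.injOn
    (((Set.finite_Icc 0 K).prod ((Set.finite_Icc (M - r' - r'') r).prod
      ((Set.finite_Icc (N - s' - s'') s).prod ((Set.finite_Icc (M - r - r'') r').prod
      (Set.finite_Icc (N - s - s'') s'))))).prod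
      ((Set.finite_Icc 0 K).prod (Set.finite_Icc 0 K)))) ?_
  intro q hq
  obtain ⟨a, i, j, k, l, b, c, h0, h1, h2, h3⟩ := hF q hq
  have h1 := hf.le h1
  have h2 := hg.le h2
  have h3 := hh.le h3
  simp only [Set.mem_preimage, h0, Set.mem_prod, Set.mem_Icc]
  omega

/-- Auxiliary: the common expansion of `(f g) h` and `f (g h)`. -/
def triple (f g h : ℤ → ℤ → A) (M N : ℤ) (x : (ℕ × ℤ × ℤ × ℤ × ℤ) × (ℕ × ℕ)) : A :=
  match x with
  | ((a, i, j, k, l), (b, c)) =>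
    weight j k l (M - i - k + (a + b + c : ℕ)) a b c • (f i j * g k l *
      h (M - i - k + (a + b + c : ℕ)) (N - j - l + (a + b + c : ℕ)))

/-- Auxiliary reindexing. -/
def eqvL : (ℕ × ℤ × ℤ × ℤ × ℤ) × ℕ ≃ (ℕ × ℤ × ℤ) × (ℕ × ℤ × ℤ) where
  toFun x := ((x.2, x.1.2.1 + x.1.2.2.2.1 - x.1.1, x.1.2.2.1 + x.1.2.2.2.2 - x.1.1),
    (x.1.1, x.1.2.1, x.1.2.2.1))
  invFun y := ((y.2.1, y.2.2.1, y.2.2.2, y.1.2.1 - y.2.2.1 + y.2.1, y.1.2.2 - y.2.2.2 + y.2.1),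
    y.1.1)
  left_inv := by rintro ⟨⟨t, i, j, k, l⟩, u⟩; ext <;> simp <;> ring
  right_inv := by rintro ⟨⟨u, I, J⟩, ⟨t, i, j⟩⟩; ext <;> simp <;> ring

/-- Auxiliary reindexing. -/
def eqvR : (ℕ × ℤ × ℤ × ℤ × ℤ) × ℕ ≃ (ℕ × ℤ × ℤ) × (ℕ × ℤ × ℤ) where
  toFun x := ((x.2, x.1.2.1, x.1.2.2.1), (x.1.1, x.1.2.2.2.1, x.1.2.2.2.2))
  invFun y := ((y.2.1, y.1.2.1, y.1.2.2, y.2.2.1, y.2.2.2), y.1.1)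
  left_inv := by rintro ⟨⟨t, i, j, k, l⟩, u⟩; rfl
  right_inv := by rintro ⟨⟨u, I, J⟩, ⟨t, i, j⟩⟩; rfl

/-- Auxiliary reindexing. -/
def eqvS : (ℕ × ℤ × ℤ × ℤ × ℤ) × (ℕ × ℕ) ≃ (ℕ × ℤ × ℤ × ℤ × ℤ) × (ℕ × ℕ) where
  toFun x := ((x.2.1, x.1.2), (x.1.1, x.2.2))
  invFun x := ((x.2.1, x.1.2), (x.1.1, x.2.2))
  left_inv _ := rfl
  right_inv _ := rfl

theorem finite_triple_support {f g h : ℤ → ℤ → A} {r s r' s' r'' s'' : ℤ} (hf : Bdd f r s)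
    (hg : Bdd g r' s') (hh : Bdd h r'' s'') (M N : ℤ) : (triple f g h M N).support.Finite := by
  refine finite_triple hf hg hh M N _ id Function.injective_id ?_
  rintro ⟨⟨a, i, j, k, l⟩, b, c⟩ hq
  have h0 := right_ne_zero_of_smul hq
  exact ⟨a, i, j, k, l, b, c, rfl, left_ne_zero_of_mul (left_ne_zero_of_mul h0),
    right_ne_zero_of_mul (left_ne_zero_of_mul h0), right_ne_zero_of_mul h0⟩

theorem mulCoeff_left {f g h : ℤ → ℤ → A} {r s r' s' r'' s'' : ℤ} (hf : Bdd f r s)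
    (hg : Bdd g r' s') (hh : Bdd h r'' s'') (M N : ℤ) :
    mulCoeff (mulCoeff f g) h M N = ∑ᶠ x, triple f g h M N x := by
  let Φ : (ℕ × ℤ × ℤ) × (ℕ × ℤ × ℤ) → A := fun z =>
    (contr z.1.2.2 (M - z.1.2.1 + z.1.1) z.1.1 *
      contr z.2.2.2 (z.1.2.1 - z.2.2.1 + z.2.1) z.2.1) •
    (f z.2.2.1 z.2.2.2 * g (z.1.2.1 - z.2.2.1 + z.2.1) (z.1.2.2 - z.2.2.2 + z.2.1) *
      h (M - z.1.2.1 + z.1.1) (N - z.1.2.2 + z.1.1))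
  have h1 : mulCoeff (mulCoeff f g) h M N = ∑ᶠ x, ∑ᶠ y, Φ (x, y) := by
    rw [mulCoeff]
    refine finsum_congr fun x => ?_
    rw [mulCoeff, finsum_mul' _ _ (finite_mul_support hf hg _ _),
      smul_finsum' _ (((finite_mul_support hf hg _ _).subset
        (Function.support_mul_subset_left _ _)))]
    refine finsum_congr fun y => ?_
    simp only [Φ]
    rw [smul_mul_assoc, smul_smul]
  have h2 : ∀ p u, (Φ ∘ eqvL) (p, u) =
      ∑ bc ∈ Finset.HasAntidiagonal.antidiagonal u, triple f g h M N (p, bc) := by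
    rintro ⟨t, i, j, k, l⟩ u
    have e1 : i + k - (t : ℤ) - i + t = k := by ring
    have e2 : j + l - (t : ℤ) - j + t = l := by ring
    have e3 : M - (i + k - (t : ℤ)) + u = M - i - k + (t + u : ℕ) := by push_cast; ring
    have e4 : N - (j + l - (t : ℤ)) + u = N - j - l + (t + u : ℕ) := by push_cast; ring
    simp only [Φ, eqvL, Function.comp_apply, Equiv.coe_fn_mk]
    rw [e1, e2, e3, e4, contr_left, Finset.sum_smul]
    refine Finset.sum_congr rfl fun bc hbc => ?_
    rw [Finset.HasAntidiagonal.mem_antidiagonal] at hbc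
    obtain ⟨b, c⟩ := bc
    simp only at hbc
    subst hbc
    simp only [triple, add_assoc]
  have h3 : (Φ ∘ eqvL).support.Finite := by
    refine finite_triple hf hg hh M N _ (fun x => (x.1, (x.2, 0))) ?_ ?_
    · rintro ⟨p, u⟩ ⟨p', u'⟩ hx
      simp only [Prod.mk.injEq, and_true] at hx
      simp [hx]
    rintro ⟨⟨t, i, j, k, l⟩, u⟩ hq
    refine ⟨t, i, j, k, l, u, 0, rfl, ?_⟩
    rw [h2] at hq
    obtain ⟨⟨b, c⟩, hbc, hne⟩ := Finset.exists_ne_zero_of_sum_ne_zero hq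
    have h0 := right_ne_zero_of_smul hne
    rw [Finset.HasAntidiagonal.mem_antidiagonal] at hbc
    simp only at hbc
    subst hbc
    rw [add_assoc t b c] at h0
    exact ⟨left_ne_zero_of_mul (left_ne_zero_of_mul h0),
      right_ne_zero_of_mul (left_ne_zero_of_mul h0), right_ne_zero_of_mul h0⟩
  have h4 : Φ.support.Finite := by
    have : Φ = (Φ ∘ eqvL) ∘ eqvL.symm := by ext; simp
    rw [this, Function.support_comp_eq_preimage]
    exact h3.preimage eqvL.symm.injective.injOn
  rw [h1, ← finsum_curry _ h4, ← finsum_comp_equiv eqvL]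
  exact finsum_antidiag (Φ ∘ eqvL) _ (finite_triple_support hf hg hh M N) h2

theorem mulCoeff_right {f g h : ℤ → ℤ → A} {r s r' s' r'' s'' : ℤ} (hf : Bdd f r s)
    (hg : Bdd g r' s') (hh : Bdd h r'' s'') (M N : ℤ) :
    mulCoeff f (mulCoeff g h) M N = ∑ᶠ x, triple f g h M N x := by
  let Φ : (ℕ × ℤ × ℤ) × (ℕ × ℤ × ℤ) → A := fun z =>
    (contr z.1.2.2 (M - z.1.2.1 + z.1.1) z.1.1 *
      contr z.2.2.2 (M - z.1.2.1 + z.1.1 - z.2.2.1 + z.2.1) z.2.1) •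
    (f z.1.2.1 z.1.2.2 * g z.2.2.1 z.2.2.2 *
      h (M - z.1.2.1 + z.1.1 - z.2.2.1 + z.2.1) (N - z.1.2.2 + z.1.1 - z.2.2.2 + z.2.1))
  have h1 : mulCoeff f (mulCoeff g h) M N = ∑ᶠ x, ∑ᶠ y, Φ (x, y) := by
    rw [mulCoeff]
    refine finsum_congr fun x => ?_
    rw [mulCoeff, mul_finsum' _ _ (finite_mul_support hg hh _ _),
      smul_finsum' _ (((finite_mul_support hg hh _ _).subset
        (Function.support_mul_subset_right _ _)))]
    refine finsum_congr fun y => ?_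
    simp only [Φ]
    rw [mul_smul_comm, smul_smul, mul_assoc]
  have h2 : ∀ p u, (Φ ∘ eqvR) (p, u) =
      ∑ bc ∈ Finset.HasAntidiagonal.antidiagonal u, (triple f g h M N ∘ eqvS) (p, bc) := by
    rintro ⟨v, i, j, k, l⟩ w
    have e3 : M - i + w - k + v = M - i - k + (w + v : ℕ) := by push_cast; ring
    have e4 : N - j + w - l + v = N - j - l + (w + v : ℕ) := by push_cast; ring
    have e5 : M - i + w = k + (M - i - k + (w + v : ℕ)) - v := by push_cast; ring
    simp only [Φ, eqvR, Function.comp_apply, Equiv.coe_fn_mk]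
    rw [e3, e4, e5, contr_right, Finset.sum_smul]
    refine Finset.sum_congr rfl fun ac hac => ?_
    rw [Finset.HasAntidiagonal.mem_antidiagonal] at hac
    obtain ⟨a, c⟩ := ac
    simp only at hac
    subst hac
    have e6 : a + c + v = a + v + c := by ring
    simp only [triple, eqvS, Equiv.coe_fn_mk, e6]
  have h5 : (triple f g h M N ∘ eqvS).support.Finite := by
    rw [Function.support_comp_eq_preimage]
    exact (finite_triple_support hf hg hh M N).preimage eqvS.injective.injOn
  have h3 : (Φ ∘ eqvR).support.Finite := by
    refine finite_triple hf hg hh M N _ (fun x => (x.1, (x.2, 0))) ?_ ?_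
    · rintro ⟨p, u⟩ ⟨p', u'⟩ hx
      simp only [Prod.mk.injEq, and_true] at hx
      simp [hx]
    rintro ⟨⟨v, i, j, k, l⟩, w⟩ hq
    refine ⟨v, i, j, k, l, w, 0, rfl, ?_⟩
    rw [h2] at hq
    obtain ⟨⟨a, c⟩, hac, hne⟩ := Finset.exists_ne_zero_of_sum_ne_zero hq
    have h0 := right_ne_zero_of_smul hne
    rw [Finset.HasAntidiagonal.mem_antidiagonal] at hac
    simp only at hac
    subst hac
    have e6 : a + v + c = v + (a + c) + 0 := by ring
    change f i j * g k l * h (M - i - k + (a + v + c : ℕ)) (N - j - l + (a + v + c : ℕ)) ≠ 0 at h0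
    rw [e6] at h0
    exact ⟨left_ne_zero_of_mul (left_ne_zero_of_mul h0),
      right_ne_zero_of_mul (left_ne_zero_of_mul h0), right_ne_zero_of_mul h0⟩
  have h4 : Φ.support.Finite := by
    have : Φ = (Φ ∘ eqvR) ∘ eqvR.symm := by ext; simp
    rw [this, Function.support_comp_eq_preimage]
    exact h3.preimage eqvR.symm.injective.injOn
  rw [h1, ← finsum_curry _ h4, ← finsum_comp_equiv eqvR, ← finsum_comp_equiv eqvS]
  exact finsum_antidiag (Φ ∘ eqvR) _ h5 h2

theorem bdd_coeff (f : PseudoDiff A) : ∃ r s : ℤ, Bdd f.coeff r s := f.bounded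

instance : Zero (PseudoDiff A) := ⟨⟨fun _ _ => 0, 0, 0, fun _ _ _ => rfl⟩⟩

instance : Add (PseudoDiff A) := ⟨fun f g => ⟨fun i j => f.coeff i j + g.coeff i j, by
  obtain ⟨r, s, hf⟩ := f.bounded
  obtain ⟨r', s', hg⟩ := g.bounded
  refine ⟨max r r', max s s', fun i j h => ?_⟩
  rw [hf i j (by omega), hg i j (by omega), add_zero]⟩⟩

instance : Neg (PseudoDiff A) := ⟨fun f => ⟨fun i j => -f.coeff i j, by
  obtain ⟨r, s, hf⟩ := f.bounded
  exact ⟨r, s, fun i j h => by rw [hf i j h, neg_zero]⟩⟩⟩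

/-- The monomial `a z^i ∂^j`. -/
def mono (a : A) (i j : ℤ) : PseudoDiff A :=
  ⟨fun i' j' => if i' = i ∧ j' = j then a else 0, i, j, fun i' j' h => if_neg (by omega)⟩

instance : One (PseudoDiff A) := ⟨mono 1 0 0⟩

instance : Mul (PseudoDiff A) := ⟨fun f g => ⟨mulCoeff f.coeff g.coeff, by
  obtain ⟨r, s, hf⟩ := bdd_coeff f
  obtain ⟨r', s', hg⟩ := bdd_coeff g
  exact ⟨_, _, bdd_mulCoeff hf hg⟩⟩⟩

@[simp] theorem coeff_zero (i j : ℤ) : (0 : PseudoDiff A).coeff i j = 0 := rfl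
@[simp] theorem coeff_add (f g : PseudoDiff A) (i j : ℤ) :
    (f + g).coeff i j = f.coeff i j + g.coeff i j := rfl
@[simp] theorem coeff_neg (f : PseudoDiff A) (i j : ℤ) : (-f).coeff i j = -f.coeff i j := rfl
theorem coeff_one (i j : ℤ) : (1 : PseudoDiff A).coeff i j = if i = 0 ∧ j = 0 then 1 else 0 := rfl
theorem coeff_mul (f g : PseudoDiff A) : (f * g).coeff = mulCoeff f.coeff g.coeff := rfl

theorem ext_coeff {f g : PseudoDiff A} (h : ∀ i j, f.coeff i j = g.coeff i j) : f = g :=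
  PseudoDiff.ext (funext fun i => funext fun j => h i j)

theorem one_mul_aux (f : PseudoDiff A) : 1 * f = f := by
  refine ext_coeff fun M N => ?_
  rw [coeff_mul, mulCoeff, finsum_eq_single _ (0, 0, 0)]
  · simp [contr_zero, coeff_one]
  · rintro ⟨t, i, j⟩ hx
    by_cases h : i = 0 ∧ j = 0
    · obtain ⟨rfl, rfl⟩ := h
      have ht : t ≠ 0 := by rintro rfl; exact hx rfl
      simp [contr_zero_left _ _ ht]
    · simp [coeff_one, h]

theorem mul_one_aux (f : PseudoDiff A) : f * 1 = f := by
  refine ext_coeff fun M N => ?_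
  rw [coeff_mul, mulCoeff, finsum_eq_single _ (0, M, N)]
  · simp [contr_zero, coeff_one]
  · rintro ⟨t, i, j⟩ hx
    by_cases h : M - i + t = 0 ∧ N - j + t = 0
    · have ht : t ≠ 0 := by
        rintro rfl
        refine hx ?_
        simp only [Prod.mk.injEq, true_and]
        omega
      simp only [h.1]
      simp [contr_zero_right _ _ ht]
    · simp [coeff_one, h]

instance : Ring (PseudoDiff A) where
  add_assoc f g h := ext_coeff fun i j => by simp [add_assoc]
  zero_add f := ext_coeff fun i j => by simp
  add_zero f := ext_coeff fun i j => by simp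
  add_comm f g := ext_coeff fun i j => by simp [add_comm]
  neg_add_cancel f := ext_coeff fun i j => by simp
  nsmul := nsmulRec
  zsmul := zsmulRec
  zero_mul f := ext_coeff fun i j => by simp [coeff_mul, mulCoeff]
  mul_zero f := ext_coeff fun i j => by simp [coeff_mul, mulCoeff]
  one_mul := one_mul_aux
  mul_one := mul_one_aux
  left_distrib f g h := ext_coeff fun M N => by
    obtain ⟨r, s, hf⟩ := bdd_coeff f
    obtain ⟨r', s', hg⟩ := bdd_coeff g
    obtain ⟨r'', s'', hh⟩ := bdd_coeff h
    simp only [coeff_add, coeff_mul, mulCoeff]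
    rw [← finsum_add_distrib (finite_mul_support hf hg M N) (finite_mul_support hf hh M N)]
    simp only [mul_add, smul_add]
  right_distrib f g h := ext_coeff fun M N => by
    obtain ⟨r, s, hf⟩ := bdd_coeff f
    obtain ⟨r', s', hg⟩ := bdd_coeff g
    obtain ⟨r'', s'', hh⟩ := bdd_coeff h
    simp only [coeff_add, coeff_mul, mulCoeff]
    rw [← finsum_add_distrib (finite_mul_support hf hh M N) (finite_mul_support hg hh M N)]
    simp only [add_mul, smul_add]
  mul_assoc f g h := ext_coeff fun M N => by
    obtain ⟨r, s, hf⟩ := bdd_coeff f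
    obtain ⟨r', s', hg⟩ := bdd_coeff g
    obtain ⟨r'', s'', hh⟩ := bdd_coeff h
    rw [coeff_mul, coeff_mul, coeff_mul, coeff_mul, mulCoeff_left hf hg hh,
      mulCoeff_right hf hg hh]

/-- Coefficientwise extension to pseudo-differential operators of a homomorphism `F`. -/
def map {A' : Type*} [Ring A'] (F : A →+* A') (f : PseudoDiff A) : PseudoDiff A' :=
  ⟨fun i j => F (f.coeff i j), by
    obtain ⟨r, s, hf⟩ := f.bounded
    exact ⟨r, s, fun i j h => by rw [hf i j h, map_zero]⟩⟩

/-- The extension `a z^i ∂^j ↦ ω(a) z^j ∂^i` of an additive map `ω` (an anti-involution of `A`)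
to pseudo-differential operators. -/
def swap (ω : A →+ A) (f : PseudoDiff A) : PseudoDiff A :=
  ⟨fun i j => ω (f.coeff j i), by
    obtain ⟨r, s, hf⟩ := f.bounded
    exact ⟨s, r, fun i j h => by rw [hf j i h.symm, map_zero]⟩⟩

/-- The series `∑_{r ≥ 0} a_r z^{-r-1}`. -/
def negSeries (a : ℕ → A) : PseudoDiff A :=
  ⟨fun i j => if i < 0 ∧ j = 0 then a (-i - 1).toNat else 0, -1, 0,
    fun i j h => if_neg (by omega)⟩

section Scalars

variable (A) [Algebra ℂ A]

/-- The element `z - c`. -/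
def zSub (c : ℂ) : PseudoDiff A := mono 1 1 0 - mono (algebraMap ℂ A c) 0 0

/-- The element `∂_z - c`. -/
def dSub (c : ℂ) : PseudoDiff A := mono 1 0 1 - mono (algebraMap ℂ A c) 0 0

/-- The expansion at infinity `∑_{r ≥ 0} c^r z^{-r-1}` of `1 / (z - c)`. -/
def zSubInv (c : ℂ) : PseudoDiff A := negSeries fun r => algebraMap ℂ A (c ^ r)

end Scalars

end PseudoDiff

section Determinants

variable {R : Type*} [Ring R] {k : ℕ}

/-- The column determinant `∑_σ (-1)^{l(σ)} a_{σ(1),1} ⋯ a_{σ(k),k}` (factors in this order). -/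
def cdet (A : Matrix (Fin k) (Fin k) R) : R :=
  ∑ σ : Equiv.Perm (Fin k), (Equiv.Perm.sign σ : ℤ) • (List.ofFn fun i => A (σ i) i).prod

/-- The `(i,j)`th quasideterminant of `A` is defined: `A` has a two-sided inverse `B`, and the
entry `B_{ji}` is invertible. -/
def QuasidetDefined (A : Matrix (Fin k) (Fin k) R) (i j : Fin k) : Prop :=
  IsUnit A ∧ IsUnit (Ring.inverse A j i)

/-- The `(i,j)`th quasideterminant `((A⁻¹)_{ji})⁻¹` (meaningful if `QuasidetDefined A i j`). -/
def quasidet (A : Matrix (Fin k) (Fin k) R) (i j : Fin k) : R :=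
  Ring.inverse (Ring.inverse A j i)

/-- The upper left square submatrix of `A` whose last row and column are those of index `i`. -/
def leading (A : Matrix (Fin k) (Fin k) R) (i : Fin k) :
    Matrix (Fin (i + 1)) (Fin (i + 1)) R :=
  A.submatrix (Fin.castLE i.isLt) (Fin.castLE i.isLt)

/-- The principal quasiminor of `A`: the quasideterminant of the leading submatrix at its lower
right corner. -/
def quasiminor (A : Matrix (Fin k) (Fin k) R) (i : Fin k) : R :=
  quasidet (leading A i) (Fin.last i) (Fin.last i)

/-- Every principal quasiminor of `A` is well defined. -/
def SufficientlyInvertible (A : Matrix (Fin k) (Fin k) R) : Prop :=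
  ∀ i : Fin k, QuasidetDefined (leading A i) (Fin.last i) (Fin.last i)

/-- The Berezinian of type `s`: the ordered product `d_1(A)^{±1} ⋯ d_k(A)^{±1}` of the principal
quasiminors, with exponent `1` at the even indices (`s i = 0`) and `-1` at the odd indices.
It is meaningful if `A` is sufficiently invertible. -/
def Ber (s : Fin k → ZMod 2) (A : Matrix (Fin k) (Fin k) R) : R :=
  (List.ofFn fun i => if s i = 0 then quasiminor A i else Ring.inverse (quasiminor A i)).prod

end Determinants

/-- The sign `(-1)^a` for a parity `a`. -/
def superSign (a : ZMod 2) : ℂ := if a = 0 then 1 else -1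

/-- The relations `[E^i_j[a], E^k_l[b]] = δ_{jk} E^i_l[a+b] - (-1)^{(|i|+|j|)(|k|+|l|)} δ_{il} E^k_j[a+b]`
of the current superalgebra `gl[t]`, where `|i| = s i`, `A[r] = A ⊗ t^r`, and `[x, y]` is the
supercommutator `x y - (-1)^{|x||y|} y x`. -/
inductive CurrentRel {N : ℕ} (s : Fin N → ZMod 2) :
    FreeAlgebra ℂ (Fin N × Fin N × ℕ) → FreeAlgebra ℂ (Fin N × Fin N × ℕ) → Prop
  | comm (i j k l : Fin N) (a b : ℕ) : CurrentRel s
      (FreeAlgebra.ι ℂ (i, j, a) * FreeAlgebra.ι ℂ (k, l, b))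
      (superSign ((s i + s j) * (s k + s l)) •
          (FreeAlgebra.ι ℂ (k, l, b) * FreeAlgebra.ι ℂ (i, j, a)) +
        ((if j = k then FreeAlgebra.ι ℂ (i, l, a + b) else 0) -
          superSign ((s i + s j) * (s k + s l)) •
            (if i = l then FreeAlgebra.ι ℂ (k, j, a + b) else 0)))

/-- The universal enveloping superalgebra `U(gl[t])` of the current superalgebra of the general
linear Lie superalgebra on a superspace with a basis of parities `s`: it is the associative unital
algebra generated by the basis `E^i_j[k]` of `gl[t]` subject to the supercommutation relations.
If `s = 0`, it is the universal enveloping algebra of the current Lie algebra `gl_N[t]`. -/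
abbrev CurrentEnv {N : ℕ} (s : Fin N → ZMod 2) : Type := RingQuot (CurrentRel s)

/-- The generator `E^i_j[k] = E^i_j ⊗ t^k`. -/
def CurrentEnv.E {N : ℕ} (s : Fin N → ZMod 2) (i j : Fin N) (k : ℕ) : CurrentEnv s :=
  RingQuot.mkAlgHom ℂ (CurrentRel s) (FreeAlgebra.ι ℂ (i, j, k))

/-- The defining relations of the Weyl superalgebra: the variables supercommute, the derivatives
supercommute, and `[∂_u, x_v] = δ_{uv}` (supercommutators; `x_u` and `∂_u` have parity `s u`;
the generator `Sum.inl u` is the variable `x_u` and `Sum.inr u` is the derivative `∂_u`). -/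
inductive WeylRel {κ : Type} [DecidableEq κ] (s : κ → ZMod 2) :
    FreeAlgebra ℂ (κ ⊕ κ) → FreeAlgebra ℂ (κ ⊕ κ) → Prop
  | var_var (u v : κ) : WeylRel s
      (FreeAlgebra.ι ℂ (Sum.inl u) * FreeAlgebra.ι ℂ (Sum.inl v))
      (superSign (s u * s v) • (FreeAlgebra.ι ℂ (Sum.inl v) * FreeAlgebra.ι ℂ (Sum.inl u)))
  | der_der (u v : κ) : WeylRel s
      (FreeAlgebra.ι ℂ (Sum.inr u) * FreeAlgebra.ι ℂ (Sum.inr v))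
      (superSign (s u * s v) • (FreeAlgebra.ι ℂ (Sum.inr v) * FreeAlgebra.ι ℂ (Sum.inr u)))
  | der_var (u v : κ) : WeylRel s
      (FreeAlgebra.ι ℂ (Sum.inr u) * FreeAlgebra.ι ℂ (Sum.inl v))
      (superSign (s u * s v) • (FreeAlgebra.ι ℂ (Sum.inl v) * FreeAlgebra.ι ℂ (Sum.inr u)) +
        if u = v then 1 else 0)

/-- The Weyl superalgebra in variables indexed by `κ` with parities `s`. -/
abbrev Weyl {κ : Type} [DecidableEq κ] (s : κ → ZMod 2) : Type := RingQuot (WeylRel s)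

namespace Weyl
variable {κ : Type} [DecidableEq κ] (s : κ → ZMod 2)

/-- The variable with index `u`. -/
def var (u : κ) : Weyl s := RingQuot.mkAlgHom ℂ (WeylRel s) (FreeAlgebra.ι ℂ (Sum.inl u))

/-- The derivative with respect to the variable with index `u`. -/
def der (u : κ) : Weyl s := RingQuot.mkAlgHom ℂ (WeylRel s) (FreeAlgebra.ι ℂ (Sum.inr u))

theorem var_mul_var (u v : κ) :
    var s u * var s v = superSign (s u * s v) • (var s v * var s u) := by
  simpa [var] using RingQuot.mkAlgHom_rel ℂ (WeylRel.var_var (s := s) u v)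

theorem der_mul_der (u v : κ) :
    der s u * der s v = superSign (s u * s v) • (der s v * der s u) := by
  simpa [der] using RingQuot.mkAlgHom_rel ℂ (WeylRel.der_der (s := s) u v)

theorem der_mul_var (u v : κ) :
    der s u * var s v = superSign (s u * s v) • (var s v * der s u) + if u = v then 1 else 0 := by
  have h := RingQuot.mkAlgHom_rel ℂ (WeylRel.der_var (s := s) u v)
  split_ifs at h ⊢ <;> simpa [der, var] using h

/-- The map `ω` as an algebra homomorphism to the opposite algebra. -/
def omegaHom : Weyl s →ₐ[ℂ] (Weyl s)ᵐᵒᵖ :=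
  RingQuot.liftAlgHom ℂ ⟨FreeAlgebra.lift ℂ (Sum.elim (fun u => MulOpposite.op (der s u))
    (fun u => MulOpposite.op (var s u))), by
    rintro x y (⟨u, v⟩ | ⟨u, v⟩ | ⟨u, v⟩)
    · simp only [map_mul, map_smul, FreeAlgebra.lift_ι_apply, Sum.elim_inl, ← MulOpposite.op_mul,
        ← MulOpposite.op_smul]
      rw [der_mul_der s v u, mul_comm (s v)]
    · simp only [map_mul, map_smul, FreeAlgebra.lift_ι_apply, Sum.elim_inr, ← MulOpposite.op_mul,
        ← MulOpposite.op_smul]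
      rw [var_mul_var s v u, mul_comm (s v)]
    · have h := der_mul_var s v u
      rw [mul_comm (s v)] at h
      by_cases huv : u = v
      · subst huv
        simp only [if_true] at h
        simp only [map_mul, map_smul, map_add, map_one, FreeAlgebra.lift_ι_apply, Sum.elim_inr,
          Sum.elim_inl, ← MulOpposite.op_mul, ← MulOpposite.op_smul, if_true]
        rw [h]; simp
      · simp only [if_neg huv, if_neg (Ne.symm huv)] at h ⊢
        simp only [map_mul, map_smul, map_add, map_zero, FreeAlgebra.lift_ι_apply, Sum.elim_inr,
          Sum.elim_inl, ← MulOpposite.op_mul, ← MulOpposite.op_smul]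
        rw [h]; simp⟩

/-- The anti-involution `ω` of the Weyl superalgebra which exchanges every variable with the
corresponding derivative; `ω(ab) = ω(b) ω(a)` without signs. -/
def omega : Weyl s →+ Weyl s where
  toFun a := (omegaHom s a).unop
  map_zero' := by simp
  map_add' := by simp

theorem omega_var (u : κ) : omega s (var s u) = der s u := by
  simp [omega, omegaHom, var]

theorem omega_der (u : κ) : omega s (der s u) = var s u := by
  simp [omega, omegaHom, der]

theorem omega_mul (a b : Weyl s) : omega s (a * b) = omega s b * omega s a := by
  simp [omega]

end Weyl

theorem superSign_add (a b : ZMod 2) : superSign (a + b) = superSign a * superSign b := by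
  have h : ∀ x : ZMod 2, x = 0 ∨ x = 1 := by decide
  have h2 : (1 + 1 : ZMod 2) = 0 := by decide
  rcases h a with rfl | rfl <;> rcases h b with rfl | rfl <;> simp [superSign, h2]

theorem superSign_mul_self (a : ZMod 2) : superSign a * superSign a = 1 := by
  rw [superSign]; split_ifs <;> norm_num

theorem oscillator_quad {B κ : Type} [Ring B] [Algebra ℂ B] [DecidableEq κ] (s : κ → ZMod 2)
    (R C : κ → B)
    (hRR : ∀ u v, R u * R v = superSign (s u * s v) • (R v * R u))
    (hCC : ∀ u v, C u * C v = superSign (s u * s v) • (C v * C u))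
    (hCR : ∀ u v, C u * R v = superSign (s u * s v) • (R v * C u) + if u = v then 1 else 0)
    (u v x y : κ) :
    R u * C v * (R x * C y) = superSign ((s u + s v) * (s x + s y)) • (R x * C y * (R u * C v)) +
      ((if v = x then R u * C y else 0) -
        superSign ((s u + s v) * (s x + s y)) • (if u = y then R x * C v else 0)) := by
  have h1 : R u * C v * (R x * C y) = superSign (s v * s x) • (R u * R x * (C v * C y)) +
      (if v = x then R u * C y else 0) := by
    have : R u * C v * (R x * C y) = R u * (C v * R x) * C y := by noncomm_ring
    rw [this, hCR]
    split_ifs <;> simp [mul_add, add_mul, mul_assoc]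
  have h2 : R x * C y * (R u * C v) = superSign (s y * s u) • (R x * R u * (C y * C v)) +
      (if u = y then R x * C v else 0) := by
    have : R x * C y * (R u * C v) = R x * (C y * R u) * C v := by noncomm_ring
    rw [this, hCR]
    simp only [eq_comm (a := u)]
    split_ifs <;> simp [mul_add, add_mul, mul_assoc]
  rw [h1, h2, hRR u x, hCC v y]
  have h3 : superSign ((s u + s v) * (s x + s y)) * superSign (s y * s u) =
      superSign (s v * s x) * (superSign (s u * s x) * superSign (s v * s y)) := by
    rw [add_mul, mul_add, mul_add, superSign_add, superSign_add, superSign_add, mul_comm (s y)]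
    linear_combination (superSign (s u * s x) * superSign (s v * s x) * superSign (s v * s y)) *
      superSign_mul_self (s u * s y)
  rw [smul_add, smul_smul, h3]
  simp only [smul_mul_assoc, mul_smul_comm, smul_smul]
  rw [mul_comm (superSign (s v * s y))]
  abel

theorem lift_ite {X B : Type} [Ring B] [Algebra ℂ B] (f : X → B) (P : Prop) [Decidable P] (x : X) :
    FreeAlgebra.lift ℂ f (if P then FreeAlgebra.ι ℂ x else 0) = if P then f x else 0 := by
  split_ifs <;> simp

section Duality

variable (p q m n d : ℕ)

/-- The sequence `s = (0^p, 1^q, 0^m, 1^n)` of parities of the index set `{1, …, p+q+m+n}`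
(indices are counted from `0` here). -/
def superType (i : Fin (p + q + m + n)) : ZMod 2 :=
  if (i : ℕ) < p ∨ (p + q ≤ (i : ℕ) ∧ (i : ℕ) < p + q + m) then 0 else 1

/-- The Weyl superalgebra `𝔻[x, y, η, ζ]`. Its variables are indexed by pairs `(i, a)`: for
`i < p + q` (counted from `0`) the variable `(i, a)` is `y_{i+1}^a`, with `y_{p+s}^a = ζ_s^a`, and
for `i ≥ p + q` it is `x_{i+1-p-q}^a`, with `x_{m+j}^a = η_j^a`. -/
abbrev WeylD : Type := Weyl (fun u : Fin (p + q + m + n) × Fin d => superType p q m n u.1)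

/-- The operator `∂_{y_i^a}` if `i ≤ p + q` (counted from `1`), and `x_{i-p-q}^a` otherwise. -/
def rowOp (i : Fin (p + q + m + n)) (a : Fin d) : WeylD p q m n d :=
  if (i : ℕ) < p + q then Weyl.der _ (i, a) else Weyl.var _ (i, a)

/-- The operator `(-1)^{|j|+1} y_j^a` if `j ≤ p + q` (counted from `1`), and `∂_{x_{j-p-q}^a}`
otherwise. -/
def colOp (j : Fin (p + q + m + n)) (a : Fin d) : WeylD p q m n d :=
  if (j : ℕ) < p + q then superSign (superType p q m n j + 1) • Weyl.var _ (j, a)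
  else Weyl.der _ (j, a)

/-- The image of `E^i_j[k]` under `φ_w`:
`∑_a w_a^k · {∂_{y_i^a} or x_{i-p-q}^a} · {(-1)^{|j|+1} y_j^a or ∂_{x_{j-p-q}^a}}`. -/
def varphiGen (w : Fin d → ℂ) (i j : Fin (p + q + m + n)) (k : ℕ) : WeylD p q m n d :=
  ∑ a, w a ^ k • (rowOp p q m n d i a * colOp p q m n d j a)

/-- The image of `e_{ab}[k]` under `φ_z`:
`-∑_{r ≤ p+q} z_r^k y_r^b ∂_{y_r^a} + ∑_{i ≤ m+n} z_{p+q+i}^k x_i^a ∂_{x_i^b}`. -/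
def phiGen (z : Fin (p + q + m + n) → ℂ) (a b : Fin d) (k : ℕ) : WeylD p q m n d :=
  -(∑ r with (r : Fin (p + q + m + n)).val < p + q,
      z r ^ k • (Weyl.var _ (r, b) * Weyl.der _ (r, a))) +
    ∑ i with p + q ≤ (i : Fin (p + q + m + n)).val,
      z i ^ k • (Weyl.var _ (i, a) * Weyl.der _ (i, b))

theorem Weyl.var_mul_der {κ : Type} [DecidableEq κ] (s : κ → ZMod 2) (u v : κ) :
    Weyl.var s u * Weyl.der s v = superSign (s u * s v) • (Weyl.der s v * Weyl.var s u) -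
      superSign (s u * s v) • if u = v then 1 else 0 := by
  rw [Weyl.der_mul_var, mul_comm (s v), smul_add, smul_smul, superSign_mul_self, one_smul]
  simp only [eq_comm (a := u), add_sub_cancel_right]

theorem row_row (u v : Fin (p + q + m + n) × Fin d) :
    rowOp p q m n d u.1 u.2 * rowOp p q m n d v.1 v.2 =
      superSign (superType p q m n u.1 * superType p q m n v.1) •
        (rowOp p q m n d v.1 v.2 * rowOp p q m n d u.1 u.2) := by
  simp only [rowOp]
  split_ifs with h1 h2 h2
  · exact Weyl.der_mul_der _ u v
  · refine (Weyl.der_mul_var _ u v).trans ?_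
    rw [if_neg (by rintro rfl; exact h2 h1), add_zero]
  · refine (Weyl.var_mul_der _ u v).trans ?_
    rw [if_neg (by rintro rfl; exact h1 h2), smul_zero, sub_zero]
  · exact Weyl.var_mul_var _ u v

theorem col_col (u v : Fin (p + q + m + n) × Fin d) :
    colOp p q m n d u.1 u.2 * colOp p q m n d v.1 v.2 =
      superSign (superType p q m n u.1 * superType p q m n v.1) •
        (colOp p q m n d v.1 v.2 * colOp p q m n d u.1 u.2) := by
  simp only [colOp]
  split_ifs with h1 h2 h2
  · have h := Weyl.var_mul_var (fun u : Fin (p + q + m + n) × Fin d => superType p q m n u.1) u v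
    simp only [Prod.mk.eta, smul_mul_assoc, mul_smul_comm, h]
    simp only [smul_smul]
    congr 1; ring
  · have h := Weyl.var_mul_der (fun u : Fin (p + q + m + n) × Fin d => superType p q m n u.1) u v
    rw [if_neg (by rintro rfl; exact h2 h1), smul_zero, sub_zero] at h
    simp only [Prod.mk.eta, smul_mul_assoc, mul_smul_comm, h]
    simp only [smul_smul]
    congr 1; ring
  · have h := Weyl.der_mul_var (fun u : Fin (p + q + m + n) × Fin d => superType p q m n u.1) u v
    rw [if_neg (by rintro rfl; exact h1 h2), add_zero] at h
    simp only [Prod.mk.eta, smul_mul_assoc, mul_smul_comm, h]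
    simp only [smul_smul]
    congr 1; ring
  · exact Weyl.der_mul_der _ u v

theorem superSign_add_one (a : ZMod 2) : superSign (a + 1) * superSign (a * a) = -1 := by
  have h : ∀ x : ZMod 2, x = 0 ∨ x = 1 := by decide
  have h2 : (1 + 1 : ZMod 2) = 0 := by decide
  rcases h a with rfl | rfl <;> simp [superSign, h2]

theorem col_row (u v : Fin (p + q + m + n) × Fin d) :
    colOp p q m n d u.1 u.2 * rowOp p q m n d v.1 v.2 =
      superSign (superType p q m n u.1 * superType p q m n v.1) •
        (rowOp p q m n d v.1 v.2 * colOp p q m n d u.1 u.2) + if u = v then 1 else 0 := by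
  set t : Fin (p + q + m + n) × Fin d → ZMod 2 := fun u => superType p q m n u.1 with ht
  by_cases h1 : (u.1 : ℕ) < p + q <;> by_cases h2 : (v.1 : ℕ) < p + q
  · have h := Weyl.var_mul_der t u v
    simp only [rowOp, colOp, h1, h2, if_true, Prod.mk.eta, smul_mul_assoc, mul_smul_comm]
    rw [h, smul_sub, smul_smul, smul_smul,
      mul_comm (superSign (superType p q m n u.1 + 1))]
    by_cases huv : u = v
    · subst huv
      have h3 := superSign_add_one (superType p q m n u.1)
      rw [mul_comm] at h3
      have h4 : superSign (t u * t u) * superSign (superType p q m n u.1 + 1) = -1 := h3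
      rw [if_pos rfl, smul_smul, h4]
      simp only [neg_smul, one_smul, sub_neg_eq_add]
      rfl
    · rw [if_neg huv, smul_zero, sub_zero, add_zero, smul_smul]
  · have h := Weyl.var_mul_var t u v
    have huv : u ≠ v := by rintro rfl; exact h2 h1
    simp only [rowOp, colOp, h1, h2, if_true, if_false, Prod.mk.eta, smul_mul_assoc,
      mul_smul_comm, huv, add_zero]
    rw [h, smul_smul, smul_smul, mul_comm]
  · have h := Weyl.der_mul_der t u v
    have huv : u ≠ v := by rintro rfl; exact h1 h2
    simp only [rowOp, colOp, h1, h2, if_true, if_false, Prod.mk.eta, huv, add_zero]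
    exact h
  · simp only [rowOp, colOp, h1, h2, if_false]
    exact Weyl.der_mul_var t u v

theorem varphiGen_rel (w : Fin d → ℂ) (i j k l : Fin (p + q + m + n)) (a b : ℕ) :
    varphiGen p q m n d w i j a * varphiGen p q m n d w k l b =
      superSign ((superType p q m n i + superType p q m n j) *
          (superType p q m n k + superType p q m n l)) •
        (varphiGen p q m n d w k l b * varphiGen p q m n d w i j a) +
      ((if j = k then varphiGen p q m n d w i l (a + b) else 0) -
        superSign ((superType p q m n i + superType p q m n j) *
          (superType p q m n k + superType p q m n l)) •
        (if i = l then varphiGen p q m n d w k j (a + b) else 0)) := by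
  have key := fun e f => oscillator_quad
    (fun u : Fin (p + q + m + n) × Fin d => superType p q m n u.1)
    (fun u => rowOp p q m n d u.1 u.2) (fun u => colOp p q m n d u.1 u.2)
    (row_row p q m n d) (col_col p q m n d) (col_row p q m n d) (i, e) (j, e) (k, f) (l, f)
  simp only at key
  set ε := superSign ((superType p q m n i + superType p q m n j) *
          (superType p q m n k + superType p q m n l))
  have h1 : varphiGen p q m n d w i j a * varphiGen p q m n d w k l b = ∑ e, ∑ f,
      (w e ^ a * w f ^ b) • (rowOp p q m n d i e * colOp p q m n d j e *
        (rowOp p q m n d k f * colOp p q m n d l f)) := by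
    rw [varphiGen, varphiGen, Finset.sum_mul_sum]
    simp only [smul_mul_smul_comm]
  have h2 : varphiGen p q m n d w k l b * varphiGen p q m n d w i j a = ∑ e, ∑ f,
      (w e ^ a * w f ^ b) • (rowOp p q m n d k f * colOp p q m n d l f *
        (rowOp p q m n d i e * colOp p q m n d j e)) := by
    rw [varphiGen, varphiGen, Finset.sum_mul_sum, Finset.sum_comm]
    simp only [smul_mul_smul_comm, mul_comm (w _ ^ b)]
  have h3 : (if j = k then varphiGen p q m n d w i l (a + b) else 0) = ∑ e, ∑ f,
      (w e ^ a * w f ^ b) • (if ((j, e) : Fin (p + q + m + n) × Fin d) = (k, f) then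
        rowOp p q m n d i e * colOp p q m n d l f else 0) := by
    by_cases hjk : j = k
    · simp [hjk, varphiGen, pow_add]
    · simp [hjk]
  have h4 : (if i = l then varphiGen p q m n d w k j (a + b) else 0) = ∑ e, ∑ f,
      (w e ^ a * w f ^ b) • (if ((i, e) : Fin (p + q + m + n) × Fin d) = (l, f) then
        rowOp p q m n d k f * colOp p q m n d j e else 0) := by
    by_cases hjk : i = l
    · simp [hjk, varphiGen, pow_add]
    · simp [hjk]
  rw [h1, h2, h3, h4]
  simp only [Finset.smul_sum, ← Finset.sum_add_distrib, ← Finset.sum_sub_distrib]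
  refine Finset.sum_congr rfl fun e _ => Finset.sum_congr rfl fun f _ => ?_
  rw [key, smul_add, smul_sub, smul_comm ε, smul_comm ε]

/-- The homomorphism `φ_w : U(gl_{p+q|m+n}[t]) → 𝔻`, `E^i_j[k] ↦ varphiGen w i j k`. -/
def varphi (w : Fin d → ℂ) : CurrentEnv (superType p q m n) →ₐ[ℂ] WeylD p q m n d :=
  RingQuot.liftAlgHom ℂ ⟨FreeAlgebra.lift ℂ (fun x => varphiGen p q m n d w x.1 x.2.1 x.2.2), by
    rintro _ _ ⟨i, j, k, l, a, b⟩
    have h := varphiGen_rel p q m n d w i j k l a b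
    simp only [map_add, map_sub, map_smul, map_mul, FreeAlgebra.lift_ι_apply, lift_ite]
    exact h⟩

theorem phiGen_eq (z : Fin (p + q + m + n) → ℂ) (a b : Fin d) (k : ℕ) :
    phiGen p q m n d z a b k = (∑ i, z i ^ k • (rowOp p q m n d i a * colOp p q m n d i b)) +
      if a = b then (∑ i : Fin (p + q + m + n), if (i : ℕ) < p + q then
        (superSign (superType p q m n i) * z i ^ k) • (1 : WeylD p q m n d) else 0) else 0 := by
  have h0 : (if a = b then (∑ i : Fin (p + q + m + n), if (i : ℕ) < p + q then
        (superSign (superType p q m n i) * z i ^ k) • (1 : WeylD p q m n d) else 0) else 0) =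
      ∑ i : Fin (p + q + m + n), if (i : ℕ) < p + q then
        if a = b then (superSign (superType p q m n i) * z i ^ k) • (1 : WeylD p q m n d) else 0
        else 0 := by
    split_ifs <;> simp
  rw [h0, phiGen, Finset.sum_filter, Finset.sum_filter, ← Finset.sum_neg_distrib,
    ← Finset.sum_add_distrib, ← Finset.sum_add_distrib]
  refine Finset.sum_congr rfl fun i _ => ?_
  by_cases hi : (i : ℕ) < p + q
  · have h := Weyl.var_mul_der
      (fun u : Fin (p + q + m + n) × Fin d => superType p q m n u.1) (i, b) (i, a)
    simp only [hi, if_true, not_le.2 hi, if_false, add_zero, rowOp, colOp]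
    rw [h]
    have hs : superSign (superType p q m n i + 1) = -superSign (superType p q m n i) := by
      rw [superSign_add]; simp [superSign]
    have hs2 : superSign (superType p q m n i * superType p q m n i) =
        superSign (superType p q m n i) := by
      have h : ∀ x : ZMod 2, x * x = x := by decide
      rw [h]
    simp only [hs, hs2, mul_smul_comm, Prod.mk.injEq, true_and, eq_comm (a := b)]
    by_cases hab : a = b
    · simp only [hab, if_true]
      module
    · simp only [hab, if_false]
      module
  · simp [hi, not_lt.1 hi, rowOp, colOp]

theorem phiGen_rel (z : Fin (p + q + m + n) → ℂ) (a b c e : Fin d) (k l : ℕ) :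
    phiGen p q m n d z a b k * phiGen p q m n d z c e l =
      phiGen p q m n d z c e l * phiGen p q m n d z a b k +
      ((if b = c then phiGen p q m n d z a e (k + l) else 0) -
        (if a = e then phiGen p q m n d z c b (k + l) else 0)) := by
  set Q : Fin d → Fin d → ℕ → WeylD p q m n d := fun a b k =>
    ∑ i, z i ^ k • (rowOp p q m n d i a * colOp p q m n d i b) with hQ
  set K : ℕ → ℂ := fun k => ∑ i : Fin (p + q + m + n), if (i : ℕ) < p + q then
        (superSign (superType p q m n i) * z i ^ k) else 0 with hK
  have hphi : ∀ a b k, phiGen p q m n d z a b k =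
      Q a b k + if a = b then K k • (1 : WeylD p q m n d) else 0 := by
    intro a b k
    rw [phiGen_eq]
    simp only [hQ, hK, Finset.sum_smul, ite_smul, zero_smul]
  have key := fun i j => oscillator_quad
    (fun u : Fin (p + q + m + n) × Fin d => superType p q m n u.1)
    (fun u => rowOp p q m n d u.1 u.2) (fun u => colOp p q m n d u.1 u.2)
    (row_row p q m n d) (col_col p q m n d) (col_row p q m n d) (i, a) (i, b) (j, c) (j, e)
  have h2z : ∀ x : ZMod 2, x + x = 0 := by decide
  have hs0 : superSign 0 = 1 := by simp [superSign]
  simp only [h2z, zero_mul, hs0, one_smul] at key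
  have hQQ : Q a b k * Q c e l = Q c e l * Q a b k +
      ((if b = c then Q a e (k + l) else 0) - (if a = e then Q c b (k + l) else 0)) := by
    have h1 : Q a b k * Q c e l = ∑ i, ∑ j,
        (z i ^ k * z j ^ l) • (rowOp p q m n d i a * colOp p q m n d i b *
          (rowOp p q m n d j c * colOp p q m n d j e)) := by
      simp only [hQ]
      rw [Finset.sum_mul_sum]
      simp only [smul_mul_smul_comm]
    have h2 : Q c e l * Q a b k = ∑ i, ∑ j,
        (z i ^ k * z j ^ l) • (rowOp p q m n d j c * colOp p q m n d j e *
          (rowOp p q m n d i a * colOp p q m n d i b)) := by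
      simp only [hQ]
      rw [Finset.sum_mul_sum, Finset.sum_comm]
      simp only [smul_mul_smul_comm, mul_comm (z _ ^ l)]
    have h3 : (if b = c then Q a e (k + l) else 0) = ∑ i, ∑ j,
        (z i ^ k * z j ^ l) • (if ((i, b) : Fin (p + q + m + n) × Fin d) = (j, c) then
          rowOp p q m n d i a * colOp p q m n d j e else 0) := by
      by_cases hjk : b = c
      · simp [hjk, hQ, pow_add]
      · simp [hjk]
    have h4 : (if a = e then Q c b (k + l) else 0) = ∑ i, ∑ j,
        (z i ^ k * z j ^ l) • (if ((i, a) : Fin (p + q + m + n) × Fin d) = (j, e) then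
          rowOp p q m n d j c * colOp p q m n d i b else 0) := by
      by_cases hjk : a = e
      · simp [hjk, hQ, pow_add]
      · simp [hjk]
    rw [h1, h2, h3, h4]
    simp only [← Finset.sum_add_distrib, ← Finset.sum_sub_distrib]
    refine Finset.sum_congr rfl fun i _ => Finset.sum_congr rfl fun j _ => ?_
    rw [key, smul_add, smul_sub]
  simp only [hphi]
  have hcomm : (Q a b k + if a = b then K k • (1 : WeylD p q m n d) else 0) *
      (Q c e l + if c = e then K l • (1 : WeylD p q m n d) else 0) -
      (Q c e l + if c = e then K l • (1 : WeylD p q m n d) else 0) *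
      (Q a b k + if a = b then K k • (1 : WeylD p q m n d) else 0) =
      Q a b k * Q c e l - Q c e l * Q a b k := by
    split_ifs <;> simp [mul_add, add_mul, smul_smul, mul_comm] <;> abel
  rw [← sub_eq_iff_eq_add', hcomm, hQQ, add_sub_cancel_left]
  by_cases h1 : b = c <;> by_cases h2 : a = e
  · subst h1 h2
    simp
  · subst h1
    simp [h2]
  · subst h2
    simp [h1, eq_comm (a := c)]
  · simp [h1, h2]

/-- The homomorphism `φ_z : U(gl_d[t]) → 𝔻`, `e_{ab}[k] ↦ phiGen z a b k`. -/
def phi (z : Fin (p + q + m + n) → ℂ) :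
    CurrentEnv (fun _ : Fin d => (0 : ZMod 2)) →ₐ[ℂ] WeylD p q m n d :=
  RingQuot.liftAlgHom ℂ ⟨FreeAlgebra.lift ℂ (fun x => phiGen p q m n d z x.1 x.2.1 x.2.2), by
    rintro _ _ ⟨i, j, k, l, a, b⟩
    have h := phiGen_rel p q m n d z i j k l a b
    have hs0 : superSign ((0 + 0) * (0 + 0)) = 1 := by simp [superSign]
    simp only [hs0, one_smul]
    simp only [map_add, map_sub, map_mul, FreeAlgebra.lift_ι_apply, lift_ite]
    exact h⟩

theorem varphi_E (w : Fin d → ℂ) (i j : Fin (p + q + m + n)) (k : ℕ) :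
    varphi p q m n d w (CurrentEnv.E _ i j k) = varphiGen p q m n d w i j k := by
  simp [varphi, CurrentEnv.E]

theorem phi_E (z : Fin (p + q + m + n) → ℂ) (a b : Fin d) (k : ℕ) :
    phi p q m n d z (CurrentEnv.E _ a b k) = phiGen p q m n d z a b k := by
  simp [phi, CurrentEnv.E]

/-- The matrix `𝓛_d^w = [δ_{ab} (∂_z - w_a) - e_{ab}(z)]`, where `A(z) = ∑_{r ≥ 0} A[r] z^{-r-1}`. -/
def Lgl {d : ℕ} (w : Fin d → ℂ) :
    Matrix (Fin d) (Fin d) (PseudoDiff (CurrentEnv (fun _ : Fin d => (0 : ZMod 2)))) :=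
  fun a b => (if a = b then PseudoDiff.dSub _ (w a) else 0) -
    PseudoDiff.negSeries fun r => CurrentEnv.E _ a b r

/-- The matrix `𝓛_{p+q|m+n}^z = [δ_{ij} (∂_z - z_i) - (-1)^{|i|} E^i_j(z)]`. -/
def Lsuper (z : Fin (p + q + m + n) → ℂ) :
    Matrix (Fin (p + q + m + n)) (Fin (p + q + m + n))
      (PseudoDiff (CurrentEnv (superType p q m n))) :=
  fun i j => (if i = j then PseudoDiff.dSub _ (z i) else 0) -
    PseudoDiff.negSeries fun r =>
      superSign (superType p q m n i) • CurrentEnv.E (superType p q m n) i j r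

/-- `R_{p|q}(z) = (z - z_1) ⋯ (z - z_p) / ((z - z_{p+1}) ⋯ (z - z_{p+q}))`, expanded at infinity. -/
def ratR (z : Fin (p + q + m + n) → ℂ) : PseudoDiff (WeylD p q m n d) :=
  (List.ofFn fun r : Fin p => PseudoDiff.zSub _ (z ⟨r, by omega⟩)).prod *
    (List.ofFn fun s : Fin q => PseudoDiff.zSubInv _ (z ⟨p + s, by omega⟩)).prod

/-- `(z - z_{p+q+1}) ⋯ (z - z_{p+q+m}) / ((z - z_{p+q+m+1}) ⋯ (z - z_{p+q+m+n}))`, the function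
`R'_{m|n}(z)`, expanded at infinity. -/
def ratRPrime (z : Fin (p + q + m + n) → ℂ) : PseudoDiff (WeylD p q m n d) :=
  (List.ofFn fun i : Fin m => PseudoDiff.zSub _ (z ⟨p + q + i, by omega⟩)).prod *
    (List.ofFn fun j : Fin n => PseudoDiff.zSubInv _ (z ⟨p + q + m + j, by omega⟩)).prod

end Duality

end BetheDuality

end

open BetheDuality

/-!
Contracting the columns of a Manin matrix with fermions turns its column determinant into a product
of pairwise anticommuting elements. In this form a rank one update `X - ε χ Δ⁻¹ ρ` changes the
determinant in a controlled way: if `X u = χ` and `θ = Δ - ε ρ u`, then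
`cdet X * θ ^ ε = Δ ^ ε * cdet (X - ε χ Δ⁻¹ ρ)`, where `ε = ±1` is the parity of `ρ` and `χ`.

The variables of the Weyl superalgebra are oscillators, each contributing one such update with
`Δ = ∂ - z_i`. Starting from the diagonal matrix with entries `z - w_a`, the updates lead to the
`ω`-image of `𝓛_d`, up to conjugation by the rational functions, and elimination shows that the
`θ`'s are the principal quasiminors of the `φ_w`-image of `𝓛_{p+q|m+n}`. The product of the
`θ ^ ε` is the Berezinian and that of the `Δ ^ ε` is the `ω`-image of the rational functions.
-/

noncomputable section

namespace BetheDuality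

section Grassmann

variable {β G : Type*} [Ring G]

/-- A Grassmann family: pairwise anticommuting elements of square zero. -/
structure IsGrassmann (f : β → G) : Prop where
  mul_self : ∀ b, f b * f b = 0
  anticomm : ∀ b c, f b * f c = -(f c * f b)

theorem exists_prod_mul_eq_smul {x : G} {f : β → G} (h : ∀ b, f b * x = -(x * f b)) (l : List β) :
    ∃ ε : ℤˣ, (l.map f).prod * x = ε • (x * (l.map f).prod) := by
  induction l with
  | nil => exact ⟨1, by simp⟩
  | cons c l ih =>
    obtain ⟨ε, hε⟩ := ih
    refine ⟨-ε, ?_⟩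
    rw [List.map_cons, List.prod_cons, mul_assoc, hε, mul_smul_comm, ← mul_assoc, h, neg_mul,
      smul_neg, Units.neg_smul, mul_assoc]

namespace IsGrassmann

variable {f : β → G}

theorem prod_mul_eq_zero (hf : IsGrassmann f) {l : List β} {b : β} (hb : b ∈ l) :
    (l.map f).prod * f b = 0 := by
  induction l with
  | nil => simp at hb
  | cons c l ih =>
    by_cases hbl : b ∈ l
    · rw [List.map_cons, List.prod_cons, mul_assoc, ih hbl, mul_zero]
    obtain rfl : b = c := by simpa [hbl] using hb
    obtain ⟨ε, hε⟩ := exists_prod_mul_eq_smul (fun c => hf.anticomm c b) l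
    rw [List.map_cons, List.prod_cons, mul_assoc, hε, mul_smul_comm, ← mul_assoc, hf.mul_self,
      zero_mul, smul_zero]

theorem mul_prod_eq_zero (hf : IsGrassmann f) {l : List β} {b : β} (hb : b ∈ l) :
    f b * (l.map f).prod = 0 := by
  obtain ⟨ε, hε⟩ := exists_prod_mul_eq_smul (fun c => hf.anticomm c b) l
  rw [hf.prod_mul_eq_zero hb] at hε
  exact (smul_eq_zero_iff_eq ε).1 hε.symm

theorem mul_of_commute (hf : IsGrassmann f) {c : β → G} (hc : ∀ a b, Commute (c a) (c b))
    (hfc : ∀ a b, Commute (c a) (f b)) : IsGrassmann fun b => f b * c b where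
  mul_self b := by rw [(hfc b b).mul_mul_mul_comm, hf.mul_self, zero_mul]
  anticomm a b := by
    rw [(hfc a b).mul_mul_mul_comm, (hfc b a).mul_mul_mul_comm, hf.anticomm, (hc a b).eq, neg_mul]

theorem sum_mul_self (hf : IsGrassmann f) (s : Finset β) :
    (∑ b ∈ s, f b) * ∑ b ∈ s, f b = 0 := by
  classical
  induction s using Finset.induction_on with
  | empty => simp
  | insert b s hb ih =>
    have hanti : f b * ∑ c ∈ s, f c = -((∑ c ∈ s, f c) * f b) := by
      rw [Finset.mul_sum, Finset.sum_mul, ← Finset.sum_neg_distrib]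
      exact Finset.sum_congr rfl fun c _ => hf.anticomm b c
    rw [Finset.sum_insert hb, add_mul, mul_add, mul_add, hf.mul_self, ih, hanti]
    abel

/-- The algebra homomorphism from the exterior algebra given by a Grassmann family. -/
def exteriorLift {d : ℕ} {f : Fin d → G} (hf : IsGrassmann f) :
    ExteriorAlgebra ℤ (Fin d → ℤ) →ₐ[ℤ] G :=
  ExteriorAlgebra.lift ℤ ⟨Fintype.linearCombination ℤ f, fun v => by
    have h := (hf.mul_of_commute (c := fun b => (v b : G)) (fun a b => Int.cast_commute _ _)
      fun a b => Int.cast_commute _ _).sum_mul_self Finset.univ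
    simpa only [Fintype.linearCombination_apply, zsmul_eq_mul, (Int.cast_commute _ _).eq] using h⟩

theorem exteriorLift_ιMulti {d k : ℕ} {f : Fin d → G} (hf : IsGrassmann f) (g : Fin k → Fin d) :
    hf.exteriorLift (ExteriorAlgebra.ιMulti ℤ k fun b => Pi.single (g b) 1) =
      (List.ofFn fun b => f (g b)).prod := by
  rw [ExteriorAlgebra.ιMulti_apply, map_list_prod, List.map_ofFn]
  congr 2
  funext b
  simp [exteriorLift, Fintype.linearCombination_apply_single]

theorem prod_perm {d : ℕ} {f : Fin d → G} (hf : IsGrassmann f) (σ : Equiv.Perm (Fin d)) :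
    (List.ofFn fun b => f (σ b)).prod = Equiv.Perm.sign σ • (List.ofFn f).prod := by
  have h := congrArg hf.exteriorLift
    ((ExteriorAlgebra.ιMulti ℤ d).map_perm (fun b : Fin d => Pi.single b (1 : ℤ)) σ)
  rw [Units.smul_def, map_zsmul, exteriorLift_ιMulti hf fun b => b] at h
  rw [Units.smul_def, ← h]
  exact (exteriorLift_ιMulti hf σ).symm

theorem prod_eq_zero_of_not_injective {d k : ℕ} {f : Fin d → G} (hf : IsGrassmann f)
    {g : Fin k → Fin d} (hg : ¬ Function.Injective g) : (List.ofFn fun b => f (g b)).prod = 0 := by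
  rw [← exteriorLift_ιMulti hf, AlternatingMap.map_eq_zero_of_not_injective, map_zero]
  exact fun h => hg fun a b hab => h (congrArg (Pi.single · (1 : ℤ)) hab)

end IsGrassmann

end Grassmann

/-- The rank one update `Ψ b - ε γ Δ⁻¹ r b`: the columns of a Schur complement. -/
def rankOneUpdate {β G : Type*} [Ring G] (ε : ℤˣ) (Ψ r : β → G) (γ : G) (Δ : Gˣ) (b : β) : G :=
  Ψ b - ε • (γ * ↑Δ⁻¹ * r b)

/-- The commutation relations between the columns `Ψ b` of a matrix, the entries `r b` of a row, a
column `γ` and an invertible corner `Δ`, under which the rank one update of the columns is again a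
Grassmann family; `ψ b` is the basis vector of index `b`, and the sign `ε` is the parity of the
bordering row and column. -/
structure GrassmannBordering {β G : Type*} [Ring G] (ε : ℤˣ) (Ψ ψ r : β → G) (γ : G) (Δ : Gˣ) :
    Prop where
  isGrassmann : IsGrassmann Ψ
  col_mul_matrix : ∀ b, γ * Ψ b = -ε • (Ψ b * γ)
  row_mul_col : ∀ b, r b * γ = γ * r b - ψ b
  row_mul_matrix : ∀ b c, r b * Ψ c = ε • (Ψ c * r b)
  row_mul_row : ∀ b c, r b * r c = ε • (r c * r b)
  corner_mul_matrix : ∀ b, Δ * Ψ b = Ψ b * Δ + ψ b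
  corner_row : ∀ b, Commute (Δ : G) (r b)
  corner_col : Commute (Δ : G) γ
  col_mul_self : ε = 1 → γ * γ = 0
  row_mul_self : ε = -1 → ∀ b, r b * r b = 0

namespace GrassmannBordering

variable {β G : Type*} [Ring G] {Ψ ψ r : β → G} {γ : G} {Δ : Gˣ}

section Update

variable {ε : ℤˣ}

theorem inv_mul_matrix (h : GrassmannBordering ε Ψ ψ r γ Δ) (b : β) :
    ↑Δ⁻¹ * Ψ b = Ψ b * ↑Δ⁻¹ - ↑Δ⁻¹ * ψ b * ↑Δ⁻¹ := by
  rw [Units.inv_mul_eq_iff_eq_mul, mul_sub, ← mul_assoc, h.corner_mul_matrix, add_mul, mul_assoc,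
    Units.mul_inv, mul_one, ← mul_assoc, Units.mul_inv_cancel_left, add_sub_cancel_right]

theorem rankOne_mul_matrix (h : GrassmannBordering ε Ψ ψ r γ Δ) (b c : β) :
    γ * ↑Δ⁻¹ * r b * Ψ c = -(Ψ c * (γ * ↑Δ⁻¹ * r b)) - ε • (γ * ↑Δ⁻¹ * ψ c * ↑Δ⁻¹ * r b) := by
  calc γ * ↑Δ⁻¹ * r b * Ψ c = ε • (γ * (↑Δ⁻¹ * Ψ c) * r b) := by
        rw [mul_assoc, h.row_mul_matrix, mul_smul_comm]; simp only [mul_assoc]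
    _ = ε • (γ * Ψ c * ↑Δ⁻¹ * r b) - ε • (γ * ↑Δ⁻¹ * ψ c * ↑Δ⁻¹ * r b) := by
        rw [h.inv_mul_matrix, ← smul_sub]; simp only [mul_sub, sub_mul, mul_assoc]
    _ = _ := by
        rw [h.col_mul_matrix]
        simp only [Units.neg_smul, neg_mul, smul_neg, smul_mul_assoc, smul_smul,
          Int.units_mul_self, one_smul, mul_assoc]

theorem rankOne_mul_rankOne (h : GrassmannBordering ε Ψ ψ r γ Δ) (b c : β) :
    γ * ↑Δ⁻¹ * r b * (γ * ↑Δ⁻¹ * r c) =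
      γ * γ * (↑Δ⁻¹ * ↑Δ⁻¹) * (r b * r c) - γ * ↑Δ⁻¹ * ψ b * ↑Δ⁻¹ * r c := by
  have hγ : ↑Δ⁻¹ * γ = γ * ↑Δ⁻¹ := h.corner_col.units_inv_left
  have hr : r b * ↑Δ⁻¹ = ↑Δ⁻¹ * r b := (h.corner_row b).units_inv_left.symm
  calc γ * ↑Δ⁻¹ * r b * (γ * ↑Δ⁻¹ * r c) = γ * ↑Δ⁻¹ * (r b * γ) * (↑Δ⁻¹ * r c) := by
        simp only [mul_assoc]
    _ = γ * (↑Δ⁻¹ * γ) * (r b * ↑Δ⁻¹) * r c - γ * ↑Δ⁻¹ * ψ b * ↑Δ⁻¹ * r c := by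
        rw [h.row_mul_col]; simp only [mul_sub, sub_mul, mul_assoc]
    _ = _ := by rw [hγ, hr]; simp only [mul_assoc]

theorem update_mul_update (h : GrassmannBordering ε Ψ ψ r γ Δ) (b c : β) :
    rankOneUpdate ε Ψ r γ Δ b * rankOneUpdate ε Ψ r γ Δ c =
      Ψ b * Ψ c - ε • (Ψ b * (γ * ↑Δ⁻¹ * r c) - Ψ c * (γ * ↑Δ⁻¹ * r b)) +
        (γ * ↑Δ⁻¹ * ψ c * ↑Δ⁻¹ * r b - γ * ↑Δ⁻¹ * ψ b * ↑Δ⁻¹ * r c) +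
          γ * γ * (↑Δ⁻¹ * ↑Δ⁻¹) * (r b * r c) := by
  rw [rankOneUpdate, rankOneUpdate, sub_mul, mul_sub, mul_sub, smul_mul_smul_comm,
    smul_mul_assoc, mul_smul_comm, h.rankOne_mul_matrix, h.rankOne_mul_rankOne,
    Int.units_mul_self, one_smul, smul_sub, smul_sub, smul_neg, smul_smul, Int.units_mul_self,
    one_smul]
  abel

theorem isGrassmann_update (h : GrassmannBordering ε Ψ ψ r γ Δ) :
    IsGrassmann (rankOneUpdate ε Ψ r γ Δ) := by
  have hlast : IsGrassmann Ψ ∧ (∀ b, γ * γ * (↑Δ⁻¹ * ↑Δ⁻¹) * (r b * r b) = 0) ∧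
      ∀ b c, γ * γ * (↑Δ⁻¹ * ↑Δ⁻¹) * (r b * r c) = -(γ * γ * (↑Δ⁻¹ * ↑Δ⁻¹) * (r c * r b)) := by
    refine ⟨h.isGrassmann, ?_⟩
    rcases Int.units_eq_one_or ε with hε | hε
    · simp [h.col_mul_self hε]
    · exact ⟨fun b => by rw [h.row_mul_self hε, mul_zero],
        fun b c => by rw [h.row_mul_row, hε, Units.neg_smul, one_smul, mul_neg]⟩
  obtain ⟨hΨ, hsq, hanti⟩ := hlast
  constructor
  · intro b
    rw [h.update_mul_update, hΨ.mul_self, hsq]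
    simp
  · intro b c
    rw [h.update_mul_update, h.update_mul_update, hΨ.anticomm b c, hanti b c, smul_sub, smul_sub]
    abel

end Update

section Even

theorem isGrassmann_evenBlock (h : GrassmannBordering 1 Ψ ψ r γ Δ) :
    IsGrassmann fun b => !![Ψ b, -r b; 0, -Ψ b] := by
  constructor
  · intro b
    simp [h.isGrassmann.mul_self, h.row_mul_matrix, ← Matrix.ext_iff, Fin.forall_fin_two]
  · intro b c
    simp [h.isGrassmann.anticomm b c, h.row_mul_matrix, add_comm]

theorem prod_evenBlock_zero (Ψ r : β → G) (l : List β) :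
    (l.map fun b => !![Ψ b, -r b; 0, -Ψ b]).prod 0 0 = (l.map Ψ).prod ∧
      (l.map fun b => !![Ψ b, -r b; 0, -Ψ b]).prod 1 0 = 0 := by
  induction l with
  | nil => simp
  | cons b l ih => simp [Matrix.mul_apply, Fin.sum_univ_two, ih]

theorem prod_evenBlock_mulVec (h : GrassmannBordering 1 Ψ ψ r γ Δ) (l : List β) :
    (l.map fun b => !![Ψ b, -r b; 0, -Ψ b]).prod.mulVec ![↑Δ, γ] =
      fun i => ![↑Δ, γ] i * (l.map (rankOneUpdate 1 Ψ r γ Δ)).prod := by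
  have hΔγ : ∀ x, (Δ : G) * (γ * (↑Δ⁻¹ * x)) = γ * x := fun x => by
    rw [← mul_assoc, h.corner_col.eq, mul_assoc, Units.mul_inv_cancel_left]
  have hcorner (b : β) : Δ * rankOneUpdate 1 Ψ r γ Δ b = Ψ b * Δ + -r b * γ := by
    rw [rankOneUpdate, one_smul, mul_sub, h.corner_mul_matrix, mul_assoc, hΔγ, neg_mul,
      h.row_mul_col]
    abel
  have hcol (b : β) : γ * rankOneUpdate 1 Ψ r γ Δ b = -Ψ b * γ := by
    rw [rankOneUpdate, one_smul, mul_sub, h.col_mul_matrix, mul_assoc, ← mul_assoc γ γ,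
      h.col_mul_self rfl, zero_mul, sub_zero, Units.neg_smul, one_smul, neg_mul]
  induction l with
  | nil => simp
  | cons b l ih =>
    rw [List.map_cons, List.map_cons, List.prod_cons, List.prod_cons, ← Matrix.mulVec_mulVec, ih]
    ext i
    fin_cases i
    · simp [Matrix.mulVec, dotProduct, Fin.sum_univ_two, ← mul_assoc, hcorner, add_mul]
    · simp [Matrix.mulVec, dotProduct, Fin.sum_univ_two, ← mul_assoc, hcol]

theorem corner_mul_prod_rankOneUpdate [Fintype β] (h : GrassmannBordering 1 Ψ ψ r γ Δ) {u : β → G}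
    (hu : γ = ∑ b, Ψ b * u b) {l : List β} (hl : ∀ b, b ∈ l) :
    Δ * (l.map (rankOneUpdate 1 Ψ r γ Δ)).prod = (l.map Ψ).prod * (Δ - ∑ b, r b * u b) := by
  obtain ⟨h00, -⟩ := prod_evenBlock_zero Ψ r l
  have hvec := congrFun (h.prod_evenBlock_mulVec l) 0
  -- The product already contains the factor of index `b`, so multiplying by it once more gives `0`.
  have hzero (b : β) := congrFun (congrFun (h.isGrassmann_evenBlock.prod_mul_eq_zero (hl b)) 0) 1
  generalize (l.map fun b => !![Ψ b, -r b; 0, -Ψ b]).prod = M at *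
  have hcol : M 0 1 * γ = -(M 0 0 * ∑ b, r b * u b) := by
    have (b : β) : M 0 1 * Ψ b = -(M 0 0 * r b) := by
      have h01 : -(M 0 0 * r b + M 0 1 * Ψ b) = 0 := by
        simpa [Matrix.mul_apply, Fin.sum_univ_two, add_comm] using hzero b
      exact eq_neg_of_add_eq_zero_right (neg_eq_zero.1 h01)
    rw [hu, Finset.mul_sum, Finset.mul_sum, ← Finset.sum_neg_distrib]
    exact Finset.sum_congr rfl fun b _ => by rw [← mul_assoc, this, neg_mul, mul_assoc]
  have hvec : M 0 0 * Δ + M 0 1 * γ = Δ * (l.map (rankOneUpdate 1 Ψ r γ Δ)).prod := by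
    simpa [Matrix.mulVec, dotProduct, Fin.sum_univ_two] using hvec
  rw [← hvec, hcol, h00, mul_sub, sub_eq_add_neg]

end Even

section Odd

theorem commute_shift (h : GrassmannBordering (-1) Ψ ψ r γ Δ) (b : β) :
    Commute (↑Δ + γ) (Ψ b - r b) := by
  have hcol : γ * Ψ b = Ψ b * γ := by simpa using h.col_mul_matrix b
  rw [Commute, SemiconjBy, add_mul, mul_sub, mul_sub, sub_mul, mul_add, mul_add,
    h.corner_mul_matrix, h.row_mul_col, hcol, (h.corner_row b).eq]
  abel

theorem isGrassmann_shift (h : GrassmannBordering (-1) Ψ ψ r γ Δ) :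
    IsGrassmann fun b => Ψ b - r b := by
  have hmul (b c : β) : (Ψ b - r b) * (Ψ c - r c) =
      Ψ b * Ψ c - (Ψ b * r c - Ψ c * r b) + r b * r c := by
    rw [sub_mul, mul_sub, mul_sub, h.row_mul_matrix, Units.neg_smul, one_smul]
    abel
  constructor
  · intro b
    rw [hmul, h.isGrassmann.mul_self, h.row_mul_self rfl]
    simp
  · intro b c
    rw [hmul, hmul, h.isGrassmann.anticomm b c, h.row_mul_row b c, Units.neg_smul, one_smul]
    abel

theorem prod_shift_mul [Fintype β] (h : GrassmannBordering (-1) Ψ ψ r γ Δ) {u : β → G}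
    (hu : γ = ∑ b, Ψ b * u b) {l : List β} (hl : ∀ b, b ∈ l) :
    (l.map fun b => Ψ b - r b).prod * (Δ + ∑ b, r b * u b) =
      (↑Δ + γ) * (l.map fun b => Ψ b - r b).prod := by
  have hcomm : Commute (↑Δ + γ) (l.map fun b => Ψ b - r b).prod :=
    Commute.list_prod_right _ _ fun x hx => by
      obtain ⟨b, -, rfl⟩ := List.mem_map.1 hx
      exact h.commute_shift b
  have hcol : (l.map fun b => Ψ b - r b).prod * γ =
      (l.map fun b => Ψ b - r b).prod * ∑ b, r b * u b := by
    rw [hu, ← sub_eq_zero, ← mul_sub, ← Finset.sum_sub_distrib, Finset.mul_sum]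
    refine Finset.sum_eq_zero fun b _ => ?_
    rw [← sub_mul, ← mul_assoc, h.isGrassmann_shift.prod_mul_eq_zero (hl b), zero_mul]
  rw [hcomm.eq, mul_add, mul_add, hcol]

theorem rankOneUpdate_eq_shift (Ψ r : β → G) (γ : G) (Δ : Gˣ) (b : β) :
    rankOneUpdate (-1) Ψ r γ Δ b = (Ψ b - r b) + (↑Δ + γ) * (↑Δ⁻¹ * r b) := by
  rw [rankOneUpdate, add_mul, Units.mul_inv_cancel_left, Units.neg_smul, one_smul, mul_assoc]
  abel

end Odd

end GrassmannBordering

section Bordering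

/-- Fermionic creation operators `psi a` in a ring `G`, together with a coefficient ring `P` acting
by even elements and the parity operator `par`, which anticommutes with the `psi a`. -/
structure Fermions (G P : Type*) [Ring G] [Ring P] (d : ℕ) where
  coef : P →+* G
  psi : Fin d → G
  par : G
  isGrassmann_psi : IsGrassmann psi
  coef_psi : ∀ p a, Commute (coef p) (psi a)
  par_mul_par : par * par = 1
  par_coef : ∀ p, Commute par (coef p)
  par_mul_psi : ∀ a, par * psi a = -(psi a * par)

variable {G P : Type*} [Ring G] [Ring P] {d : ℕ}

namespace Fermions

variable (F : Fermions G P d)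

/-- The element `∑ a, ψ_a X_{ab}` attached to the column `b` of a matrix. -/
def col (X : Matrix (Fin d) (Fin d) P) (b : Fin d) : G := ∑ a, F.psi a * F.coef (X a b)

/-- A matrix with noncommuting entries is a Manin matrix if its columns, contracted with the
fermions, form a Grassmann family. -/
def IsManin (X : Matrix (Fin d) (Fin d) P) : Prop := IsGrassmann (F.col X)

/-- The parity operator if `ε = -1`: multiplication by it turns coefficients of sign `ε` into
elements satisfying the sign rule with the fermions. -/
def twist (ε : ℤˣ) : G := if ε = 1 then 1 else F.par

/-- The entries of a row of sign `ε`, made to satisfy the sign rule with the fermions. -/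
def twistedRow (ε : ℤˣ) (ρ : Fin d → P) (b : Fin d) : G := F.twist ε * F.coef (ρ b)

/-- The contraction of a column of sign `ε` with the fermions. -/
def twistedCol (ε : ℤˣ) (χ : Fin d → P) : G := ∑ a, F.psi a * (F.twist ε * F.coef (χ a))

variable {F}

theorem prod_psi_mul_coef {k : ℕ} (g : Fin k → Fin d) (x : Fin k → P) :
    (List.ofFn fun b => F.psi (g b) * F.coef (x b)).prod =
      (List.ofFn fun b => F.psi (g b)).prod * F.coef (List.ofFn x).prod := by
  induction k with
  | zero => simp
  | succ k ih =>
    have hcomm : Commute (F.coef (x 0)) (List.ofFn fun b : Fin k => F.psi (g b.succ)).prod :=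
      Commute.list_prod_right _ _ fun y hy => by
        obtain ⟨b, rfl⟩ := List.mem_ofFn.1 hy
        exact F.coef_psi _ _
    rw [List.ofFn_succ, List.ofFn_succ, List.ofFn_succ, List.prod_cons, List.prod_cons,
      List.prod_cons, map_mul, ih (fun b => g b.succ) fun b => x b.succ, hcomm.mul_mul_mul_comm]

theorem prod_col (X : Matrix (Fin d) (Fin d) P) :
    (List.ofFn (F.col X)).prod = (List.ofFn F.psi).prod * F.coef (cdet X) := by
  have hexpand : (List.ofFn (F.col X)).prod =
      ∑ g : Fin d → Fin d, (List.ofFn fun b => F.psi (g b) * F.coef (X (g b) b)).prod :=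
    (MultilinearMap.mkPiAlgebraFin ℤ d G).map_sum fun b a => F.psi a * F.coef (X a b)
  rw [hexpand, cdet, map_sum, Finset.mul_sum]
  refine (Fintype.sum_of_injective (fun σ : Equiv.Perm (Fin d) => ⇑σ) DFunLike.coe_injective _ _
    (fun g hg => ?_) fun σ => ?_).symm
  · have hninj : ¬ Function.Injective g := fun hinj =>
      hg ⟨Equiv.ofBijective g (Finite.injective_iff_bijective.1 hinj), rfl⟩
    rw [prod_psi_mul_coef, F.isGrassmann_psi.prod_eq_zero_of_not_injective hninj, zero_mul]
  · rw [prod_psi_mul_coef, F.isGrassmann_psi.prod_perm, Units.smul_def, map_zsmul,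
      smul_mul_assoc, mul_smul_comm]

theorem isManin_diagonal {W : Fin d → P} (hW : ∀ a b, Commute (W a) (W b)) :
    F.IsManin (Matrix.diagonal W) := by
  have hcol : F.col (Matrix.diagonal W) = fun b => F.psi b * F.coef (W b) := by
    funext b
    rw [col, Finset.sum_eq_single b (fun a _ hab => ?_) (by simp), Matrix.diagonal_apply_eq]
    rw [Matrix.diagonal_apply_ne _ hab, map_zero, mul_zero]
  rw [IsManin, hcol]
  exact F.isGrassmann_psi.mul_of_commute (fun a b => (hW a b).map F.coef) fun a b => F.coef_psi _ b

variable (F) (ε : ℤˣ)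

theorem twist_mul_twist : F.twist ε * F.twist ε = 1 := by
  unfold twist
  split_ifs
  exacts [one_mul 1, F.par_mul_par]

theorem commute_twist_coef (p : P) : Commute (F.twist ε) (F.coef p) := by
  unfold twist
  split_ifs
  exacts [Commute.one_left _, F.par_coef p]

theorem twist_mul_psi (a : Fin d) : F.twist ε * F.psi a = ε • (F.psi a * F.twist ε) := by
  unfold twist
  rcases Int.units_eq_one_or ε with rfl | rfl
  · simp
  · simpa using F.par_mul_psi a

theorem twistedRow_mul_psi (ρ : Fin d → P) (a b : Fin d) :
    F.twistedRow ε ρ b * F.psi a = ε • (F.psi a * F.twistedRow ε ρ b) := by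
  rw [twistedRow, mul_assoc, (F.coef_psi _ _).eq, ← mul_assoc, twist_mul_psi, smul_mul_assoc,
    mul_assoc]

theorem twist_coef_mul_twist_coef (x y : P) :
    F.twist ε * F.coef x * (F.twist ε * F.coef y) = F.coef (x * y) := by
  rw [(F.commute_twist_coef ε x).symm.mul_mul_mul_comm, twist_mul_twist, one_mul, map_mul]

end Fermions

/-- The relations between a matrix `X`, a row `ρ`, a column `χ` and an invertible `Δ` under which
`X` may be bordered by `ρ`, `χ` and `Δ`; the sign `ε` is the parity of the bordering index. -/
structure Bordering (ε : ℤˣ) (X : Matrix (Fin d) (Fin d) P) (ρ χ : Fin d → P) (Δ : Pˣ) :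
    Prop where
  row_entry : ∀ a b c, Commute (ρ c) (X a b)
  col_entry : ∀ a b c, Commute (χ c) (X a b)
  corner_row : ∀ b, Commute (Δ : P) (ρ b)
  corner_col : ∀ a, Commute (Δ : P) (χ a)
  corner_entry : ∀ a b, Δ * X a b = X a b * Δ + if a = b then 1 else 0
  row_row : ∀ a b, ρ a * ρ b = ε • (ρ b * ρ a)
  row_mul_self : ε = -1 → ∀ b, ρ b * ρ b = 0
  col_col : ∀ a b, χ a * χ b = ε • (χ b * χ a)
  col_row : ∀ a b, χ a * ρ b = ε • (ρ b * χ a) + if a = b then 1 else 0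

/-- The rank one update `X - ε χ Δ⁻¹ ρ`, the Schur complement of `Δ`. -/
def border (ε : ℤˣ) (X : Matrix (Fin d) (Fin d) P) (ρ χ : Fin d → P) (Δ : Pˣ) :
    Matrix (Fin d) (Fin d) P :=
  Matrix.of fun a b => X a b - ε • (χ a * ↑Δ⁻¹ * ρ b)

namespace Bordering

variable (F : Fermions G P d) {ε : ℤˣ} {X : Matrix (Fin d) (Fin d) P} {ρ χ : Fin d → P} {Δ : Pˣ}

theorem twistedCol_mul_col (h : Bordering ε X ρ χ Δ) (b : Fin d) :
    F.twistedCol ε χ * F.col X b = -ε • (F.col X b * F.twistedCol ε χ) := by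
  rw [Fermions.twistedCol, Fermions.col, Finset.sum_mul_sum, Finset.sum_mul_sum, Finset.sum_comm,
    Finset.smul_sum]
  refine Finset.sum_congr rfl fun c _ => ?_
  rw [Finset.smul_sum]
  refine Finset.sum_congr rfl fun a _ => ?_
  have hcomm : Commute (F.twist ε * F.coef (χ a)) (F.coef (X c b)) :=
    (F.commute_twist_coef ε _).mul_left ((h.col_entry c b a).map F.coef)
  calc F.psi a * (F.twist ε * F.coef (χ a)) * (F.psi c * F.coef (X c b))
      = F.psi a * (F.twistedRow ε χ a * F.psi c) * F.coef (X c b) := by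
        simp only [Fermions.twistedRow, mul_assoc]
    _ = ε • (F.psi a * F.psi c * (F.twist ε * F.coef (χ a) * F.coef (X c b))) := by
        rw [F.twistedRow_mul_psi]
        simp only [Fermions.twistedRow, mul_smul_comm, smul_mul_assoc, mul_assoc]
    _ = -ε • (F.psi c * (F.psi a * F.coef (X c b)) * (F.twist ε * F.coef (χ a))) := by
        rw [F.isGrassmann_psi.anticomm, hcomm.eq]
        simp only [neg_mul, smul_neg, Units.neg_smul, mul_assoc]
    _ = _ := by rw [← (F.coef_psi _ _).eq]; simp only [mul_assoc]

theorem twistedRow_mul_twistedCol (h : Bordering ε X ρ χ Δ) (b : Fin d) :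
    F.twistedRow ε ρ b * F.twistedCol ε χ =
      F.twistedCol ε χ * F.twistedRow ε ρ b - F.psi b := by
  have hterm (a : Fin d) : F.twistedRow ε ρ b * (F.psi a * (F.twist ε * F.coef (χ a))) =
      F.psi a * (F.twist ε * F.coef (χ a)) * F.twistedRow ε ρ b -
        if a = b then F.psi a else 0 := by
    rw [← mul_assoc, F.twistedRow_mul_psi, Fermions.twistedRow, smul_mul_assoc, mul_assoc,
      mul_assoc (F.psi a), F.twist_coef_mul_twist_coef, F.twist_coef_mul_twist_coef, h.col_row,
      map_add, mul_add, Units.smul_def, Units.smul_def, map_zsmul, mul_smul_comm, eq_sub_iff_add_eq]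
    split_ifs <;> simp
  rw [Fermions.twistedCol, Finset.mul_sum, Finset.sum_mul]
  simp only [hterm, Finset.sum_sub_distrib, Finset.sum_ite_eq', Finset.mem_univ, if_true]

theorem twistedRow_mul_col (h : Bordering ε X ρ χ Δ) (b c : Fin d) :
    F.twistedRow ε ρ b * F.col X c = ε • (F.col X c * F.twistedRow ε ρ b) := by
  rw [Fermions.col, Finset.mul_sum, Finset.sum_mul, Finset.smul_sum]
  refine Finset.sum_congr rfl fun a _ => ?_
  have hcomm : Commute (F.twistedRow ε ρ b) (F.coef (X a c)) :=
    (F.commute_twist_coef ε _).mul_left ((h.row_entry a c b).map F.coef)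
  rw [← mul_assoc, F.twistedRow_mul_psi, smul_mul_assoc, mul_assoc, hcomm.eq, mul_assoc]

theorem coef_corner_mul_col (h : Bordering ε X ρ χ Δ) (b : Fin d) :
    F.coef Δ * F.col X b = F.col X b * F.coef Δ + F.psi b := by
  have hterm (a : Fin d) : F.coef Δ * (F.psi a * F.coef (X a b)) =
      F.psi a * F.coef (X a b) * F.coef Δ + if a = b then F.psi a else 0 := by
    rw [← mul_assoc, (F.coef_psi _ _).eq, mul_assoc, ← map_mul, h.corner_entry, map_add, map_mul,
      mul_add, mul_assoc]
    split_ifs <;> simp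
  rw [Fermions.col, Finset.mul_sum, Finset.sum_mul]
  simp only [hterm, Finset.sum_add_distrib, Finset.sum_ite_eq', Finset.mem_univ, if_true]

theorem commute_coef_corner_twistedCol (h : Bordering ε X ρ χ Δ) :
    Commute (F.coef Δ) (F.twistedCol ε χ) :=
  Commute.sum_right _ _ _ fun a _ => (F.coef_psi _ a).mul_right
    ((F.commute_twist_coef ε _).symm.mul_right ((h.corner_col a).map F.coef))

theorem twistedCol_mul_self (h : Bordering 1 X ρ χ Δ) :
    F.twistedCol 1 χ * F.twistedCol 1 χ = 0 := by
  refine (F.isGrassmann_psi.mul_of_commute (fun a b => ?_) fun a b => ?_).sum_mul_self Finset.univ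
  · have : Commute (χ a) (χ b) := (h.col_col a b).trans (one_smul _ _)
    simpa [Fermions.twist] using this.map F.coef
  · simpa [Fermions.twist] using F.coef_psi (χ a) b

theorem grassmannBordering (h : Bordering ε X ρ χ Δ) (hX : F.IsManin X) :
    GrassmannBordering ε (F.col X) F.psi (F.twistedRow ε ρ) (F.twistedCol ε χ)
      (Units.map F.coef Δ) where
  isGrassmann := hX
  col_mul_matrix := h.twistedCol_mul_col F
  row_mul_col := h.twistedRow_mul_twistedCol F
  row_mul_matrix := h.twistedRow_mul_col F
  row_mul_row b c := by
    rw [Fermions.twistedRow, Fermions.twistedRow, F.twist_coef_mul_twist_coef,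
      F.twist_coef_mul_twist_coef, h.row_row, Units.smul_def, Units.smul_def, map_zsmul]
  corner_mul_matrix := h.coef_corner_mul_col F
  corner_row b := (F.commute_twist_coef ε _).symm.mul_right ((h.corner_row b).map F.coef)
  corner_col := h.commute_coef_corner_twistedCol F
  col_mul_self := by rintro rfl; exact h.twistedCol_mul_self F
  row_mul_self hε b := by
    rw [Fermions.twistedRow, F.twist_coef_mul_twist_coef, h.row_mul_self hε, map_zero]

theorem col_border (b : Fin d) : F.col (border ε X ρ χ Δ) b =
    rankOneUpdate ε (F.col X) (F.twistedRow ε ρ) (F.twistedCol ε χ) (Units.map F.coef Δ) b := by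
  have hterm (a : Fin d) : F.psi a * (F.twist ε * F.coef (χ a)) * F.coef ↑Δ⁻¹ *
      (F.twist ε * F.coef (ρ b)) = F.psi a * F.coef (χ a * ↑Δ⁻¹ * ρ b) := by
    rw [← F.twist_coef_mul_twist_coef ε, map_mul]
    simp only [mul_assoc]
  simp only [Fermions.col, border, Matrix.of_apply, rankOneUpdate, map_sub, mul_sub,
    Finset.sum_sub_distrib, Fermions.twistedCol, Fermions.twistedRow, ← map_inv, Units.coe_map,
    MonoidHom.coe_coe, Finset.sum_mul, Finset.smul_sum, hterm, Units.smul_def, map_zsmul,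
    mul_smul_comm]

theorem isManin_border (h : Bordering ε X ρ χ Δ) (hX : F.IsManin X) :
    F.IsManin (border ε X ρ χ Δ) := by
  rw [Fermions.IsManin, funext (col_border F)]
  exact (h.grassmannBordering F hX).isGrassmann_update

end Bordering

end Bordering

/-- The Fock space: `P`-valued functions on the sets of occupied states. -/
abbrev Fock (P : Type*) (d : ℕ) : Type _ := Finset (Fin d) → P

namespace Fock

variable {P : Type*} [Ring P] {d : ℕ}

variable (P) in
/-- The creation operator of the state `a`. The states occupied by an elementary vector are created
in decreasing order, whence the sign. -/
def psi (a : Fin d) : Module.End ℤ (Fock P d) where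
  toFun v S := if a ∈ S then (-1 : ℤˣ) ^ {c ∈ S | c < a}.card • v (S.erase a) else 0
  map_add' v w := by ext S; by_cases h : a ∈ S <;> simp [h]
  map_smul' n v := by ext S; by_cases h : a ∈ S <;> simp [h, smul_comm n]

theorem psi_apply (a : Fin d) (v : Fock P d) (S : Finset (Fin d)) :
    psi P a v S = if a ∈ S then (-1 : ℤˣ) ^ {c ∈ S | c < a}.card • v (S.erase a) else 0 := rfl

variable (P d) in
/-- The sign of the parity of the number of occupied states. -/
def par : Module.End ℤ (Fock P d) where
  toFun v S := (-1 : ℤˣ) ^ S.card • v S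
  map_add' v w := by ext S; simp
  map_smul' n v := by ext S; simp [smul_comm n]

theorem par_apply (v : Fock P d) (S : Finset (Fin d)) :
    par P d v S = (-1 : ℤˣ) ^ S.card • v S := rfl

variable (P d) in
/-- The vacuum vector. -/
def vac : Fock P d := Pi.single ∅ 1

theorem psi_mul_psi_of_lt {a b : Fin d} (h : a < b) : psi P a * psi P b = -(psi P b * psi P a) := by
  refine LinearMap.ext fun v => funext fun S => ?_
  rw [LinearMap.neg_apply, Pi.neg_apply, Module.End.mul_apply, Module.End.mul_apply]
  simp only [psi_apply, Finset.mem_erase, ne_eq, h.ne, h.ne', not_false_eq_true, true_and]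
  by_cases ha : a ∈ S
  · by_cases hb : b ∈ S
    · have hpos : {c ∈ S | c < b}.card = {c ∈ S.erase a | c < b}.card + 1 := by
        rw [Finset.filter_erase, Finset.card_erase_add_one (by simp [ha, h])]
      have heq : {c ∈ S.erase b | c < a}.card = {c ∈ S | c < a}.card := by
        rw [Finset.filter_erase, Finset.erase_eq_of_notMem (by simp [h.le])]
      simp only [if_pos ha, if_pos hb, smul_smul, hpos, heq, pow_succ,
        Finset.erase_right_comm (a := a)]
      simp [Units.neg_smul, mul_comm]
    · simp [hb]
  · simp [ha]

theorem isGrassmann_psi : IsGrassmann (psi P : Fin d → _) where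
  mul_self a := LinearMap.ext fun v => funext fun S => by simp [psi_apply]
  anticomm a b := by
    rcases lt_trichotomy a b with h | rfl | h
    · exact psi_mul_psi_of_lt h
    · have hzero : psi P a * psi P a = 0 :=
        LinearMap.ext fun v => funext fun S => by simp [psi_apply]
      rw [hzero, neg_zero]
    · rw [psi_mul_psi_of_lt h, neg_neg]

variable (P d) in
/-- The Fock representation of the fermions. -/
def fermions : Fermions (Module.End ℤ (Fock P d)) P d where
  coef := Module.toModuleEnd ℤ (Fock P d)
  psi := psi P
  par := par P d
  isGrassmann_psi := isGrassmann_psi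
  coef_psi p a := by
    refine LinearMap.ext fun v => funext fun S => ?_
    simp [psi_apply, mul_smul_comm]
  par_mul_par := by
    refine LinearMap.ext fun v => funext fun S => ?_
    simp [par_apply, smul_smul]
  par_coef p := by
    refine LinearMap.ext fun v => funext fun S => ?_
    simp [par_apply, mul_smul_comm]
  par_mul_psi a := by
    refine LinearMap.ext fun v => funext fun S => ?_
    by_cases ha : a ∈ S
    · simp only [psi_apply, par_apply, LinearMap.neg_apply, Pi.neg_apply, Module.End.mul_apply,
        if_pos ha, ← Finset.card_erase_add_one ha, pow_succ, mul_neg_one, Units.neg_smul]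
      rw [smul_comm]
    · simp [psi_apply, par_apply, ha]

theorem prod_psi_apply {l : List (Fin d)} (hl : l.Pairwise (· < ·)) (v : Fock P d) :
    (l.map (psi P)).prod v l.toFinset = v ∅ := by
  induction l with
  | nil => simp
  | cons a l ih =>
    obtain ⟨ha, hl⟩ := List.pairwise_cons.1 hl
    have hcard : {c ∈ insert a l.toFinset | c < a} = ∅ :=
      Finset.filter_eq_empty_iff.2 fun c hc => by
        rcases Finset.mem_insert.1 hc with rfl | hc
        exacts [lt_irrefl c, (ha c (List.mem_toFinset.1 hc)).not_gt]
    have hmem : a ∉ l.toFinset := fun h => lt_irrefl a (ha a (List.mem_toFinset.1 h))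
    rw [List.map_cons, List.prod_cons, Module.End.mul_apply, List.toFinset_cons, psi_apply,
      if_pos (Finset.mem_insert_self _ _), hcard, Finset.card_empty, pow_zero, one_smul,
      Finset.erase_insert hmem, ih hl]

theorem prod_psi_mul_coef_apply (p : P) (v : Fock P d) :
    ((List.ofFn (fermions P d).psi).prod * (fermions P d).coef p) v Finset.univ = p * v ∅ := by
  have h := prod_psi_apply (List.pairwise_lt_finRange d) (p • v)
  rwa [List.toFinset_finRange, ← List.ofFn_eq_map] at h

end Fock

section BorderedDeterminant

variable {G P : Type*} [Ring G] [Ring P] {d : ℕ}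

theorem Fermions.twistedCol_mulVec (F : Fermions G P d) (ε : ℤˣ) (X : Matrix (Fin d) (Fin d) P)
    (u : Fin d → P) :
    F.twistedCol ε (X.mulVec u) = ∑ b, F.col X b * F.twistedRow ε u b := by
  simp only [twistedCol, col, twistedRow, Matrix.mulVec, dotProduct, map_sum, map_mul,
    Finset.mul_sum, Finset.sum_mul]
  rw [Finset.sum_comm]
  refine Finset.sum_congr rfl fun b _ => Finset.sum_congr rfl fun a _ => ?_
  rw [← mul_assoc (F.twist ε), (F.commute_twist_coef ε _).eq]
  simp only [mul_assoc]

theorem Fermions.sum_twistedRow_mul (F : Fermions G P d) (ε : ℤˣ) (ρ u : Fin d → P) :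
    ∑ b, F.twistedRow ε ρ b * F.twistedRow ε u b = F.coef (∑ b, ρ b * u b) := by
  simp only [twistedRow, twist_coef_mul_twist_coef, map_sum]

theorem Fermions.commute_coef_prod_psi (F : Fermions G P d) (p : P) :
    Commute (F.coef p) (List.ofFn F.psi).prod :=
  Commute.list_prod_right _ _ fun y hy => by
    obtain ⟨b, rfl⟩ := List.mem_ofFn.1 hy
    exact F.coef_psi p b

theorem Fock.eq_of_prod_psi_mul_coef_eq {x y : P}
    (h : (List.ofFn (fermions P d).psi).prod * (fermions P d).coef x =
      (List.ofFn (fermions P d).psi).prod * (fermions P d).coef y) : x = y := by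
  simpa [prod_psi_mul_coef_apply, vac] using
    congrFun (LinearMap.congr_fun h (vac P d)) Finset.univ

variable {X : Matrix (Fin d) (Fin d) P} {ρ χ u : Fin d → P} {Δ : Pˣ}

theorem Bordering.cdet_mul_of_even (h : Bordering 1 X ρ χ Δ) (hX : (Fock.fermions P d).IsManin X)
    (hu : X.mulVec u = χ) :
    cdet X * (Δ - ∑ b, ρ b * u b) = Δ * cdet (border 1 X ρ χ Δ) := by
  set F := Fock.fermions P d
  have hexch := (h.grassmannBordering F hX).corner_mul_prod_rankOneUpdate
    (by rw [← hu, F.twistedCol_mulVec]) List.mem_finRange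
  rw [← funext (Bordering.col_border F), ← List.ofFn_eq_map, ← List.ofFn_eq_map, F.prod_col,
    F.prod_col, F.sum_twistedRow_mul, Units.coe_map, MonoidHom.coe_coe, ← map_sub, mul_assoc,
    ← map_mul, ← mul_assoc, (F.commute_coef_prod_psi _).eq, mul_assoc, ← map_mul] at hexch
  exact Fock.eq_of_prod_psi_mul_coef_eq hexch.symm

namespace Fock

variable (P d) in
/-- The vectors with fewer than `k` occupied states. -/
def degLT (k : ℕ) : AddSubgroup (Fock P d) where
  carrier := {v | ∀ S : Finset (Fin d), k ≤ S.card → v S = 0}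
  zero_mem' _ _ := rfl
  add_mem' hv hw S hS := by rw [Pi.add_apply, hv S hS, hw S hS, add_zero]
  neg_mem' hv S hS := by rw [Pi.neg_apply, hv S hS, neg_zero]

theorem degLT_mono {k l : ℕ} (h : k ≤ l) : degLT P d k ≤ degLT P d l :=
  fun _ hv S hS => hv S (h.trans hS)

theorem vac_mem_degLT : vac P d ∈ degLT P d 1 := fun _ hS =>
  Pi.single_eq_of_ne (Finset.card_pos.1 hS).ne_empty _

theorem coef_mem_degLT (p : P) {k : ℕ} {v : Fock P d} (hv : v ∈ degLT P d k) :
    (fermions P d).coef p v ∈ degLT P d k := fun S hS => by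
  rw [fermions, Module.toModuleEnd_apply]
  simp [hv S hS]

theorem psi_mem_degLT (a : Fin d) {k : ℕ} {v : Fock P d} (hv : v ∈ degLT P d k) :
    (fermions P d).psi a v ∈ degLT P d (k + 1) := fun S hS => by
  rw [fermions, psi_apply]
  split_ifs with ha
  · rw [hv _ (by rw [Finset.card_erase_of_mem ha]; omega), smul_zero]
  · rfl

theorem twist_mem_degLT (ε : ℤˣ) {k : ℕ} {v : Fock P d} (hv : v ∈ degLT P d k) :
    (fermions P d).twist ε v ∈ degLT P d k := by
  rw [Fermions.twist]
  split_ifs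
  · exact hv
  · exact fun S hS => by rw [fermions, par_apply, hv S hS, smul_zero]

theorem twistedRow_mem_degLT (ε : ℤˣ) (ρ : Fin d → P) (b : Fin d) {k : ℕ} {v : Fock P d}
    (hv : v ∈ degLT P d k) : (fermions P d).twistedRow ε ρ b v ∈ degLT P d k :=
  twist_mem_degLT ε (coef_mem_degLT _ hv)

theorem col_mem_degLT (X : Matrix (Fin d) (Fin d) P) (b : Fin d) {k : ℕ} {v : Fock P d}
    (hv : v ∈ degLT P d k) : (fermions P d).col X b v ∈ degLT P d (k + 1) := by
  rw [Fermions.col, LinearMap.sum_apply]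
  exact sum_mem fun a _ => psi_mem_degLT a (coef_mem_degLT _ hv)

theorem list_prod_mem_degLT {f : Fin d → Module.End ℤ (Fock P d)}
    (hf : ∀ b k, ∀ v ∈ degLT P d k, f b v ∈ degLT P d (k + 1)) (l : List (Fin d)) {k : ℕ}
    {v : Fock P d} (hv : v ∈ degLT P d k) : (l.map f).prod v ∈ degLT P d (k + l.length) := by
  induction l with
  | nil => exact hv
  | cons b l ih => exact hf b _ _ ih

theorem prod_sub_prod_mem_degLT {f g : Fin d → Module.End ℤ (Fock P d)}
    (hf : ∀ b k, ∀ v ∈ degLT P d k, f b v ∈ degLT P d (k + 1))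
    (hg : ∀ b k, ∀ v ∈ degLT P d k, g b v ∈ degLT P d (k + 1))
    (hfg : ∀ b k, ∀ v ∈ degLT P d k, f b v - g b v ∈ degLT P d k) (l : List (Fin d)) {k : ℕ}
    {v : Fock P d} (hv : v ∈ degLT P d (k + 1)) :
    (l.map f).prod v - (l.map g).prod v ∈ degLT P d (k + l.length) := by
  induction l with
  | nil => simp
  | cons b l ih =>
    have hsplit : ((b :: l).map f).prod v - ((b :: l).map g).prod v =
        (f b ((l.map f).prod v) - g b ((l.map f).prod v)) +
          g b ((l.map f).prod v - (l.map g).prod v) := by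
      simp
    rw [hsplit, List.length_cons]
    refine add_mem (hfg b _ _ ?_) (hg b _ _ ih)
    exact degLT_mono (by omega) (list_prod_mem_degLT hf l hv)

theorem exists_prod_eq_add_mul {f g e : Fin d → Module.End ℤ (Fock P d)}
    {Φ : Module.End ℤ (Fock P d)} (hf : ∀ b k, ∀ v ∈ degLT P d k, f b v ∈ degLT P d (k + 1))
    (hg : ∀ b k, ∀ v ∈ degLT P d k, g b v ∈ degLT P d (k + 1))
    (he : ∀ b k, ∀ v ∈ degLT P d k, e b v ∈ degLT P d k) (hΦ : ∀ b, Commute Φ (f b))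
    (hgf : ∀ b, g b = f b + Φ * e b) (l : List (Fin d)) :
    ∃ E : Module.End ℤ (Fock P d), (l.map g).prod = (l.map f).prod + Φ * E ∧
      ∀ k, ∀ v ∈ degLT P d (k + 1), E v ∈ degLT P d (k + l.length) := by
  induction l with
  | nil => exact ⟨0, by simp, fun _ _ _ => zero_mem _⟩
  | cons b l ih =>
    obtain ⟨E, hprod, hE⟩ := ih
    refine ⟨f b * E + e b * (l.map g).prod, ?_, fun k v hv => ?_⟩
    · rw [List.map_cons, List.prod_cons, List.map_cons, List.prod_cons, hgf, add_mul, mul_add,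
        ← mul_assoc Φ (f b), (hΦ b).eq, mul_assoc (f b), ← add_assoc, ← mul_add, ← hprod,
        mul_assoc Φ]
    · rw [List.length_cons, LinearMap.add_apply]
      refine add_mem (hf b _ _ (hE k v hv)) (he b _ _ ?_)
      exact degLT_mono (by omega) (list_prod_mem_degLT hg l hv)

end Fock

namespace Bordering

theorem isNilpotent_twistedCol (h : Bordering (-1) X ρ χ Δ) (F : Fermions G P d) :
    IsNilpotent (F.twistedCol (-1) χ) := by
  have hmul (a b : Fin d) :
      F.psi a * (F.twist (-1) * F.coef (χ a)) * (F.psi b * (F.twist (-1) * F.coef (χ b))) =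
        -(F.psi a * F.psi b * F.coef (χ a * χ b)) := by
    have hpsi := F.twistedRow_mul_psi (-1) χ b a
    rw [Fermions.twistedRow, Units.neg_smul, one_smul] at hpsi
    rw [mul_assoc, ← mul_assoc _ (F.psi b), hpsi, neg_mul, mul_neg, mul_assoc (F.psi b),
      F.twist_coef_mul_twist_coef, mul_assoc]
  refine Commute.isNilpotent_sum (fun a _ => ⟨2, ?_⟩) fun a b _ _ => ?_
  · rw [pow_two, hmul, F.isGrassmann_psi.mul_self, zero_mul, neg_zero]
  · rw [Commute, SemiconjBy, hmul, hmul, F.isGrassmann_psi.anticomm, h.col_col, Units.neg_smul,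
      one_smul, map_neg, neg_mul_neg]

theorem isUnit_corner_add_twistedCol (h : Bordering (-1) X ρ χ Δ) (F : Fermions G P d) :
    IsUnit (F.coef Δ + F.twistedCol (-1) χ) :=
  (h.isNilpotent_twistedCol F).isUnit_add_left_of_commute (Δ.isUnit.map F.coef)
    (h.commute_coef_corner_twistedCol F).symm

theorem twistedCol_mul_prod_psi (F : Fermions G P d) (χ : Fin d → P) :
    F.twistedCol (-1) χ * (List.ofFn F.psi).prod = 0 := by
  rw [List.ofFn_eq_map, Fermions.twistedCol, Finset.sum_mul]
  refine Finset.sum_eq_zero fun a _ => ?_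
  obtain ⟨ε, hε⟩ := exists_prod_mul_eq_smul (f := F.psi) (x := F.twistedRow (-1) χ a)
    (fun b => by rw [F.twistedRow_mul_psi, Units.neg_smul, one_smul, neg_neg]) (List.finRange d)
  have hε : F.twistedRow (-1) χ a * ((List.finRange d).map F.psi).prod =
      ε • (((List.finRange d).map F.psi).prod * F.twistedRow (-1) χ a) := by
    rw [hε, smul_smul, Int.units_mul_self, one_smul]
  rw [mul_assoc, ← Fermions.twistedRow, hε, mul_smul_comm, ← mul_assoc,
    F.isGrassmann_psi.mul_prod_eq_zero (List.mem_finRange a), zero_mul, smul_zero]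

theorem shift_mem_degLT (X : Matrix (Fin d) (Fin d) P) (ρ : Fin d → P) (b : Fin d) (k : ℕ)
    (v : Fock P d) (hv : v ∈ Fock.degLT P d k) :
    ((Fock.fermions P d).col X b - (Fock.fermions P d).twistedRow (-1) ρ b) v ∈
      Fock.degLT P d (k + 1) :=
  sub_mem (Fock.col_mem_degLT X b hv)
    (Fock.degLT_mono (Nat.le_succ _) (Fock.twistedRow_mem_degLT (-1) ρ b hv))

theorem prod_shift_apply (X : Matrix (Fin d) (Fin d) P) (ρ : Fin d → P) :
    ((List.finRange d).map fun b => (Fock.fermions P d).col X b -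
      (Fock.fermions P d).twistedRow (-1) ρ b).prod (Fock.vac P d) Finset.univ = cdet X := by
  have hlower := Fock.prod_sub_prod_mem_degLT (k := 0) (g := (Fock.fermions P d).col X)
    (shift_mem_degLT X ρ) (fun b _ _ hv => Fock.col_mem_degLT X b hv)
    (fun b _ _ hv => by simpa using Fock.twistedRow_mem_degLT (-1) ρ b hv)
    (List.finRange d) Fock.vac_mem_degLT
  have htop := sub_eq_zero.1 (hlower Finset.univ (by simp))
  rw [htop, ← List.ofFn_eq_map, Fermions.prod_col, Fock.prod_psi_mul_coef_apply, Fock.vac,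
    Pi.single_eq_same, mul_one]

theorem exists_prod_psi_mul_cdet_border (h : Bordering (-1) X ρ χ Δ)
    (hX : (Fock.fermions P d).IsManin X) (hu : X.mulVec u = χ) :
    ∃ E : Module.End ℤ (Fock P d),
      (List.ofFn (Fock.fermions P d).psi).prod * (Fock.fermions P d).coef
          (↑Δ⁻¹ * (cdet (border (-1) X ρ χ Δ) * (Δ + ∑ b, ρ b * u b))) =
        ((List.finRange d).map fun b => (Fock.fermions P d).col X b -
            (Fock.fermions P d).twistedRow (-1) ρ b).prod +
          E * (Fock.fermions P d).coef (Δ + ∑ b, ρ b * u b) ∧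
      ∀ v ∈ Fock.degLT P d 1, E v ∈ Fock.degLT P d d := by
  set F := Fock.fermions P d
  have hG := h.grassmannBordering F hX
  obtain ⟨E, hprod, hE⟩ := Fock.exists_prod_eq_add_mul
    (g := F.col (border (-1) X ρ χ Δ)) (e := fun b => F.coef ↑Δ⁻¹ * F.twistedRow (-1) ρ b)
    (shift_mem_degLT X ρ) (fun b _ _ hv => Fock.col_mem_degLT _ b hv)
    (fun b _ _ hv => Fock.coef_mem_degLT _ (Fock.twistedRow_mem_degLT (-1) ρ b hv))
    hG.commute_shift
    (fun b => by rw [col_border, GrassmannBordering.rankOneUpdate_eq_shift]; rfl) (List.finRange d)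
  have hshift := hG.prod_shift_mul (by rw [← hu, F.twistedCol_mulVec]) List.mem_finRange
  rw [F.sum_twistedRow_mul, Units.coe_map, MonoidHom.coe_coe, ← map_add] at hshift
  rw [Units.coe_map, MonoidHom.coe_coe] at hprod
  -- `Δ + γ` acts as `Δ` on the product of all `ψ_a`, which every `ψ_a` annihilates.
  refine ⟨E, (h.isUnit_corner_add_twistedCol F).mul_left_cancel ?_, fun v hv => ?_⟩
  · calc (F.coef Δ + F.twistedCol (-1) χ) * ((List.ofFn F.psi).prod * F.coef
          (↑Δ⁻¹ * (cdet (border (-1) X ρ χ Δ) * (Δ + ∑ b, ρ b * u b))))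
        = (List.ofFn F.psi).prod * F.coef (cdet (border (-1) X ρ χ Δ)) *
            F.coef (Δ + ∑ b, ρ b * u b) := by
          rw [← mul_assoc, add_mul, twistedCol_mul_prod_psi, add_zero,
            (F.commute_coef_prod_psi _).eq, mul_assoc, ← map_mul, Units.mul_inv_cancel_left,
            map_mul, mul_assoc]
      _ = _ := by
          rw [← F.prod_col, List.ofFn_eq_map, hprod, add_mul, hshift, mul_add, mul_assoc]
  · simpa using hE 0 v hv

theorem cdet_mul_of_odd (h : Bordering (-1) X ρ χ Δ) (hX : (Fock.fermions P d).IsManin X)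
    (hu : X.mulVec u = χ) :
    cdet (border (-1) X ρ χ Δ) * (Δ + ∑ b, ρ b * u b) = Δ * cdet X := by
  obtain ⟨E, hprod, hE⟩ := h.exists_prod_psi_mul_cdet_border hX hu
  have hlow := hE _ (Fock.coef_mem_degLT (Δ + ∑ b, ρ b * u b) Fock.vac_mem_degLT)
    Finset.univ (by simp)
  have htop := congrFun (LinearMap.congr_fun hprod (Fock.vac P d)) Finset.univ
  rw [Fock.prod_psi_mul_coef_apply, LinearMap.add_apply, Pi.add_apply, prod_shift_apply,
    Module.End.mul_apply, hlow, add_zero, Fock.vac, Pi.single_eq_same, mul_one] at htop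
  rw [← htop, Units.mul_inv_cancel_left]

end Bordering

end BorderedDeterminant

section Quasiminor

variable {P : Type*} [Ring P] {N : ℕ}

theorem QuasidetDefined.isUnit_quasidet {A : Matrix (Fin N) (Fin N) P} {i j : Fin N}
    (h : QuasidetDefined A i j) : IsUnit (quasidet A i j) :=
  h.2.ringInverse

theorem quasidet_eq_of_mulVec_eq_single {A : Matrix (Fin N) (Fin N) P} {i : Fin N}
    (hA : QuasidetDefined A i i) {x : Fin N → P} {θ : P} (hx : x i = 1)
    (h : A.mulVec x = Pi.single i θ) : quasidet A i i = θ := by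
  have hinv : Ring.inverse A i i * θ = 1 := by
    have := congrFun (congrArg (Ring.inverse A).mulVec h) i
    rwa [Matrix.mulVec_mulVec, Ring.inverse_mul_cancel _ hA.1, Matrix.one_mulVec, hx,
      Matrix.mulVec_single, eq_comm] at this
  rw [quasidet, ← mul_one (Ring.inverse _), ← hinv, Ring.inverse_mul_cancel_left _ _ hA.2]

theorem leading_mulVec (A : Matrix (Fin N) (Fin N) P) (k : Fin N) {y : Fin N → P}
    (hy : ∀ j, k < j → y j = 0) (i : Fin (k + 1)) :
    (leading A k).mulVec (y ∘ Fin.castLE k.isLt) i = A.mulVec y (Fin.castLE k.isLt i) := by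
  refine Fintype.sum_of_injective _ (Fin.castLE_injective k.isLt) _ _ (fun j hj => ?_) fun j => rfl
  have hkj : k < j := by
    by_contra! hle
    exact hj ⟨⟨j, Nat.lt_succ_of_le hle⟩, rfl⟩
  rw [hy j hkj, mul_zero]

theorem quasiminor_eq_of_mulVec_eq_single {A : Matrix (Fin N) (Fin N) P} {k : Fin N}
    (hA : QuasidetDefined (leading A k) (Fin.last k) (Fin.last k)) {y : Fin N → P} {θ : P}
    (hy : ∀ j, k < j → y j = 0) (hk : y k = 1)
    (h : ∀ i ≤ k, A.mulVec y i = (Pi.single k θ : Fin N → P) i) : quasiminor A k = θ := by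
  refine quasidet_eq_of_mulVec_eq_single hA (x := y ∘ Fin.castLE k.isLt) hk (funext fun i => ?_)
  rw [leading_mulVec A k hy, h _ (Fin.le_def.2 (Nat.lt_succ_iff.1 i.isLt))]
  simp only [Pi.single_apply, Fin.ext_iff, Fin.val_castLE, Fin.val_last]

end Quasiminor

theorem mul_prod_ofFn_of_intertwine {M : Type*} [Monoid M] {N : ℕ} (c : ℕ → M) (a b : Fin N → M)
    (h : ∀ k : Fin N, c k * a k = b k * c (k + 1)) :
    c 0 * (List.ofFn a).prod = (List.ofFn b).prod * c N := by
  induction N with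
  | zero => simp
  | succ N ih =>
    rw [List.ofFn_succ', List.ofFn_succ', List.prod_concat, List.prod_concat, ← mul_assoc,
      ih _ _ fun k => h k.castSucc, mul_assoc, mul_assoc]
    exact congrArg _ (h (Fin.last N))

theorem zmod_two_mul_self (a : ZMod 2) : a * a = a := by
  revert a; decide

theorem Bordering.cdet_mul_zpow {P : Type*} [Ring P] {d : ℕ} {ε : ℤˣ}
    {X : Matrix (Fin d) (Fin d) P} {ρ χ u : Fin d → P} {Δ θ : Pˣ} (h : Bordering ε X ρ χ Δ)
    (hX : (Fock.fermions P d).IsManin X) (hu : X.mulVec u = χ)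
    (hθ : (θ : P) = Δ - ε • ∑ b, ρ b * u b) :
    cdet X * ↑(θ ^ (ε : ℤ)) = ↑(Δ ^ (ε : ℤ)) * cdet (border ε X ρ χ Δ) := by
  rcases Int.units_eq_one_or ε with rfl | rfl
  · rw [one_smul] at hθ
    simpa [hθ] using h.cdet_mul_of_even hX hu
  · rw [Units.neg_smul, one_smul, sub_neg_eq_add] at hθ
    have key := h.cdet_mul_of_odd hX hu
    rw [← hθ] at key
    rw [Units.val_neg, Units.val_one, zpow_neg_one, zpow_neg_one, Units.eq_inv_mul_iff_mul_eq,
      ← mul_assoc, ← key, Units.mul_inv_cancel_right]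

/-- Oscillators `ρ`, `χ` of parities `s`, with units `Δ` and `W` such that `[Δ i, W a] = 1`: the
data from which both matrices of the duality, `lax` and `dual`, are built. -/
structure Oscillators (P : Type*) [Ring P] (N d : ℕ) where
  s : Fin N → ZMod 2
  ρ : Fin N → Fin d → P
  χ : Fin N → Fin d → P
  Δ : Fin N → Pˣ
  W : Fin d → Pˣ
  Δ_comm : ∀ i j, Commute (Δ i : P) (Δ j)
  Δ_ρ : ∀ i j a, Commute (Δ i : P) (ρ j a)
  Δ_χ : ∀ i j a, Commute (Δ i : P) (χ j a)
  W_ρ : ∀ a j b, Commute (W a : P) (ρ j b)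
  W_χ : ∀ a j b, Commute (W a : P) (χ j b)
  W_comm : ∀ a b, Commute (W a : P) (W b)
  Δ_W : ∀ i a, (Δ i : P) * W a = W a * Δ i + 1
  ρ_ρ : ∀ i a j b, ρ i a * ρ j b = (-1 : ℤˣ) ^ (s i * s j) • (ρ j b * ρ i a)
  ρ_mul_self : ∀ i, (-1 : ℤˣ) ^ s i = -1 → ∀ a, ρ i a * ρ i a = 0
  χ_χ : ∀ i a j b, χ i a * χ j b = (-1 : ℤˣ) ^ (s i * s j) • (χ j b * χ i a)
  χ_ρ : ∀ i a j b, χ i a * ρ j b = (-1 : ℤˣ) ^ (s i * s j) • (ρ j b * χ i a) +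
    if (i, a) = (j, b) then 1 else 0

namespace Oscillators

variable {P : Type*} [Ring P] {N d : ℕ} (O : Oscillators P N d)

/-- The matrix `W - ∑_{i < k} (-1)^{s i} χ_i (Δ i)⁻¹ ρ_i`, with `k` of the oscillators coupled. -/
def lax (k : ℕ) : Matrix (Fin d) (Fin d) P := Matrix.of fun a b =>
  Matrix.diagonal (fun a => (O.W a : P)) a b -
    ∑ i with i.val < k, (-1 : ℤˣ) ^ O.s i • (O.χ i a * ↑(O.Δ i)⁻¹ * O.ρ i b)

theorem lax_zero : O.lax 0 = Matrix.diagonal fun a => (O.W a : P) := by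
  ext a b
  simp [lax]

theorem lax_succ (k : Fin N) :
    O.lax (k + 1) = border ((-1) ^ O.s k) (O.lax k) (O.ρ k) (O.χ k) (O.Δ k) := by
  ext a b
  have hfilter : Finset.univ.filter (fun i : Fin N => i.val < k + 1) =
      insert k (Finset.univ.filter fun i : Fin N => i.val < k) := by
    ext i
    simp only [Finset.mem_filter, Finset.mem_univ, true_and, Finset.mem_insert, Fin.ext_iff]
    omega
  rw [lax, border, Matrix.of_apply, Matrix.of_apply, hfilter, Finset.sum_insert (by simp)]
  simp only [lax, Matrix.of_apply]
  abel

theorem commute_lax {k : ℕ} {z : P} (hW : ∀ a, Commute z (O.W a))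
    (h : ∀ i : Fin N, i.val < k → ∀ a b, Commute z (O.χ i a * ↑(O.Δ i)⁻¹ * O.ρ i b)) (a b : Fin d) :
    Commute z (O.lax k a b) := by
  refine Commute.sub_right ?_ (Commute.sum_right _ _ _ fun i hi =>
    (h i (Finset.mem_filter.1 hi).2 a b).smul_right _)
  rw [Matrix.diagonal_apply]
  split_ifs
  exacts [hW a, Commute.zero_right z]

theorem Δ_coupling (j i : Fin N) (a b : Fin d) :
    Commute (O.Δ j : P) (O.χ i a * ↑(O.Δ i)⁻¹ * O.ρ i b) :=
  ((O.Δ_χ j i a).mul_right (O.Δ_comm j i).units_inv_right).mul_right (O.Δ_ρ j i b)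

theorem commute_mul_mul_of_smul_comm {ε : ℤˣ} {z x y c : P} (hx : z * x = ε • (x * z))
    (hc : Commute z c) (hy : z * y = ε • (y * z)) : Commute z (x * c * y) :=
  calc z * (x * c * y) = ε • (x * (z * c) * y) := by
        rw [mul_assoc, ← mul_assoc, hx, smul_mul_assoc]; simp only [mul_assoc]
    _ = ε • (x * c * (z * y)) := by rw [hc.eq]; simp only [mul_assoc]
    _ = x * c * y * z := by
        rw [hy, mul_smul_comm, smul_smul, Int.units_mul_self, one_smul, mul_assoc (x * c)]

theorem ρ_mul_χ_of_ne {i j : Fin N} (h : i ≠ j) (a b : Fin d) :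
    O.ρ i a * O.χ j b = (-1 : ℤˣ) ^ (O.s i * O.s j) • (O.χ j b * O.ρ i a) := by
  rw [O.χ_ρ, if_neg fun hij => h (congrArg Prod.fst hij).symm, add_zero, smul_smul,
    mul_comm (O.s j), Int.units_mul_self, one_smul]

theorem χ_mul_ρ_of_ne {i j : Fin N} (h : i ≠ j) (a b : Fin d) :
    O.χ i a * O.ρ j b = (-1 : ℤˣ) ^ (O.s i * O.s j) • (O.ρ j b * O.χ i a) := by
  rw [O.χ_ρ, if_neg fun hij => h (congrArg Prod.fst hij), add_zero]

theorem bordering (k : Fin N) :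
    Bordering ((-1) ^ O.s k) (O.lax k) (O.ρ k) (O.χ k) (O.Δ k) where
  row_entry a b c := O.commute_lax (fun a => (O.W_ρ a k c).symm) (fun i hi _ _ =>
    commute_mul_mul_of_smul_comm (O.ρ_mul_χ_of_ne (Fin.ne_of_gt hi) _ _)
      (O.Δ_ρ i k c).units_inv_left.symm (O.ρ_ρ _ _ _ _)) a b
  col_entry a b c := O.commute_lax (fun a => (O.W_χ a k c).symm) (fun i hi _ _ =>
    commute_mul_mul_of_smul_comm (O.χ_χ _ _ _ _)
      (O.Δ_χ i k c).units_inv_left.symm (O.χ_mul_ρ_of_ne (Fin.ne_of_gt hi) _ _)) a b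
  corner_row b := O.Δ_ρ k k b
  corner_col a := O.Δ_χ k k a
  corner_entry a b := by
    have hsum : Commute (O.Δ k : P) (∑ i with i.val < k.val,
        (-1 : ℤˣ) ^ O.s i • (O.χ i a * ↑(O.Δ i)⁻¹ * O.ρ i b)) :=
      Commute.sum_right _ _ _ fun i _ => (O.Δ_coupling k i a b).smul_right _
    rw [lax, Matrix.of_apply, Matrix.diagonal_apply, mul_sub, hsum.eq, sub_mul, mul_ite, O.Δ_W]
    split_ifs
    · abel
    · simp
  row_row a b := by rw [O.ρ_ρ k a k b, zmod_two_mul_self]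
  row_mul_self := O.ρ_mul_self k
  col_col a b := by rw [O.χ_χ k a k b, zmod_two_mul_self]
  col_row a b := by rw [O.χ_ρ k a k b, zmod_two_mul_self]; simp

theorem isManin_lax {G : Type*} [Ring G] (F : Fermions G P d) {k : ℕ} (hk : k ≤ N) :
    F.IsManin (O.lax k) := by
  induction k with
  | zero => exact O.lax_zero ▸ Fermions.isManin_diagonal O.W_comm
  | succ k ih =>
    exact O.lax_succ ⟨k, hk⟩ ▸ (O.bordering ⟨k, hk⟩).isManin_border F (ih (Nat.le_of_succ_le hk))

theorem cdet_lax_zero_mul_prod {u : Fin N → Fin d → P}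
    (hu : ∀ k : Fin N, (O.lax k).mulVec (u k) = O.χ k) {θ : Fin N → Pˣ}
    (hθ : ∀ k, (θ k : P) = O.Δ k - (-1 : ℤˣ) ^ O.s k • ∑ b, O.ρ k b * u k b) :
    cdet (O.lax 0) * (List.ofFn fun k => (↑(θ k ^ (((-1 : ℤˣ) ^ O.s k : ℤˣ) : ℤ)) : P)).prod =
      (List.ofFn fun k => (↑(O.Δ k ^ (((-1 : ℤˣ) ^ O.s k : ℤˣ) : ℤ)) : P)).prod *
        cdet (O.lax N) := by
  refine mul_prod_ofFn_of_intertwine (fun k => cdet (O.lax k)) _ _ fun k => ?_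
  rw [O.lax_succ]
  exact (O.bordering k).cdet_mul_zpow (O.isManin_lax _ k.isLt.le) (hu k) (hθ k)

/-- The matrix `Δ - (-1)^s ρ W⁻¹ χ` over the oscillator indices. -/
def dual : Matrix (Fin N) (Fin N) P := Matrix.of fun i j =>
  Matrix.diagonal (fun i => (O.Δ i : P)) i j -
    (-1 : ℤˣ) ^ O.s i • ∑ a, O.ρ i a * ↑(O.W a)⁻¹ * O.χ j a

theorem dual_mulVec (y : Fin N → P) (i : Fin N) : O.dual.mulVec y i =
    O.Δ i * y i - (-1 : ℤˣ) ^ O.s i • ∑ a, O.ρ i a * (↑(O.W a)⁻¹ * ∑ j, O.χ j a * y j) := by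
  simp only [Matrix.mulVec, dotProduct, dual, Matrix.of_apply, sub_mul, Finset.sum_sub_distrib,
    Matrix.diagonal_apply, ite_mul, zero_mul, Finset.sum_ite_eq, Finset.mem_univ, if_true,
    smul_mul_assoc, ← Finset.smul_sum, Finset.sum_mul, Finset.mul_sum, mul_assoc]
  rw [Finset.sum_comm]

/-- The first `k` unknowns that solve the first `k` equations of `dual y = 0`, when `y k = 1`, all
later unknowns vanish and `W u = ∑ j, χ j * y j`. -/
def eliminated (k : Fin N) (u : Fin d → P) (j : Fin N) : P :=
  (if j < k then ↑(O.Δ j)⁻¹ * ((-1 : ℤˣ) ^ O.s j • ∑ b, O.ρ j b * u b) else 0) +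
    (Pi.single k 1 : Fin N → P) j

theorem sum_χ_mul_eliminated {k : Fin N} {u : Fin d → P} (hu : (O.lax k).mulVec u = O.χ k)
    (a : Fin d) : ∑ j, O.χ j a * O.eliminated k u j = O.W a * u a := by
  have hlax : (O.lax k).mulVec u a = O.W a * u a - ∑ j with j < k,
      O.χ j a * (↑(O.Δ j)⁻¹ * ((-1 : ℤˣ) ^ O.s j • ∑ b, O.ρ j b * u b)) := by
    simp only [Matrix.mulVec, dotProduct, lax, Matrix.of_apply, sub_mul, Finset.sum_sub_distrib,
      Matrix.diagonal_apply, ite_mul, zero_mul, Finset.sum_ite_eq, Finset.mem_univ, if_true,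
      smul_mul_assoc, mul_smul_comm, Finset.smul_sum, Finset.sum_mul, Finset.mul_sum, mul_assoc,
      Fin.lt_def]
    rw [Finset.sum_comm]
  rw [congrFun hu a, eq_sub_iff_add_eq] at hlax
  simp only [eliminated, mul_add, mul_ite, mul_zero, Finset.sum_add_distrib, Finset.sum_filter]
    at hlax ⊢
  rw [← hlax, add_comm]
  simp [Pi.single_apply]

theorem quasiminor_dual {k : Fin N}
    (hk : QuasidetDefined (leading O.dual k) (Fin.last k) (Fin.last k)) {u : Fin d → P}
    (hu : (O.lax k).mulVec u = O.χ k) :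
    quasiminor O.dual k = O.Δ k - (-1 : ℤˣ) ^ O.s k • ∑ b, O.ρ k b * u b := by
  refine quasiminor_eq_of_mulVec_eq_single hk (y := O.eliminated k u) (fun j hj => ?_) ?_
    fun i hi => ?_
  · simp [eliminated, hj.not_gt, hj.ne']
  · simp [eliminated]
  · rw [O.dual_mulVec]
    simp only [O.sum_χ_mul_eliminated hu, Units.inv_mul_cancel_left]
    rcases hi.lt_or_eq with hik | rfl
    · simp [eliminated, hik, hik.ne]
    · simp [eliminated]

end Oscillators

section PseudoDifferentialOperators

open MulOpposite
open scoped Nat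

namespace PseudoDiff

variable {A B : Type*} [Ring A] [Ring B]

variable (A) in
/-- The coefficient of `z^i ∂^j`, as an additive map. -/
def coeffHom (i j : ℤ) : PseudoDiff A →+ A where
  toFun f := f.coeff i j
  map_zero' := rfl
  map_add' _ _ := rfl

theorem coeff_sub (f g : PseudoDiff A) (i j : ℤ) :
    (f - g).coeff i j = f.coeff i j - g.coeff i j :=
  map_sub (coeffHom A i j) f g

theorem coeff_sum {κ : Type*} (s : Finset κ) (f : κ → PseudoDiff A) (i j : ℤ) :
    (∑ k ∈ s, f k).coeff i j = ∑ k ∈ s, (f k).coeff i j :=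
  map_sum (coeffHom A i j) f s

theorem coeff_mono (a : A) (i j M N : ℤ) :
    (mono a i j).coeff M N = if M = i ∧ N = j then a else 0 :=
  rfl

theorem coeff_mono_zero_mul (a : A) (i : ℤ) (f : PseudoDiff A) (M N : ℤ) :
    (mono a i 0 * f).coeff M N = a * f.coeff (M - i) N := by
  rw [coeff_mul, mulCoeff, finsum_eq_single _ (0, i, 0)]
  · simp [contr_zero, coeff_mono]
  · rintro ⟨t, k, l⟩ hx
    by_cases h : k = i ∧ l = 0
    · obtain ⟨rfl, rfl⟩ := h
      have ht : t ≠ 0 := by rintro rfl; exact hx rfl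
      simp [contr_zero_left _ _ ht]
    · simp [coeff_mono, h]

theorem coeff_mul_mono_zero (a : A) (j : ℤ) (f : PseudoDiff A) (M N : ℤ) :
    (f * mono a 0 j).coeff M N = f.coeff M (N - j) * a := by
  rw [coeff_mul, mulCoeff, finsum_eq_single _ (0, M, N - j)]
  · simp [contr_zero, coeff_mono]
  · rintro ⟨t, k, l⟩ hx
    by_cases h : M - k + t = 0 ∧ N - l + t = j
    · have ht : t ≠ 0 := by
        rintro rfl
        simp only [Nat.cast_zero] at h
        exact hx (by ext <;> simp <;> omega)
      simp [h.1, contr_zero_right _ _ ht]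
    · simp [coeff_mono, h]

theorem mono_zero_mul_mono (a b : A) (i k l : ℤ) :
    mono a i 0 * mono b k l = mono (a * b) (i + k) l := by
  refine ext_coeff fun M N => ?_
  simp only [coeff_mono_zero_mul, coeff_mono, mul_ite, mul_zero, sub_eq_iff_eq_add']

theorem mono_mul_mono_zero (a b : A) (i j l : ℤ) :
    mono a i j * mono b 0 l = mono (a * b) i (j + l) := by
  refine ext_coeff fun M N => ?_
  simp only [coeff_mul_mono_zero, coeff_mono, ite_mul, zero_mul, sub_eq_iff_eq_add]

theorem contr_one_left_of_one_lt (k : ℤ) {t : ℕ} (ht : 1 < t) : contr 1 k t = 0 := by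
  have h : Ring.choose (1 : ℤ) t = (Nat.choose 1 t : ℤ) := by
    exact_mod_cast Ring.choose_natCast (R := ℤ) 1 t
  rw [contr, h, Nat.choose_eq_zero_of_lt ht, Nat.cast_zero, zero_mul, zero_mul]

theorem contr_one (j k : ℤ) : contr j k 1 = j * k := by
  simp [contr]

theorem d_mul_z : (mono 1 0 1 : PseudoDiff A) * mono 1 1 0 = mono 1 1 0 * mono 1 0 1 + 1 := by
  refine ext_coeff fun M N => ?_
  rw [mono_zero_mul_mono, coeff_mul, mulCoeff, finsum_eq_sum_of_support_subset
    (s := {((0 : ℕ), (0 : ℤ), (1 : ℤ)), (1, 0, 1)})]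
  · rw [Finset.sum_pair (by simp)]
    by_cases hM : M = 0 <;> by_cases hN : N = 0 <;>
      simp [contr_zero, contr_one, coeff_one, coeff_mono, hM, hN, sub_eq_iff_eq_add]
  · rintro ⟨t, k, l⟩ hx
    have hk : k = 0 ∧ l = 1 := by
      by_contra h
      exact hx (by simp [coeff_mono, h])
    have ht : t ≤ 1 := by
      by_contra! h
      exact hx (by simp [hk.2, contr_one_left_of_one_lt _ h])
    obtain ⟨rfl, rfl⟩ := hk
    interval_cases t <;> simp

/-- Elements of `A` as constant pseudo-differential operators. -/
def const : A →+* PseudoDiff A where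
  toFun a := mono a 0 0
  map_one' := rfl
  map_zero' := ext_coeff fun i j => by simp [coeff_mono, coeff_zero]
  map_add' a b := ext_coeff fun i j => by simp only [coeff_mono, coeff_add]; split_ifs <;> simp
  map_mul' a b := by rw [mono_zero_mul_mono, zero_add]

theorem coeff_const_mul (a : A) (f : PseudoDiff A) (i j : ℤ) :
    (const a * f).coeff i j = a * f.coeff i j :=
  (coeff_mono_zero_mul a 0 f i j).trans (by rw [sub_zero])

theorem coeff_mul_const (a : A) (f : PseudoDiff A) (i j : ℤ) :
    (f * const a).coeff i j = f.coeff i j * a :=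
  (coeff_mul_mono_zero a 0 f i j).trans (by rw [sub_zero])

theorem commute_const {a : A} {f : PseudoDiff A} (h : ∀ i j, Commute a (f.coeff i j)) :
    Commute (const a) f :=
  ext_coeff fun i j => by rw [coeff_const_mul, coeff_mul_const, (h i j).eq]

theorem commute_mono_one_const (a : A) (i j : ℤ) : Commute (mono 1 i j) (const a) :=
  (commute_const fun k l => by
    rw [coeff_mono]; split_ifs; exacts [.one_right a, .zero_right a]).symm

/-- Coefficientwise extension of a ring homomorphism, as a ring homomorphism. -/
def mapHom (F : A →+* B) : PseudoDiff A →+* PseudoDiff B where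
  toFun := map F
  map_one' := ext_coeff fun i j =>
    (apply_ite F _ _ _).trans (by rw [map_one, map_zero, coeff_one])
  map_zero' := ext_coeff fun _ _ => map_zero F
  map_add' _ _ := ext_coeff fun _ _ => map_add F _ _
  map_mul' f g := ext_coeff fun M N => by
    obtain ⟨r, s, hf⟩ := bdd_coeff f
    obtain ⟨r', s', hg⟩ := bdd_coeff g
    refine ((F : A →+ B).map_finsum (finite_mul_support hf hg M N)).trans
      (finsum_congr fun x => ?_)
    exact (map_zsmul F _ _).trans (congrArg _ (map_mul F _ _))

theorem map_mono (F : A →+* B) (a : A) (i j : ℤ) : map F (mono a i j) = mono (F a) i j :=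
  ext_coeff fun _ _ => (apply_ite F _ _ _).trans (by rw [map_zero, coeff_mono])

theorem contr_comm (j k : ℤ) (t : ℕ) : contr j k t = contr k j t := by
  rw [contr, contr, mul_comm (Ring.choose j t)]

/-- The extension of an antihomomorphism `ω` of `A`, encoded as a homomorphism to the opposite
ring, to the antihomomorphism `swap ω` of pseudo-differential operators. -/
def swapHom (ω : A →+* Aᵐᵒᵖ) : PseudoDiff A →+* (PseudoDiff A)ᵐᵒᵖ where
  toFun f := op (swap ((opAddEquiv (α := A)).symm.toAddMonoidHom.comp (ω : A →+ Aᵐᵒᵖ)) f)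
  map_one' := congrArg op (ext_coeff fun i j =>
    (apply_ite (fun a => unop (ω a)) _ _ _).trans (by simp [coeff_one, and_comm]))
  map_zero' := congrArg op (ext_coeff fun _ _ => by simp [swap, coeff_zero])
  map_add' f g := congrArg op (ext_coeff fun _ _ => by simp [swap, coeff_add])
  map_mul' f g := congrArg op (ext_coeff fun M N => by
    obtain ⟨r, s, hf⟩ := bdd_coeff f
    obtain ⟨r', s', hg⟩ := bdd_coeff g
    -- The contraction of `∂^j` with `z^k` is symmetric in `j` and `k`, which `swap` exchanges.
    let e : ℕ × ℤ × ℤ ≃ ℕ × ℤ × ℤ :=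
      { toFun := fun x => (x.1, M - x.2.2 + x.1, N - x.2.1 + x.1)
        invFun := fun x => (x.1, N - x.2.2 + x.1, M - x.2.1 + x.1)
        left_inv := fun x => by simp [sub_add]
        right_inv := fun x => by simp [sub_add] }
    refine (((opAddEquiv (α := A)).symm.toAddMonoidHom.comp (ω : A →+ Aᵐᵒᵖ)).map_finsum
      (finite_mul_support hf hg N M)).trans (Eq.trans ?_ (finsum_comp_equiv e))
    refine finsum_congr fun x => ?_
    simp [e, swap, contr_comm x.2.2, sub_add, -zsmul_eq_mul])

theorem unop_swapHom_mono (ω : A →+* Aᵐᵒᵖ) (a : A) (i j : ℤ) :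
    unop (swapHom ω (mono a i j)) = mono (unop (ω a)) j i :=
  ext_coeff fun _ _ => (apply_ite (fun a => unop (ω a)) _ _ _).trans
    (by simp [coeff_mono, and_comm])

end PseudoDiff

end PseudoDifferentialOperators

section Filtration

namespace PseudoDiff

variable (A : Type*) [Ring A]

/-- The operators with nonpositive exponents of `z` and `∂` and total degree at most `-T`. -/
def filtration (T : ℤ) : AddSubgroup (PseudoDiff A) where
  carrier := {f | ∀ i j, (0 < i ∨ 0 < j ∨ -T < i + j) → f.coeff i j = 0}
  zero_mem' _ _ _ := rfl
  add_mem' hf hg i j h := by rw [coeff_add, hf i j h, hg i j h, add_zero]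
  neg_mem' hf i j h := by rw [coeff_neg, hf i j h, neg_zero]

variable {A}

theorem filtration_antitone : Antitone (filtration A) :=
  fun _ _ h _ hf i j hij => hf i j (by omega)

theorem mul_mem_filtration {S T : ℤ} {f g : PseudoDiff A} (hf : f ∈ filtration A S)
    (hg : g ∈ filtration A T) : f * g ∈ filtration A (S + T) := by
  refine fun M N h => finsum_eq_zero_of_forall_eq_zero fun ⟨t, i, j⟩ => ?_
  by_contra hx
  have hfg := right_ne_zero_of_smul hx
  have h₁ := mt (hf i j) (left_ne_zero_of_mul hfg)
  have h₂ := mt (hg (M - i + t) (N - j + t)) (right_ne_zero_of_mul hfg)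
  omega

theorem mono_mem_filtration {T : ℤ} (a : A) {i j : ℤ} (hi : i ≤ 0) (hj : j ≤ 0)
    (hij : i + j ≤ -T) : mono a i j ∈ filtration A T :=
  fun _ _ _ => if_neg (by omega)

theorem one_mem_filtration : (1 : PseudoDiff A) ∈ filtration A 0 :=
  mono_mem_filtration 1 le_rfl le_rfl (by simp)

theorem negSeries_mem_filtration (a : ℕ → A) : negSeries a ∈ filtration A 0 :=
  fun _ _ _ => if_neg (by omega)

theorem eq_zero_of_forall_mem_filtration {f : PseudoDiff A}
    (h : ∀ T : ℕ, f ∈ filtration A T) : f = 0 :=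
  ext_coeff fun i j => h ((-(i + j)).toNat + 1) i j (by omega)

theorem matrix_mul_mem_filtration {κ : Type*} [Fintype κ] {S T : ℤ}
    {M N : Matrix κ κ (PseudoDiff A)}
    (hM : M ∈ (filtration A S).matrix) (hN : N ∈ (filtration A T).matrix) :
    M * N ∈ (filtration A (S + T)).matrix :=
  fun a b => sum_mem fun c _ => mul_mem_filtration (hM a c) (hN c b)

theorem matrix_diagonal_mem_filtration {κ : Type*} [DecidableEq κ] {T : ℤ} {f : κ → PseudoDiff A}
    (h : ∀ a, f a ∈ filtration A T) : Matrix.diagonal f ∈ (filtration A T).matrix := fun a b => by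
  rw [Matrix.diagonal_apply]
  split_ifs
  exacts [h a, zero_mem _]

theorem matrix_one_mem_filtration {κ : Type*} [DecidableEq κ] :
    (1 : Matrix κ κ (PseudoDiff A)) ∈ (filtration A 0).matrix :=
  matrix_diagonal_mem_filtration fun _ => one_mem_filtration

variable {κ : Type*} [Fintype κ] [DecidableEq κ]

theorem matrix_pow_mem_filtration {N : Matrix κ κ (PseudoDiff A)}
    (hN : N ∈ (filtration A 1).matrix) (t : ℕ) : N ^ t ∈ (filtration A t).matrix := by
  induction t with
  | zero => exact matrix_one_mem_filtration
  | succ t ih => exact_mod_cast pow_succ N t ▸ matrix_mul_mem_filtration ih hN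

theorem exists_geometric_series {N : Matrix κ κ (PseudoDiff A)}
    (hN : N ∈ (filtration A 1).matrix) :
    ∃ B : Matrix κ κ (PseudoDiff A),
      ∀ T : ℕ, B - ∑ t ∈ Finset.range T, N ^ t ∈ (filtration A T).matrix := by
  have hpow := matrix_pow_mem_filtration hN
  refine ⟨.of fun a b =>
    ⟨fun i j => ∑ t ∈ Finset.range ((-(i + j)).toNat + 1), ((N ^ t) a b).coeff i j, 0, 0,
      fun i j h => Finset.sum_eq_zero fun t _ => hpow t a b i j (by omega)⟩,
    fun T a b i j h => ?_⟩
  rw [Matrix.sub_apply, Matrix.sum_apply, Matrix.of_apply, coeff_sub, coeff_sum, sub_eq_zero]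
  dsimp only
  by_cases hij : 0 < i ∨ 0 < j
  · rw [Finset.sum_eq_zero fun t _ => hpow t a b i j (by omega),
      Finset.sum_eq_zero fun t _ => hpow t a b i j (by omega)]
  · refine Finset.sum_subset (fun t ht => ?_) fun t _ ht => hpow t a b i j ?_ <;>
      rw [Finset.mem_range] at * <;> omega

theorem exists_unit_eq_one_sub {N : Matrix κ κ (PseudoDiff A)}
    (hN : N ∈ (filtration A 1).matrix) :
    ∃ u : (Matrix κ κ (PseudoDiff A))ˣ, (u : Matrix κ κ (PseudoDiff A)) = 1 - N ∧
      (↑u⁻¹ - 1 : Matrix κ κ (PseudoDiff A)) ∈ (filtration A 1).matrix := by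
  obtain ⟨B, hB⟩ := exists_geometric_series hN
  have hpow := matrix_pow_mem_filtration hN
  have h1N : 1 - N ∈ (filtration A 0).matrix :=
    sub_mem matrix_one_mem_filtration fun a b => filtration_antitone zero_le_one (hN a b)
  have eq_one {M : Matrix κ κ (PseudoDiff A)}
      (h : ∀ T : ℕ, M - 1 + N ^ T ∈ (filtration A T).matrix) : M = 1 := by
    refine sub_eq_zero.mp (Matrix.ext fun a b => eq_zero_of_forall_mem_filtration fun T => ?_)
    simpa using (filtration A T).sub_mem (h T a b) (hpow T a b)
  refine ⟨⟨1 - N, B, eq_one fun T => ?_, eq_one fun T => ?_⟩, rfl, by simpa using hB 1⟩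
  · have := matrix_mul_mem_filtration h1N (hB T)
    rwa [mul_sub, mul_neg_geom_sum, zero_add, ← sub_add] at this
  · have := matrix_mul_mem_filtration (hB T) h1N
    rwa [sub_mul, geom_sum_mul_neg, add_zero, ← sub_add] at this

theorem isUnit_one_sub {f : PseudoDiff A} (hf : f ∈ filtration A 1) : IsUnit (1 - f) := by
  obtain ⟨u, hu, -⟩ :=
    exists_unit_eq_one_sub (κ := Unit) (N := .of fun _ _ => f) fun _ _ => hf
  exact (hu ▸ u.isUnit).map (Matrix.uniqueAlgEquiv (R := ℤ))

theorem isUnit_and_isUnit_inverse_apply_of_scalar_sub_mem {v : (PseudoDiff A)ˣ}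
    (hv : (↑v⁻¹ : PseudoDiff A) ∈ filtration A 1) {L : Matrix κ κ (PseudoDiff A)}
    (hL : Matrix.scalar κ (v : PseudoDiff A) - L ∈ (filtration A 0).matrix) :
    IsUnit L ∧ ∀ a, IsUnit (Ring.inverse L a a) := by
  let V : (Matrix κ κ (PseudoDiff A))ˣ := Units.map (Matrix.scalar κ : PseudoDiff A →+* _) v
  have hN : V⁻¹.val * (V.val - L) ∈ (filtration A 1).matrix := fun a b => by
    have h := mul_mem_filtration hv (hL a b)
    rw [add_zero] at h
    exact ((Matrix.diagonal_mul (fun _ => (↑v⁻¹ : PseudoDiff A)) _ a b).symm ▸ h :)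
  obtain ⟨u, hu, hu'⟩ := exists_unit_eq_one_sub hN
  have hVu : (↑(V * u) : Matrix κ κ (PseudoDiff A)) = L := by
    rw [Units.val_mul, hu, mul_sub, Units.mul_inv_cancel_left, mul_one, sub_sub_cancel]
  refine ⟨hVu ▸ (V * u).isUnit, fun a => ?_⟩
  have h : Ring.inverse L a a = (↑u⁻¹ : Matrix κ κ (PseudoDiff A)) a a * ↑v⁻¹ := by
    rw [← hVu, Ring.inverse_unit, mul_inv_rev, Units.val_mul]
    exact Matrix.mul_diagonal _ _ _ _
  have h₁ := (filtration A 1).neg_mem (hu' a a)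
  rw [Matrix.sub_apply, Matrix.one_apply_eq, neg_sub] at h₁
  rw [h, ← sub_sub_self 1 ((↑u⁻¹ : Matrix κ κ (PseudoDiff A)) a a)]
  exact (isUnit_one_sub h₁).mul v⁻¹.isUnit

theorem isUnit_of_sub_mem_filtration {v : (PseudoDiff A)ˣ}
    (hv : (↑v⁻¹ : PseudoDiff A) ∈ filtration A 1) {f : PseudoDiff A}
    (hf : ↑v - f ∈ filtration A 0) : IsUnit f :=
  ((isUnit_and_isUnit_inverse_apply_of_scalar_sub_mem (κ := Unit) hv
    (L := .of fun _ _ => f) fun _ _ => hf).1).map (Matrix.uniqueAlgEquiv (R := ℤ))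

end PseudoDiff

end Filtration

section RationalFunctions

namespace PseudoDiff

open MulOpposite

variable {A B : Type*} [Ring A] [Ring B]

theorem coeff_negSeries (a : ℕ → A) (i j : ℤ) :
    (negSeries a).coeff i j = if i < 0 ∧ j = 0 then a (-i - 1).toNat else 0 :=
  rfl

theorem map_negSeries (F : A →+* B) (a : ℕ → A) :
    map F (negSeries a) = negSeries fun r => F (a r) :=
  ext_coeff fun _ _ => (apply_ite F _ _ _).trans (by rw [map_zero, coeff_negSeries])

theorem const_mem_filtration (a : A) : const a ∈ filtration A 0 :=
  mono_mem_filtration a le_rfl le_rfl (by simp)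

variable (A) in
/-- The unit `z`. -/
def zUnit : (PseudoDiff A)ˣ where
  val := mono 1 1 0
  inv := mono 1 (-1) 0
  val_inv := by rw [mono_zero_mul_mono, mul_one]; rfl
  inv_val := by rw [mono_zero_mul_mono, mul_one]; rfl

variable (A) in
/-- The unit `∂`. -/
def dUnit : (PseudoDiff A)ˣ where
  val := mono 1 0 1
  inv := mono 1 0 (-1)
  val_inv := by rw [mono_mul_mono_zero, mul_one]; rfl
  inv_val := by rw [mono_mul_mono_zero, mul_one]; rfl

theorem zUnit_inv_mem_filtration : (↑(zUnit A)⁻¹ : PseudoDiff A) ∈ filtration A 1 :=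
  mono_mem_filtration 1 (by norm_num) le_rfl (by norm_num)

theorem dUnit_inv_mem_filtration : (↑(dUnit A)⁻¹ : PseudoDiff A) ∈ filtration A 1 :=
  mono_mem_filtration 1 le_rfl (by norm_num) (by norm_num)

theorem dUnit_mul_zUnit :
    (dUnit A : PseudoDiff A) * zUnit A = zUnit A * dUnit A + 1 :=
  d_mul_z

variable [Algebra ℂ A] [Algebra ℂ B]

theorem zSub_eq (c : ℂ) : zSub A c = zUnit A - const (algebraMap ℂ A c) :=
  rfl

theorem dSub_eq (c : ℂ) : dSub A c = dUnit A - const (algebraMap ℂ A c) :=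
  rfl

theorem negSeries_sum_pow_smul {κ : Type*} [Fintype κ] (c : κ → ℂ) (a : κ → A) :
    negSeries (fun r => ∑ k, c k ^ r • a k) = ∑ k, const (a k) * zSubInv A (c k) := by
  refine ext_coeff fun i j => ?_
  simp only [coeff_sum, coeff_const_mul, zSubInv, coeff_negSeries]
  split_ifs
  · exact Finset.sum_congr rfl fun k _ => by rw [Algebra.smul_def, Algebra.commutes]
  · simp

theorem zSub_mul_zSubInv (c : ℂ) : zSub A c * zSubInv A c = 1 := by
  refine ext_coeff fun i j => ?_
  rw [zSub_eq, sub_mul, coeff_sub, zUnit, coeff_mono_zero_mul, coeff_const_mul, one_mul, coeff_one,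
    zSubInv, coeff_negSeries, coeff_negSeries]
  rcases eq_or_ne j 0 with rfl | hj
  · rcases lt_trichotomy i 0 with h | rfl | h
    · have hi : (-(i - 1) - 1).toNat = (-i - 1).toNat + 1 := by omega
      rw [hi, pow_succ']
      simp [h, h.ne, (sub_one_lt i).trans h]
    · simp
    · simp [h.ne', h.not_gt, show ¬ i - 1 < 0 by omega]
  · simp [hj]

theorem commute_const_algebraMap (c : ℂ) (f : PseudoDiff A) :
    Commute (const (algebraMap ℂ A c)) f :=
  commute_const fun _ _ => Algebra.commutes _ _

theorem commute_zSub_const (c : ℂ) (a : A) : Commute (zSub A c) (const a) :=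
  (commute_mono_one_const a 1 0).sub_left (commute_const_algebraMap c _)

theorem commute_dSub_const (c : ℂ) (a : A) : Commute (dSub A c) (const a) :=
  (commute_mono_one_const a 0 1).sub_left (commute_const_algebraMap c _)

theorem commute_zSub_zSub (b c : ℂ) : Commute (zSub A b) (zSub A c) :=
  ((Commute.refl _).sub_left (commute_const_algebraMap b _)).sub_right
    (commute_const_algebraMap c _).symm

theorem commute_dSub_dSub (b c : ℂ) : Commute (dSub A b) (dSub A c) :=
  ((Commute.refl _).sub_left (commute_const_algebraMap b _)).sub_right
    (commute_const_algebraMap c _).symm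

theorem dSub_mul_zSub (b c : ℂ) : dSub A b * zSub A c = zSub A c * dSub A b + 1 := by
  rw [dSub_eq, zSub_eq, sub_mul, mul_sub, mul_sub, sub_mul, mul_sub, mul_sub, dUnit_mul_zUnit,
    (commute_const_algebraMap b (zUnit A : PseudoDiff A)).eq,
    (commute_const_algebraMap c (dUnit A : PseudoDiff A)).eq,
    (commute_const_algebraMap b (const (algebraMap ℂ A c))).eq]
  abel

theorem zUnit_sub_zSub_mem_filtration (c : ℂ) : ↑(zUnit A) - zSub A c ∈ filtration A 0 := by
  rw [zSub_eq, sub_sub_cancel]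
  exact const_mem_filtration _

theorem dUnit_sub_dSub_mem_filtration (c : ℂ) : ↑(dUnit A) - dSub A c ∈ filtration A 0 := by
  rw [dSub_eq, sub_sub_cancel]
  exact const_mem_filtration _

theorem isUnit_zSub (c : ℂ) : IsUnit (zSub A c) :=
  isUnit_of_sub_mem_filtration zUnit_inv_mem_filtration (zUnit_sub_zSub_mem_filtration c)

theorem isUnit_dSub (c : ℂ) : IsUnit (dSub A c) :=
  isUnit_of_sub_mem_filtration dUnit_inv_mem_filtration (dUnit_sub_dSub_mem_filtration c)

variable (A) in
/-- The unit `z - c`. -/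
def zSubUnit (c : ℂ) : (PseudoDiff A)ˣ :=
  (isUnit_zSub c).unit

variable (A) in
/-- The unit `∂ - c`. -/
def dSubUnit (c : ℂ) : (PseudoDiff A)ˣ :=
  (isUnit_dSub c).unit

theorem inv_zSubUnit (c : ℂ) : ↑(zSubUnit A c)⁻¹ = zSubInv A c :=
  Units.inv_eq_of_mul_eq_one_right (zSub_mul_zSubInv c)

theorem mapHom_dSub (F : A →ₐ[ℂ] B) (c : ℂ) :
    mapHom (F : A →+* B) (dSub A c) = dSub B c := by
  rw [dSub, map_sub]
  exact congrArg₂ _ ((map_mono _ _ _ _).trans (by rw [map_one]))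
    ((map_mono _ _ _ _).trans (by rw [AlgHom.coe_toRingHom, F.commutes]))

section Swap

variable (ω : A →ₐ[ℂ] Aᵐᵒᵖ)

theorem unop_swapHom_const (a : A) :
    unop (swapHom (ω : A →+* Aᵐᵒᵖ) (const a)) = const (unop (ω a)) :=
  unop_swapHom_mono _ _ _ _

theorem unop_swapHom_zSub (c : ℂ) : unop (swapHom (ω : A →+* Aᵐᵒᵖ) (zSub A c)) = dSub A c := by
  rw [zSub, map_sub, unop_sub, unop_swapHom_mono, unop_swapHom_mono]
  simp [dSub]

theorem unop_swapHom_dSub (c : ℂ) : unop (swapHom (ω : A →+* Aᵐᵒᵖ) (dSub A c)) = zSub A c := by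
  rw [dSub, map_sub, unop_sub, unop_swapHom_mono, unop_swapHom_mono]
  simp [zSub]

theorem unop_swapHom_zSubInv (c : ℂ) :
    unop (swapHom (ω : A →+* Aᵐᵒᵖ) (zSubInv A c)) = ↑(dSubUnit A c)⁻¹ := by
  refine (Units.inv_eq_of_mul_eq_one_left ?_).symm
  change _ * dSub A c = 1
  rw [← unop_swapHom_zSub ω, ← unop_mul, ← map_mul, zSub_mul_zSubInv, map_one, unop_one]

theorem unop_swapHom_mem_filtration {T : ℤ} {f : PseudoDiff A} (hf : f ∈ filtration A T) :
    unop (swapHom (ω : A →+* Aᵐᵒᵖ) f) ∈ filtration A T :=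
  fun i j h => (congrArg (fun a => unop (ω a)) (hf j i (by omega))).trans (by simp)

end Swap

end PseudoDiff

end RationalFunctions

section Homomorphisms

open MulOpposite

theorem map_ringInverse {M N F : Type*} [MonoidWithZero M] [MonoidWithZero N] [FunLike F M N]
    [MonoidHomClass F M N] (f : F) {a : M} (ha : IsUnit a) :
    f (Ring.inverse a) = Ring.inverse (f a) := by
  obtain ⟨u, rfl⟩ := ha
  exact (congrArg f (Ring.inverse_unit u)).trans (Ring.inverse_unit (Units.map (f : M →* N) u)).symm

variable {P Q : Type*} [Ring P] [Ring Q] {k : ℕ}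

theorem QuasidetDefined.map (f : P →+* Q) {M : Matrix (Fin k) (Fin k) P} {i j : Fin k}
    (h : QuasidetDefined M i j) : QuasidetDefined (M.map f) i j :=
  ⟨h.1.map f.mapMatrix, map_ringInverse f.mapMatrix h.1 ▸ h.2.map f⟩

theorem quasidet_map (f : P →+* Q) {M : Matrix (Fin k) (Fin k) P} {i j : Fin k}
    (h : QuasidetDefined M i j) : quasidet (M.map f) i j = f (quasidet M i j) := by
  rw [quasidet, quasidet, map_ringInverse f h.2]
  exact congrArg (fun B : Matrix (Fin k) (Fin k) Q => Ring.inverse (B j i))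
    (map_ringInverse f.mapMatrix h.1).symm

theorem SufficientlyInvertible.map (f : P →+* Q) {M : Matrix (Fin k) (Fin k) P}
    (h : SufficientlyInvertible M) : SufficientlyInvertible (M.map f) :=
  fun i => (h i).map f

theorem map_Ber (f : P →+* Q) (s : Fin k → ZMod 2) {M : Matrix (Fin k) (Fin k) P}
    (h : SufficientlyInvertible M) : f (Ber s M) = Ber s (M.map f) := by
  have hq i : quasiminor (M.map f) i = f (quasiminor M i) := quasidet_map f (h i)
  rw [Ber, Ber, map_list_prod, List.map_ofFn]
  congr! 3 with i
  exact (apply_ite f _ _ _).trans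
    (by rw [hq, map_ringInverse f (show IsUnit (quasiminor M i) from (h i).isUnit_quasidet)])

theorem Ber_eq_prod_zpow (s : Fin k → ZMod 2)
    {M : Matrix (Fin k) (Fin k) P} {θ : Fin k → Pˣ} (h : ∀ i, (θ i : P) = quasiminor M i) :
    Ber s M = (List.ofFn fun i => (↑(θ i ^ (((-1 : ℤˣ) ^ s i : ℤˣ) : ℤ)) : P)).prod := by
  rw [Ber]
  congr! 3 with i
  rw [← h, Ring.inverse_unit]
  rcases (show ∀ a : ZMod 2, a = 0 ∨ a = 1 by decide) (s i) with hi | hi <;> simp [hi]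

theorem map_cdet (f : P →+* Q) (M : Matrix (Fin k) (Fin k) P) : f (cdet M) = cdet (M.map f) := by
  simp only [cdet, map_sum, map_zsmul, map_list_prod, List.map_ofFn, Function.comp_def,
    Matrix.map_apply]

theorem ofFn_comp_rev {α : Type*} (f : Fin k → α) :
    (List.ofFn fun i => f i.rev) = (List.ofFn f).reverse :=
  List.ext_getElem (by simp) fun i _ _ => by simp [Fin.rev, Nat.sub_sub, Nat.add_comm]

theorem prod_ofFn_rev_of_commute {f : Fin k → P} (h : ∀ i j, Commute (f i) (f j)) :
    (List.ofFn fun i => f i.rev).prod = (List.ofFn f).prod :=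
  ofFn_comp_rev f ▸
    ((List.reverse_perm _).symm.prod_eq' (List.pairwise_ofFn.2 fun i j _ => h i j)).symm

theorem unop_map_prod_ofFn (f : P →+* Qᵐᵒᵖ) (x : Fin k → P) :
    unop (f (List.ofFn x).prod) = (List.ofFn fun i => unop (f (x i.rev))).prod := by
  rw [map_list_prod, unop_list_prod, List.map_map, List.map_ofFn,
    ← ofFn_comp_rev]
  rfl

theorem unop_map_cdet (f : P →+* Qᵐᵒᵖ) (M : Matrix (Fin k) (Fin k) P) :
    unop (f (cdet M)) = cdet (Matrix.of fun a b => unop (f (M a.rev b.rev))) := by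
  simp only [cdet, map_sum, map_zsmul, Finset.unop_sum, unop_smul, unop_map_prod_ofFn]
  refine Fintype.sum_equiv (MulAut.conj (Fin.revPerm : Equiv.Perm (Fin k))).toEquiv _ _ fun σ => ?_
  congr 2
  · simp [mul_right_comm _ (Equiv.Perm.sign σ)]
  · simp [MulAut.conj_apply]

theorem cdet_diagonal (w : Fin k → P) : cdet (Matrix.diagonal w) = (List.ofFn w).prod := by
  rw [cdet, Finset.sum_eq_single 1 (fun σ _ hσ => ?_) (by simp)]
  · simp
  · obtain ⟨i, hi⟩ := not_forall.1 (mt Equiv.ext hσ)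
    have hmem : (0 : P) ∈ List.ofFn fun i => Matrix.diagonal w (σ i) i :=
      List.mem_ofFn.2 ⟨i, Matrix.diagonal_apply_ne w hi⟩
    rw [List.prod_eq_zero hmem, smul_zero]

theorem semiconjBy_cdet {x : P} {M M' : Matrix (Fin k) (Fin k) P}
    (h : ∀ a b, SemiconjBy x (M a b) (M' a b)) : SemiconjBy x (cdet M) (cdet M') := by
  simp only [cdet, SemiconjBy, Finset.mul_sum, Finset.sum_mul, mul_smul_comm, smul_mul_assoc]
  exact Finset.sum_congr rfl fun σ _ =>
    congrArg _ (mul_prod_ofFn_of_intertwine (fun _ => x) _ _ fun i => h _ _)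

end Homomorphisms

theorem prod_mul_eq_add_mul_prod {P : Type*} [Ring P] {Z : P} {k : ℕ} {f e : Fin k → P}
    (h : ∀ i, f i * Z = (Z + e i) * f i) (hc : ∀ i j, Commute (f i) (e j)) :
    (List.ofFn f).prod * Z = (Z + ∑ i, e i) * (List.ofFn f).prod := by
  induction k with
  | zero => simp
  | succ k ih =>
    have hs : Commute (f 0) (∑ i : Fin k, e i.succ) := Commute.sum_right _ _ _ fun i _ => hc _ _
    rw [List.ofFn_succ, List.prod_cons, mul_assoc, ih (fun i => h i.succ) fun i j => hc _ _,
      Fin.sum_univ_succ, ← mul_assoc, mul_add, h, hs.eq, ← add_mul, mul_assoc, add_assoc]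

theorem zpow_units_mul_of_mul_eq_add_one {P : Type*} [Ring P] {Δ : Pˣ} {W : P}
    (h : (Δ : P) * W = W * Δ + 1) (ε : ℤˣ) :
    (↑(Δ ^ (ε : ℤ)) : P) * W = (W + ε • ↑Δ⁻¹) * ↑(Δ ^ (ε : ℤ)) := by
  rcases Int.units_eq_one_or ε with rfl | rfl
  · simp [h, add_mul]
  · rw [Units.val_neg, Units.val_one, zpow_neg_one, Units.inv_mul_eq_iff_eq_mul, Units.neg_smul,
      one_smul, ← mul_assoc, mul_add, h]
    simp [mul_assoc]

namespace Oscillators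

variable {P : Type*} [Ring P] {N d k : ℕ} (O : Oscillators P N d)

/-- The product of the `Δ (e i) ^ ±1`, with the sign given by the parity of `e i`. -/
def parityProd (e : Fin k → Fin N) : P :=
  (List.ofFn fun i => (↑(O.Δ (e i) ^ (((-1 : ℤˣ) ^ O.s (e i) : ℤˣ) : ℤ)) : P)).prod

theorem commute_parityProd (e : Fin k → Fin N) {x : P} (h : ∀ i, Commute (O.Δ i : P) x) :
    Commute (O.parityProd e) x :=
  Commute.list_prod_left _ _ fun _ hy => by
    obtain ⟨i, rfl⟩ := List.mem_ofFn.1 hy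
    exact (h (e i)).units_zpow_left _

theorem parityProd_mul_W (e : Fin k → Fin N) (a : Fin d) :
    O.parityProd e * O.W a =
      (O.W a + ∑ i, (-1 : ℤˣ) ^ O.s (e i) • (↑(O.Δ (e i))⁻¹ : P)) * O.parityProd e :=
  prod_mul_eq_add_mul_prod (fun _ => zpow_units_mul_of_mul_eq_add_one (O.Δ_W _ a) _) fun _ _ =>
    ((O.Δ_comm _ _).units_inv_right.units_zpow_left _).smul_right _

theorem parityProd_mul_lax (e : Fin k → Fin N) (K : ℕ) (a b : Fin d) :
    SemiconjBy (O.parityProd e) (O.lax K a b) (O.lax K a b +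
      if a = b then ∑ i, (-1 : ℤˣ) ^ O.s (e i) • (↑(O.Δ (e i))⁻¹ : P) else 0) := by
  have hS : Commute (O.parityProd e) (∑ i with i.val < K,
      (-1 : ℤˣ) ^ O.s i • (O.χ i a * ↑(O.Δ i)⁻¹ * O.ρ i b)) :=
    O.commute_parityProd e fun j => Commute.sum_right _ _ _ fun i _ =>
      (O.Δ_coupling j i a b).smul_right _
  rw [SemiconjBy, lax, Matrix.of_apply, Matrix.diagonal_apply, mul_sub, hS.eq, mul_ite,
    parityProd_mul_W]
  split_ifs <;> noncomm_ring

end Oscillators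

namespace PseudoDiff

open MulOpposite

variable {A : Type*} [Ring A]

theorem const_units_smul (ε : ℤˣ) (a : A) :
    const (ε • a) = ε • const a :=
  map_zsmul const (ε : ℤ) a

variable [Algebra ℂ A]

theorem commute_inv_zSubUnit_const (c : ℂ) (a : A) :
    Commute (↑(zSubUnit A c)⁻¹ : PseudoDiff A) (const a) :=
  (show Commute (zSubUnit A c : PseudoDiff A) _ from commute_zSub_const c a).units_inv_left

theorem commute_inv_dSubUnit_const (c : ℂ) (a : A) :
    Commute (↑(dSubUnit A c)⁻¹ : PseudoDiff A) (const a) :=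
  (show Commute (dSubUnit A c : PseudoDiff A) _ from commute_dSub_const c a).units_inv_left

theorem commute_inv_dSubUnit_inv_dSubUnit (b c : ℂ) :
    Commute (↑(dSubUnit A b)⁻¹ : PseudoDiff A) ↑(dSubUnit A c)⁻¹ :=
  (show Commute (dSubUnit A b : PseudoDiff A) (dSubUnit A c) from
    commute_dSub_dSub b c).units_inv_left.units_inv_right

theorem unop_swapHom_prod_zSub (ω : A →ₐ[ℂ] Aᵐᵒᵖ) {k : ℕ} (x : Fin k → ℂ) :
    unop (swapHom (ω : A →+* Aᵐᵒᵖ) (List.ofFn fun i => zSub A (x i)).prod) =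
      (List.ofFn fun i => dSub A (x i)).prod := by
  simp only [unop_map_prod_ofFn, unop_swapHom_zSub]
  exact prod_ofFn_rev_of_commute fun _ _ => commute_dSub_dSub _ _

theorem unop_swapHom_prod_zSubInv (ω : A →ₐ[ℂ] Aᵐᵒᵖ) {k : ℕ} (x : Fin k → ℂ) :
    unop (swapHom (ω : A →+* Aᵐᵒᵖ) (List.ofFn fun i => zSubInv A (x i)).prod) =
      (List.ofFn fun i => (↑(dSubUnit A (x i))⁻¹ : PseudoDiff A)).prod := by
  simp only [unop_map_prod_ofFn, unop_swapHom_zSubInv]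
  exact prod_ofFn_rev_of_commute (f := fun i => (↑(dSubUnit A (x i))⁻¹ : PseudoDiff A))
    fun _ _ => commute_inv_dSubUnit_inv_dSubUnit _ _

theorem unop_swapHom_prod_zSub_mul_prod_zSubInv (ω : A →ₐ[ℂ] Aᵐᵒᵖ) {k l : ℕ} (x : Fin k → ℂ)
    (y : Fin l → ℂ) :
    unop (swapHom (ω : A →+* Aᵐᵒᵖ)
      ((List.ofFn fun i => zSub A (x i)).prod * (List.ofFn fun j => zSubInv A (y j)).prod)) =
      (List.ofFn fun i => dSub A (x i)).prod *
        (List.ofFn fun j => (↑(dSubUnit A (y j))⁻¹ : PseudoDiff A)).prod := by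
  rw [map_mul, unop_mul, unop_swapHom_prod_zSub, unop_swapHom_prod_zSubInv]
  refine (Commute.list_prod_left _ _ fun _ hf => Commute.list_prod_right _ _ fun _ hg => ?_).eq
  obtain ⟨j, rfl⟩ := List.mem_ofFn.1 hf
  obtain ⟨i, rfl⟩ := List.mem_ofFn.1 hg
  exact (show Commute (dSubUnit A (y j) : PseudoDiff A) _ from commute_dSub_dSub _ _).units_inv_left

end PseudoDiff

namespace Oscillators

variable {P : Type*} [Ring P] {N d k l : ℕ} (O : Oscillators P N d)

theorem parityProd_append (e : Fin (k + l) → Fin N) :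
    O.parityProd e = O.parityProd (e ∘ Fin.castAdd l) * O.parityProd (e ∘ Fin.natAdd k) := by
  rw [parityProd, List.ofFn_add, List.prod_append]
  rfl

theorem parityProd_of_even {e : Fin k → Fin N} (h : ∀ i, O.s (e i) = 0) :
    O.parityProd e = (List.ofFn fun i => (O.Δ (e i) : P)).prod := by
  simp [parityProd, h]

theorem parityProd_of_odd {e : Fin k → Fin N} (h : ∀ i, O.s (e i) = 1) :
    O.parityProd e = (List.ofFn fun i => (↑(O.Δ (e i))⁻¹ : P)).prod := by
  simp [parityProd, h]

end Oscillators

theorem superSign_smul {A : Type*} [Ring A] [Algebra ℂ A] (a : ZMod 2) (x : A) :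
    superSign a • x = (-1 : ℤˣ) ^ a • x := by
  fin_cases a
  · exact (one_smul ℂ x).trans (one_smul ℤˣ x).symm
  · exact (neg_one_smul ℂ x).trans (by rw [← one_smul ℤˣ x, ← Units.neg_smul, one_smul]; rfl)

section Duality

open PseudoDiff MulOpposite

variable (p q m n d : ℕ) (z : Fin (p + q + m + n) → ℂ) (w : Fin d → ℂ)

theorem rowOp_mul_rowOp (i j : Fin (p + q + m + n)) (a b : Fin d) :
    rowOp p q m n d i a * rowOp p q m n d j b =
      (-1 : ℤˣ) ^ (superType p q m n i * superType p q m n j) •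
        (rowOp p q m n d j b * rowOp p q m n d i a) :=
  (row_row p q m n d (i, a) (j, b)).trans (superSign_smul (A := WeylD p q m n d) _ _)

theorem colOp_mul_colOp (i j : Fin (p + q + m + n)) (a b : Fin d) :
    colOp p q m n d i a * colOp p q m n d j b =
      (-1 : ℤˣ) ^ (superType p q m n i * superType p q m n j) •
        (colOp p q m n d j b * colOp p q m n d i a) :=
  (col_col p q m n d (i, a) (j, b)).trans (superSign_smul (A := WeylD p q m n d) _ _)

theorem colOp_mul_rowOp (i j : Fin (p + q + m + n)) (a b : Fin d) :
    colOp p q m n d i a * rowOp p q m n d j b =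
      (-1 : ℤˣ) ^ (superType p q m n i * superType p q m n j) •
        (rowOp p q m n d j b * colOp p q m n d i a) + if (i, a) = (j, b) then 1 else 0 :=
  (col_row p q m n d (i, a) (j, b)).trans
    (congrArg (· + _) (superSign_smul (A := WeylD p q m n d) _ _))

theorem rowOp_mul_self {i : Fin (p + q + m + n)} (hi : (-1 : ℤˣ) ^ superType p q m n i = -1)
    (a : Fin d) : rowOp p q m n d i a * rowOp p q m n d i a = 0 := by
  have h := rowOp_mul_rowOp p q m n d i i a a
  rw [zmod_two_mul_self, hi, Units.neg_smul, one_smul] at h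
  have : IsAddTorsionFree (WeylD p q m n d) := .of_isTorsionFree ℂ _
  exact self_eq_neg.1 h

/-- The oscillators on `𝔻((z⁻¹, ∂⁻¹))` given by `rowOp` and `colOp`, with `Δ i = ∂ - z i` and
`W a = z - w a`. The indices `a` are reversed, to undo the reversal of the columns of `cdet` by the
antihomomorphism `ω`. -/
def oscillators : Oscillators (PseudoDiff (WeylD p q m n d)) (p + q + m + n) d where
  s := superType p q m n
  ρ i a := const (rowOp p q m n d i a.rev)
  χ i a := const (colOp p q m n d i a.rev)
  Δ i := dSubUnit _ (z i)
  W a := zSubUnit _ (w a.rev)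
  Δ_comm _ _ := commute_dSub_dSub _ _
  Δ_ρ _ _ _ := commute_dSub_const _ _
  Δ_χ _ _ _ := commute_dSub_const _ _
  W_ρ _ _ _ := commute_zSub_const _ _
  W_χ _ _ _ := commute_zSub_const _ _
  W_comm _ _ := commute_zSub_zSub _ _
  Δ_W _ _ := dSub_mul_zSub _ _
  ρ_ρ _ _ _ _ := by rw [← map_mul, rowOp_mul_rowOp, const_units_smul, map_mul]
  ρ_mul_self _ hi _ := by rw [← map_mul, rowOp_mul_self p q m n d hi, map_zero]
  χ_χ _ _ _ _ := by rw [← map_mul, colOp_mul_colOp, const_units_smul, map_mul]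
  χ_ρ _ _ _ _ := by
    rw [← map_mul, colOp_mul_rowOp, map_add, const_units_smul, map_mul, apply_ite const, map_one,
      map_zero]
    simp only [Prod.mk.injEq, Fin.rev_inj]

theorem inv_dSubUnit_mem_filtration {κ : Type} [DecidableEq κ] (s : κ → ZMod 2) (c : ℂ) :
    ↑(dSubUnit (Weyl s) c)⁻¹ ∈ filtration (Weyl s) 0 :=
  unop_swapHom_zSubInv (Weyl.omegaHom s) c ▸
    unop_swapHom_mem_filtration (Weyl.omegaHom s) (negSeries_mem_filtration _)

theorem isUnit_lax (k : ℕ) : IsUnit ((oscillators p q m n d z w).lax k) := by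
  refine (isUnit_and_isUnit_inverse_apply_of_scalar_sub_mem zUnit_inv_mem_filtration
    fun a b => ?_).1
  rw [Matrix.sub_apply, Oscillators.lax, Matrix.of_apply, ← sub_add]
  refine add_mem ?_ (sum_mem fun i _ => zsmul_mem (mul_mem_filtration (mul_mem_filtration
    (const_mem_filtration _) (inv_dSubUnit_mem_filtration _ (z i))) (const_mem_filtration _)) _)
  rw [Matrix.scalar_apply, ← Matrix.sub_apply, Matrix.diagonal_sub]
  exact matrix_diagonal_mem_filtration (fun a => zUnit_sub_zSub_mem_filtration _) a b

theorem scalar_sub_leading_Lsuper_mem_filtration (k : Fin (p + q + m + n)) :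
    Matrix.scalar (Fin (k + 1)) (dUnit (CurrentEnv (superType p q m n)) : PseudoDiff _) -
      leading (Lsuper p q m n z) k ∈ (filtration _ 0).matrix := fun i j => by
  have hL : leading (Lsuper p q m n z) k i j =
      Matrix.diagonal (fun i => dSub _ (z (Fin.castLE k.isLt i))) i j - negSeries fun r =>
        superSign (superType p q m n (Fin.castLE k.isLt i)) •
          CurrentEnv.E _ (Fin.castLE k.isLt i) (Fin.castLE k.isLt j) r := by
    simp [leading, Lsuper, Matrix.diagonal_apply]
  rw [Matrix.sub_apply, hL, ← sub_add, Matrix.scalar_apply, ← Matrix.sub_apply,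
    Matrix.diagonal_sub]
  exact add_mem (matrix_diagonal_mem_filtration (fun _ => dUnit_sub_dSub_mem_filtration _) i j)
    (negSeries_mem_filtration _)

theorem sufficientlyInvertible_Lsuper : SufficientlyInvertible (Lsuper p q m n z) := fun k =>
  have h := isUnit_and_isUnit_inverse_apply_of_scalar_sub_mem dUnit_inv_mem_filtration
    (scalar_sub_leading_Lsuper_mem_filtration p q m n z k)
  ⟨h.1, h.2 _⟩

theorem negSeries_varphi (i j : Fin (p + q + m + n)) :
    negSeries (fun r => varphi p q m n d w
      (superSign (superType p q m n i) • CurrentEnv.E (superType p q m n) i j r)) =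
      (-1 : ℤˣ) ^ superType p q m n i • ∑ a : Fin d, const (rowOp p q m n d i a.rev) *
        ↑(zSubUnit (WeylD p q m n d) (w a.rev))⁻¹ * const (colOp p q m n d j a.rev) := by
  simp only [map_smul, varphi_E, varphiGen, Finset.smul_sum, smul_comm (superSign _)]
  rw [negSeries_sum_pow_smul, ← Equiv.sum_comp Fin.revPerm]
  refine Finset.sum_congr rfl fun a _ => ?_
  rw [Fin.revPerm_apply, ← inv_zSubUnit, mul_assoc, (commute_inv_zSubUnit_const _ _).eq,
    ← mul_assoc, ← map_mul, ← smul_mul_assoc ((-1 : ℤˣ) ^ _), ← const_units_smul]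
  congr 2
  exact superSign_smul (A := WeylD p q m n d) _ _

theorem map_Lsuper : (Lsuper p q m n z).map (mapHom (varphi p q m n d w : _ →+* WeylD p q m n d)) =
    (oscillators p q m n d z w).dual := by
  ext1 i j
  rw [Matrix.map_apply, Lsuper, map_sub, Oscillators.dual, Matrix.of_apply, Matrix.diagonal_apply,
    apply_ite (mapHom _), mapHom_dSub, map_zero]
  exact congrArg _ ((map_negSeries _ _).trans (negSeries_varphi p q m n d w i j))

/-- The coefficient of `z_i^k` in `phiGen z a b k`. -/
def phiCoeff (i : Fin (p + q + m + n)) (a b : Fin d) : WeylD p q m n d :=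
  if (i : ℕ) < p + q then -(Weyl.var _ (i, b) * Weyl.der _ (i, a))
  else Weyl.var _ (i, a) * Weyl.der _ (i, b)

theorem phiGen_eq_sum_phiCoeff (a b : Fin d) (k : ℕ) :
    phiGen p q m n d z a b k = ∑ i, z i ^ k • phiCoeff p q m n d i a b := by
  rw [phiGen, Finset.sum_filter, Finset.sum_filter, ← Finset.sum_neg_distrib,
    ← Finset.sum_add_distrib]
  refine Finset.sum_congr rfl fun i _ => ?_
  rw [phiCoeff]
  split_ifs
  · omega
  · rw [add_zero, smul_neg]
  · rw [neg_zero, zero_add]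
  · omega

theorem omega_phiCoeff (i : Fin (p + q + m + n)) (a b : Fin d) :
    Weyl.omega _ (phiCoeff p q m n d i a b) = (-1 : ℤˣ) ^ superType p q m n i •
      (colOp p q m n d i a * rowOp p q m n d i b -
        if a = b ∧ p + q ≤ (i : ℕ) then 1 else 0) := by
  rcases lt_or_ge (i : ℕ) (p + q) with hi | hi
  · have hcol : colOp p q m n d i a = (-1 : ℤˣ) ^ superType p q m n i • -Weyl.var _ (i, a) := by
      rw [colOp, if_pos hi, superSign_add, mul_smul, show superSign 1 = -1 from rfl]
      exact (superSign_smul (A := WeylD p q m n d) _ _).trans (congrArg _ (neg_one_smul ℂ _))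
    rw [phiCoeff, if_pos hi, map_neg, Weyl.omega_mul, Weyl.omega_var, Weyl.omega_der, hcol, rowOp,
      if_pos hi, if_neg fun h => hi.not_ge h.2, sub_zero, smul_mul_assoc, smul_smul,
      Int.units_mul_self, one_smul]
    exact (neg_mul (α := WeylD p q m n d) _ _).symm
  · have h := colOp_mul_rowOp p q m n d i i a b
    rw [zmod_two_mul_self] at h
    rw [phiCoeff, if_neg hi.not_gt, Weyl.omega_mul, Weyl.omega_var, Weyl.omega_der, h]
    simp [hi, hi.not_gt, smul_smul, rowOp, colOp]

/-- The index in `superType` of the variables `y_i`. -/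
def yIndex (i : Fin (p + q)) : Fin (p + q + m + n) :=
  ⟨i, by omega⟩

/-- The index in `superType` of the variables `x_i`. -/
def xIndex (i : Fin (m + n)) : Fin (p + q + m + n) :=
  ⟨p + q + i, by omega⟩

theorem sum_ite_le {M : Type*} [AddCommMonoid M] (f : Fin (p + q + m + n) → M) :
    (∑ i : Fin (p + q + m + n), if p + q ≤ (i : ℕ) then f i else 0) =
      ∑ i, f (xIndex p q m n i) := by
  refine (Fintype.sum_of_injective (xIndex p q m n) (fun i j h => ?_) _ _ (fun i hi => ?_)
    fun i => ?_).symm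
  · simpa [xIndex, Fin.ext_iff] using h
  · refine if_neg fun h => hi ⟨⟨i - (p + q), by omega⟩, Fin.ext ?_⟩
    exact Nat.add_sub_of_le h
  · exact (if_pos (Nat.le_add_right _ _)).symm

/-- The anti-involution `ω` of `𝔻((z⁻¹, ∂⁻¹))`, as a homomorphism to the opposite ring. -/
abbrev swapOmega : PseudoDiff (WeylD p q m n d) →+* (PseudoDiff (WeylD p q m n d))ᵐᵒᵖ :=
  swapHom (Weyl.omegaHom fun u : Fin (p + q + m + n) × Fin d => superType p q m n u.1 :
    WeylD p q m n d →ₐ[ℂ] (WeylD p q m n d)ᵐᵒᵖ)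

theorem unop_swapOmega_phiCoeff_mul_zSubInv (i : Fin (p + q + m + n)) (a b : Fin d) :
    unop (swapOmega p q m n d (const (phiCoeff p q m n d i a b) * zSubInv _ (z i))) =
      (-1 : ℤˣ) ^ superType p q m n i • (const (colOp p q m n d i a) *
        (↑(dSubUnit (WeylD p q m n d) (z i))⁻¹ : PseudoDiff _) * const (rowOp p q m n d i b)) -
      if a = b then if p + q ≤ (i : ℕ) then
        (-1 : ℤˣ) ^ superType p q m n i •
          (↑(dSubUnit (WeylD p q m n d) (z i))⁻¹ : PseudoDiff _) else 0 else 0 := by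
  have hω : unop (swapOmega p q m n d (const (phiCoeff p q m n d i a b))) =
      (-1 : ℤˣ) ^ superType p q m n i • const (colOp p q m n d i a * rowOp p q m n d i b -
        if a = b ∧ p + q ≤ (i : ℕ) then 1 else 0) :=
    (unop_swapHom_const _ _).trans ((congrArg const (omega_phiCoeff p q m n d i a b)).trans
      (const_units_smul _ _))
  rw [map_mul, unop_mul, unop_swapHom_zSubInv, hω, mul_smul_comm, map_sub, map_mul, mul_sub,
    ← mul_assoc, (commute_inv_dSubUnit_const _ _).eq, smul_sub, apply_ite const, map_one,
    map_zero, ite_and, mul_ite]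
  congr 1
  split_ifs <;> simp

theorem unop_swapOmega_negSeries_phi (a b : Fin d) :
    unop (swapOmega p q m n d (negSeries fun k => phi p q m n d z (CurrentEnv.E _ a b k))) =
      (∑ i, (-1 : ℤˣ) ^ superType p q m n i • (const (colOp p q m n d i a) *
        (↑(dSubUnit (WeylD p q m n d) (z i))⁻¹ : PseudoDiff _) * const (rowOp p q m n d i b))) -
      if a = b then ∑ i : Fin (m + n), (-1 : ℤˣ) ^ superType p q m n (xIndex p q m n i) •
        (↑(dSubUnit (WeylD p q m n d) (z (xIndex p q m n i)))⁻¹ : PseudoDiff _) else 0 := by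
  simp only [phi_E, phiGen_eq_sum_phiCoeff, negSeries_sum_pow_smul, map_sum, Finset.unop_sum,
    unop_swapOmega_phiCoeff_mul_zSubInv, Finset.sum_sub_distrib]
  congr 1
  split_ifs
  · exact sum_ite_le p q m n _
  · exact Finset.sum_const_zero

theorem unop_swapOmega_map_Lgl (a b : Fin d) :
    unop (swapOmega p q m n d (mapHom (phi p q m n d z : _ →+* WeylD p q m n d)
      (Lgl w a.rev b.rev))) =
      (oscillators p q m n d z w).lax (p + q + m + n) a b +
        if a = b then ∑ i : Fin (m + n), (-1 : ℤˣ) ^ superType p q m n (xIndex p q m n i) •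
          (↑(dSubUnit (WeylD p q m n d) (z (xIndex p q m n i)))⁻¹ : PseudoDiff _) else 0 := by
  have hneg := congrArg (fun f => unop (swapOmega p q m n d f))
    (map_negSeries (phi p q m n d z : _ →+* WeylD p q m n d)
      fun k => CurrentEnv.E (fun _ : Fin d => 0) a.rev b.rev k)
  replace hneg := hneg.trans (unop_swapOmega_negSeries_phi p q m n d z a.rev b.rev)
  rw [Lgl, map_sub, map_sub, unop_sub, Oscillators.lax, Matrix.of_apply,
    Finset.filter_true_of_mem fun i _ => i.isLt, sub_add, Matrix.diagonal_apply]
  simp only [Fin.rev_inj] at hneg ⊢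
  refine congrArg₂ (· - ·) ?_ hneg
  split_ifs
  · rw [mapHom_dSub, unop_swapHom_dSub]; rfl
  · simp

theorem unop_swapOmega_ratR :
    unop (swapOmega p q m n d (ratR p q m n d z)) =
      (oscillators p q m n d z w).parityProd (yIndex p q m n) := by
  rw [Oscillators.parityProd_append, Oscillators.parityProd_of_even, Oscillators.parityProd_of_odd]
  · exact unop_swapHom_prod_zSub_mul_prod_zSubInv _ _ _
  · intro i
    simp [oscillators, superType, yIndex]
  · intro i
    simp [oscillators, superType, yIndex]

theorem unop_swapOmega_ratRPrime :
    unop (swapOmega p q m n d (ratRPrime p q m n d z)) =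
      (oscillators p q m n d z w).parityProd (xIndex p q m n) := by
  rw [Oscillators.parityProd_append, Oscillators.parityProd_of_even, Oscillators.parityProd_of_odd]
  · simp only [Function.comp_apply, xIndex, Fin.val_natAdd, ← add_assoc]
    exact unop_swapHom_prod_zSub_mul_prod_zSubInv _ _ _
  · intro i
    have hi : ¬ (p + q + (m + (i : ℕ)) < p ∨
        p + q ≤ p + q + (m + (i : ℕ)) ∧ p + q + (m + (i : ℕ)) < p + q + m) := by omega
    exact if_neg hi
  · intro i
    simp [oscillators, superType, xIndex]

theorem parityProd_id : (oscillators p q m n d z w).parityProd id =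
    (oscillators p q m n d z w).parityProd (yIndex p q m n) *
      (oscillators p q m n d z w).parityProd (xIndex p q m n) := by
  have hx : xIndex p q m n ∘ Fin.natAdd m = Fin.natAdd (p + q + m) :=
    funext fun j => Fin.ext (Nat.add_assoc _ _ _).symm
  rw [Oscillators.parityProd_append, Oscillators.parityProd_append,
    Oscillators.parityProd_append _ (xIndex p q m n), hx, mul_assoc]
  rfl

theorem swap_map_phi_cdet :
    swap (Weyl.omega _) (ratRPrime p q m n d z *
      PseudoDiff.map (phi p q m n d z : _ →+* WeylD p q m n d) (cdet (Lgl w)) *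
      ratR p q m n d z) =
      (oscillators p q m n d z w).parityProd id *
        cdet ((oscillators p q m n d z w).lax (p + q + m + n)) := by
  have hcdet : unop (swapOmega p q m n d (mapHom (phi p q m n d z : _ →+* WeylD p q m n d)
      (cdet (Lgl w)))) * (oscillators p q m n d z w).parityProd (xIndex p q m n) =
      (oscillators p q m n d z w).parityProd (xIndex p q m n) *
        cdet ((oscillators p q m n d z w).lax (p + q + m + n)) := by
    rw [map_cdet, unop_map_cdet]
    refine (semiconjBy_cdet fun a b => ?_).eq.symm
    exact (Oscillators.parityProd_mul_lax _ _ _ a b).trans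
      (congrArg (· * _) (unop_swapOmega_map_Lgl p q m n d z w a b).symm)
  calc _ = unop (swapOmega p q m n d (ratRPrime p q m n d z * mapHom _ _ * ratR p q m n d z)) := rfl
    _ = _ := by
      rw [map_mul, map_mul, unop_mul, unop_mul, unop_swapOmega_ratR _ _ _ _ _ _ w,
        unop_swapOmega_ratRPrime _ _ _ _ _ _ w, hcdet, ← mul_assoc, ← parityProd_id]

theorem cdet_lax_zero : cdet ((oscillators p q m n d z w).lax 0) =
    (List.ofFn fun a => zSub (WeylD p q m n d) (w a)).prod := by
  rw [Oscillators.lax_zero, cdet_diagonal]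
  exact prod_ofFn_rev_of_commute fun _ _ => commute_zSub_zSub _ _

theorem zSub_prod_mul_map_Ber :
    (List.ofFn fun a => zSub (WeylD p q m n d) (w a)).prod *
      PseudoDiff.map (varphi p q m n d w : _ →+* WeylD p q m n d)
        (Ber (superType p q m n) (Lsuper p q m n z)) =
      (oscillators p q m n d z w).parityProd id *
        cdet ((oscillators p q m n d z w).lax (p + q + m + n)) := by
  have hL := sufficientlyInvertible_Lsuper p q m n z
  have hdual : SufficientlyInvertible (oscillators p q m n d z w).dual :=
    map_Lsuper p q m n d z w ▸ hL.map _
  have hu (k : Fin (p + q + m + n)) : ((oscillators p q m n d z w).lax k).mulVec ((Ring.inverse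
      ((oscillators p q m n d z w).lax k)).mulVec ((oscillators p q m n d z w).χ k)) =
      (oscillators p q m n d z w).χ k := by
    rw [Matrix.mulVec_mulVec, Ring.mul_inverse_cancel _ (isUnit_lax p q m n d z w k),
      Matrix.one_mulVec]
  have hθ k : IsUnit (quasiminor (oscillators p q m n d z w).dual k) := (hdual k).isUnit_quasidet
  have key := Oscillators.cdet_lax_zero_mul_prod _ hu (θ := fun k => (hθ k).unit)
    fun k => Oscillators.quasiminor_dual _ (hdual k) (hu k)
  rw [← cdet_lax_zero p q m n d z]
  refine (congrArg _ ((map_Ber (mapHom _) _ hL).trans ?_)).trans key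
  rw [map_Lsuper]
  exact Ber_eq_prod_zpow _ fun _ => rfl

end Duality

end BetheDuality

end

theorem proposition4p6 (p q m n d : ℕ) (z : Fin (p + q + m + n) → ℂ) (w : Fin d → ℂ) :
    SufficientlyInvertible (Lsuper p q m n z) ∧
    (List.ofFn fun a : Fin d => PseudoDiff.zSub (WeylD p q m n d) (w a)).prod *
        PseudoDiff.map (varphi p q m n d w : _ →+* WeylD p q m n d)
          (Ber (superType p q m n) (Lsuper p q m n z)) =
      PseudoDiff.swap (Weyl.omega _)
        (ratRPrime p q m n d z *
          PseudoDiff.map (phi p q m n d z : _ →+* WeylD p q m n d) (cdet (Lgl w)) *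
          ratR p q m n d z) :=
  ⟨sufficientlyInvertible_Lsuper p q m n z,
    (zSub_prod_mul_map_Ber p q m n d z w).trans (swap_map_phi_cdet p q m n d z w).symm⟩
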